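/- Let $\mathbb F$ be a field, $p\ge 2$, $\mu\in S^{p-1}\subset\mathbb R^p$ and $\kappa\ge 0$. Let $\nu$ be the uniform probability measure on $S^{p-1}$ and let $$f(x)=d(\kappa)\,\exp\{\kappa(x^t\mu)^2\},\qquad x\in S^{p-1},$$ be the Watson density, where $d(\kappa)>0$ is the normalizing constant with $\int f\,d\nu=1$. Let $C_*$ denote singular chains with coefficients in $\mathbb F$. The Morse filtration of $C_*(S^{p-1})$ is $\mathcal F_r=C_*(\{f\le r\})$, $r\in[-\infty,\infty]$. The Čech filtration is $0$ for $r<0$, and for $r\in[0,\infty]$ its $k$-chains are $C_0(S^{p-1})$ for $k=0$ and $\mathrm{Const}_k+C_k(\{f\ge 1/r\})$ for $k\ge1$, where $\mathrm{Const}_k$ is spanned by the constant singular $k$-simplices ($1/0=\infty$, $1/\infty=0$). The persistence interval $I_\alpha$ of a $k$-cycle $\alpha$ is the set of $r$ with $\alpha\in\mathcal F_r$ and $[\alpha]\ne0$ in $H_k(\mathcal F_r)$. The Betti–$k$ barcode of a filtration consists of given intervals (with multiplicity; empty intervals contribute nothing) if they are the persistence intervals of the members of a finite set $S$ of $k$-cycles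 such that, for every $r$, the classes $[\alpha]$ with $\alpha\in S$, $r\in I_\alpha$ form a basis of $H_k(\mathcal F_r)$. Then $\min f=d(\kappa)$, $\max f=d(\kappa)e^{\kappa}$, and: 1. (Morse filtration, $p>2$) The Betti–$0$, Betti–$(p-2)$ and Betti–$(p-1)$ barcodes consist of the single intervals $[\min f,\infty]$, $[\min f,\max f)$ and $[\max f,\infty]$, respectively, and all other Betti barcodes are empty. (For $\kappa=0$ the interval $[\min f,\max f)$ is empty.) 2. (Morse filtration, $p=2$) The Betti–$0$ barcode consists of the two intervals $[\min f,\infty]$ and $[\min f,\max f)$, the Betti–$1$ barcode of the single interval $[\max f,\infty]$, and all other Betti barcodes are empty. 3. (Čech filtration) The Betti–$(p-1)$ barcode consists of the single interval $[1/\min f,\infty]$, and the Betti–$k$ barcodes for all other $k\ge1$ are empty. 4. (Betti–$0$ function) Let $g(r)=\int_{\{f\ge 1/r\}}f\,d\nu$ for $r\in[0,\infty]$ and $\beta_0(x)=\inf\{r : g(r)\ge x\}$ for $0<x\le1$. If $\kappa>0$, then $g$ restricts to a continuous strictly increasing bijection from $[1/\max f,1/\min f]$ onto $[0,1]$, and $\beta_0(x)=g^{-1}(x)\in[1/\max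 f,1/\min f]$ for all $0<x\le 1$. For $r\in[1/\max f,1/\min f]$, $$g(r)=G(\alpha(r)),\quad G(t)=2\,\frac{s_{p-2}}{s_{p-1}}\int_0^{t}d(\kappa)e^{\kappa\cos^2\theta}\sin^{p-2}\theta\,d\theta,\quad \alpha(r)=\cos^{-1}\sqrt{-\tfrac1\kappa\ln(d(\kappa)r)},$$ where $s_{n}=2\pi^{(n+1)/2}/\Gamma((n+1)/2)$. The graph of $\beta_0$ on $(0,1]$ is the set of the points $\left(G(t),\,e^{-\kappa\cos^2t}/d(\kappa)\right)$, $t\in(0,\pi/2]$. -/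

import Mathlib

open CategoryTheory AlgebraicTopology MeasureTheory
open scoped ENNReal

universe u

noncomputable section

namespace Persistence

/-! ### Filtered chain complexes, persistent homology and barcodes over a field -/

/-- An increasing filtration, indexed by the extended reals, of a chain complex `K` of vector
spaces by subcomplexes. -/
structure Filtration {F : Type u} [Field F] (K : ChainComplex (ModuleCat.{u} F) ℕ) where
  /-- the `k`-chains of the subcomplex at level `r` -/
  chains (r : EReal) (k : ℕ) : Submodule F (K.X k)
  mono {r r' : EReal} (h : r ≤ r') (k : ℕ) : chains r k ≤ chains r' k
  d_mem (r : EReal) (i j : ℕ) {c : K.X i} (hc : c ∈ chains r i) :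
    (K.d i j).hom c ∈ chains r j

/-- The `k`-cycles of the whole complex. For `k = 0` the map `K.d 0 (0 - 1) = K.d 0 0` is zero,
so that every `0`-chain is a cycle. -/
def allCycles {F : Type u} [Field F] (K : ChainComplex (ModuleCat.{u} F) ℕ) (k : ℕ) :
    Submodule F (K.X k) :=
  LinearMap.ker (K.d k (k - 1)).hom

namespace Filtration

variable {F : Type u} [Field F] {K : ChainComplex (ModuleCat.{u} F) ℕ} (𝓕 : Filtration K)

/-- The `k`-cycles of the subcomplex at level `r`. -/
def cycles (r : EReal) (k : ℕ) : Submodule F (K.X k) :=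
  allCycles K k ⊓ 𝓕.chains r k

/-- The `k`-boundaries of the subcomplex at level `r`. -/
def boundaries (r : EReal) (k : ℕ) : Submodule F (K.X k) :=
  (𝓕.chains r (k + 1)).map (K.d (k + 1) k).hom

/-- The `k`-th homology of the subcomplex at level `r`: cycles modulo boundaries. -/
abbrev homology (r : EReal) (k : ℕ) : Type u :=
  𝓕.cycles r k ⧸ (𝓕.boundaries r k).submoduleOf (𝓕.cycles r k)

/-- The homology class at level `r` of a cycle lying in the subcomplex at level `r`. -/
def homologyClass (r : EReal) (k : ℕ) (c : 𝓕.cycles r k) : 𝓕.homology r k :=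
  Submodule.Quotient.mk c

/-- The persistence `k`-homology interval of a cycle `c`: the set of all levels `r` at which `c`
represents a nonzero homology class. -/
def persistenceInterval (k : ℕ) (c : allCycles K k) : Set EReal :=
  {r | ∃ h : (c : K.X k) ∈ 𝓕.cycles r k, 𝓕.homologyClass r k ⟨c, h⟩ ≠ 0}

/-- A family of intervals `J c`, indexed by a set `S` of `k`-cycles, is a Betti-`k` barcode if each
`J c` is a subinterval of the persistence interval of `c` and, at each level `r`, the classes of
those `c` in `S` with `r ∈ J c` form a basis of the `k`-th homology at level `r`. -/
structure IsBettiBarcode (k : ℕ) (S : Set (allCycles K k)) (J : allCycles K k → Set EReal) :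
    Prop where
  ordConnected (c) (hc : c ∈ S) : (J c).OrdConnected
  subinterval (c) (hc : c ∈ S) : J c ⊆ 𝓕.persistenceInterval k c
  basis (r : EReal) : ∃ b : Module.Basis {c // c ∈ S ∧ r ∈ J c} F (𝓕.homology r k),
    ∀ c, ∃ h : (c.1 : K.X k) ∈ 𝓕.cycles r k, b c = 𝓕.homologyClass r k ⟨c.1, h⟩

/-- The Betti-`k` barcode of `𝓕` consists of the intervals in `B` (with multiplicity): there is a
finite set `S` of cycles whose *full* persistence intervals form a Betti-`k` barcode and are the
members of `B`. Asking for the full intervals makes the persistent homology in degree `k` the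
direct sum of the interval modules of the members of `B`, so a persistence interval cannot be cut
into shorter bars; empty intervals contribute nothing. -/
def HasBettiBarcode (k : ℕ) (B : Multiset (Set EReal)) : Prop :=
  ∃ S : Finset (allCycles K k),
    𝓕.IsBettiBarcode k S (𝓕.persistenceInterval k) ∧ S.val.map (𝓕.persistenceInterval k) = B

end Filtration

/-! ### The Morse and Čech filtrations of the singular chain complex defined by a density -/

/-- The singular chain complex of `X` with coefficients in the field `F`. -/
abbrev singularChains (F : Type u) [Field F] (X : Type) [TopologicalSpace X] :
    ChainComplex (ModuleCat.{u} F) ℕ :=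
  ((singularChainComplexFunctor (ModuleCat.{u} F)).obj (ModuleCat.of F F)).obj (TopCat.of X)

section

variable (F : Type u) [Field F] {X : Type} [TopologicalSpace X]

/-- The map of singular chain complexes induced by the inclusion of a subspace. -/
def inclusionMap (A : Set X) : singularChains F A ⟶ singularChains F X :=
  ((singularChainComplexFunctor (ModuleCat.{u} F)).obj (ModuleCat.of F F)).map
    (TopCat.ofHom ⟨Subtype.val, continuous_subtype_val⟩)

/-- `C_k(A)` as a subspace of `C_k(X)`, for a subspace `A` of `X`. -/
def subspaceChains (A : Set X) (k : ℕ) : Submodule F ((singularChains F X).X k) :=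
  LinearMap.range ((inclusionMap F A).f k).hom

theorem subspaceChains_mono {A B : Set X} (h : A ⊆ B) (k : ℕ) :
    subspaceChains F A k ≤ subspaceChains F B k := by
  have hf : inclusionMap F A =
      ((singularChainComplexFunctor (ModuleCat.{u} F)).obj (ModuleCat.of F F)).map
        (TopCat.ofHom ⟨Set.inclusion h, continuous_inclusion h⟩) ≫ inclusionMap F B := by
    unfold inclusionMap
    rw [← Functor.map_comp]
    rfl
  rintro _ ⟨c, rfl⟩
  rw [hf]
  exact ⟨_, rfl⟩

theorem subspaceChains_d_mem (A : Set X) (i j : ℕ) {c : (singularChains F X).X i}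
    (hc : c ∈ subspaceChains F A i) :
    ((singularChains F X).d i j).hom c ∈ subspaceChains F A j := by
  obtain ⟨a, rfl⟩ := hc
  refine ⟨((singularChains F A).d i j).hom a, ?_⟩
  have := (inclusionMap F A).comm i j
  exact (congrArg (fun φ => φ.hom a) this).symm

variable (X) in
/-- The span of the constant singular `k`-simplices: a singular simplex is constant exactly if it
is a singular simplex of a one-point subspace. All `0`-simplices are constant, so that
`constChains F X 0` is all of `C_0(X)`. -/
def constChains (k : ℕ) : Submodule F ((singularChains F X).X k) :=
  ⨆ x : X, subspaceChains F {x} k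

theorem constChains_d_mem (i j : ℕ) {c : (singularChains F X).X i}
    (hc : c ∈ constChains F X i) :
    ((singularChains F X).d i j).hom c ∈ constChains F X j := by
  have : constChains F X i ≤ (constChains F X j).comap ((singularChains F X).d i j).hom :=
    iSup_le fun x _ hy => (le_iSup (fun x : X => subspaceChains F {x} j) x)
      (subspaceChains_d_mem F {x} i j hy)
  exact this hc

end

/-- The sublevel set `{f ≤ r}`. -/
def sublevel {X : Type} (f : X → ℝ≥0∞) (r : EReal) : Set X :=
  {x | (f x : EReal) ≤ r}

/-- The superlevel set `{f ≥ 1 / r}` for `r ∈ [0, ∞]`, where `1 / 0 = ∞` and `1 / ∞ = 0`. -/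
def superlevel {X : Type} (f : X → ℝ≥0∞) (r : ℝ≥0∞) : Set X :=
  {x | r⁻¹ ≤ f x}

theorem superlevel_mono {X : Type} (f : X → ℝ≥0∞) {r r' : ℝ≥0∞} (h : r ≤ r') :
    superlevel f r ⊆ superlevel f r' :=
  fun _ hx => (ENNReal.inv_le_inv.2 h).trans hx

section

variable (F : Type u) [Field F] {X : Type} [TopologicalSpace X] (f : X → ℝ≥0∞)

/-- The Morse filtration: at level `r` the subcomplex `C_*({f ≤ r})`. -/
def morseFiltration : Filtration (singularChains F X) where
  chains r k := subspaceChains F (sublevel f r) k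
  mono h k := subspaceChains_mono F (fun _ hx => le_trans hx h) k
  d_mem r i j _ hc := subspaceChains_d_mem F (sublevel f r) i j hc

open scoped Classical in
/-- The Čech filtration: the zero complex at levels `r < 0`, and at levels `r ≥ 0` the subcomplex
whose `k`-chains are spanned by the constant simplices and by the simplices of `{f ≥ 1 / r}`; in
degree `0` these are all chains. -/
def cechFiltration : Filtration (singularChains F X) where
  chains r k :=
    if r < 0 then ⊥ else constChains F X k ⊔ subspaceChains F (superlevel f r.toENNReal) k
  mono {r r'} h k := by
    by_cases hr : r < 0
    · simp [hr]
    · have hr' : ¬ r' < 0 := fun h' => hr (h.trans_lt h')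
      simp only [hr, hr', if_false]
      exact sup_le_sup_left
        (subspaceChains_mono F (superlevel_mono f (EReal.toENNReal_le_toENNReal h)) k) _
  d_mem r i j c hc := by
    by_cases hr : r < 0
    · simp only [hr, if_true, Submodule.mem_bot] at hc ⊢
      rw [hc, map_zero]
    · simp only [hr, if_false] at hc ⊢
      obtain ⟨a, ha, b, hb, rfl⟩ := Submodule.mem_sup.1 hc
      rw [map_add]
      exact Submodule.add_mem_sup (constChains_d_mem F i j ha) (subspaceChains_d_mem F _ i j hb)

end

/-! ### The Betti-0 function of a density with respect to a measure -/

section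

variable {X : Type} [MeasurableSpace X] (ν : Measure X) (f : X → ℝ≥0∞)

/-- `g(r)`, the integral of `f` over `{f ≥ 1 / r}`. -/
def superlevelMass (r : ℝ≥0∞) : ℝ≥0∞ := ∫⁻ x in superlevel f r, f x ∂ν

/-- The Betti-0 function `x ↦ inf {r ∈ [0, ∞] | g(r) ≥ x}`, used for `0 < x ≤ 1`. -/
def bettiZero (x : ℝ≥0∞) : ℝ≥0∞ := sInf {r | x ≤ superlevelMass ν f r}

end

end Persistence

namespace Watson

/-- The unit sphere `S^{p-1}` in `ℝ^p`. -/
abbrev Sphere (p : ℕ) : Type := Metric.sphere (0 : EuclideanSpace ℝ (Fin p)) 1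

/-- The uniform probability measure on `S^{p-1}`: the normalized surface measure. -/
def uniform (p : ℕ) : Measure (Sphere p) :=
  ((volume : Measure (EuclideanSpace ℝ (Fin p))).toSphere Set.univ)⁻¹ •
    (volume : Measure (EuclideanSpace ℝ (Fin p))).toSphere

/-- `exp (κ (xᵗ μ)²)`. -/
def kernel {p : ℕ} (μ : Sphere p) (κ : ℝ) (x : Sphere p) : ℝ :=
  Real.exp (κ * (inner ℝ (x : EuclideanSpace ℝ (Fin p)) (μ : EuclideanSpace ℝ (Fin p))) ^ 2)

/-- The normalizing constant `d(κ)` of the Watson density with respect to the uniform measure. -/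
def normConst {p : ℕ} (μ : Sphere p) (κ : ℝ) : ℝ :=
  (∫ x, kernel μ κ x ∂(uniform p))⁻¹

/-- The Watson density `d(κ) exp (κ (xᵗ μ)²)` on `S^{p-1}`. -/
def density {p : ℕ} (μ : Sphere p) (κ : ℝ) (x : Sphere p) : ℝ≥0∞ :=
  ENNReal.ofReal (normConst μ κ * kernel μ κ x)

/-- `s_n = 2 π^{(n+1)/2} / Γ((n+1)/2)`, the surface area of the sphere `S^n`. -/
def sphereArea (n : ℕ) : ℝ :=
  2 * Real.pi ^ (((n : ℝ) + 1) / 2) / Real.Gamma (((n : ℝ) + 1) / 2)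

/-- `2 (s_{p-2} / s_{p-1}) ∫₀ᵗ d e^{κ cos² θ} sin^{p-2} θ dθ`, for `p ≥ 2`. -/
def angularMass (p : ℕ) (d κ t : ℝ) : ℝ :=
  2 * (sphereArea (p - 2) / sphereArea (p - 1)) *
    ∫ θ in (0 : ℝ)..t, d * Real.exp (κ * Real.cos θ ^ 2) * Real.sin θ ^ (p - 2)

end Watson

end

noncomputable section

/-! The density is a nondecreasing function of ⟨x,μ⟩², so its level sets are known outright. A
sublevel set is empty below min f, a band |⟨x,μ⟩| ≤ c with c < 1 between min f and max f, and the
whole sphere from max f on. A superlevel set {f ≥ 1/r} with r < 1/min f is empty or the union of two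
disjoint antipodal caps; from r = 1/min f on it is the whole sphere.

Morse barcodes. Removing the component along μ and normalizing retracts every band onto the equator
orthogonal to μ, a copy of S^{p-2} fixed by the retraction. Hence one cycle of the equator generates
the reduced homology at all levels of [min f, max f) (`IsHomologySphere.band`); from max f on it
bounds, and a class of the whole sphere, one degree higher, takes over. Unreduced H_0 adds the class
of a point, whence two bars in degree 0 when p = 2.

The homology of spheres is computed from scratch in the augmented singular complex. There ∅ = S^{-1}
carries a class of its own, so the induction on dimension in `exists_isHomologySphere_subsphere`
starts at the empty sphere. Its step is `IsHomologySphere.suspend`: the complements of two antipodal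
points are star-shaped, hence acyclic, their intersection retracts onto an equator, and a
Mayer–Vietoris argument raises the degree by one. That argument needs chains to be replaced by small
ones, through barycentric subdivision (`exists_iterate_subdiv_mem_small`) and the prism operator.
`chainEquiv` carries the result to the singular chain complex, with an index shift: singular degree
k is index k + 1, the number of vertices.

Čech barcodes. The constant simplices have an explicit contraction in positive degrees, so a cycle
involving them can be traded for a cycle of the superlevel set
(`exists_bdry_eq_of_mem_consts_sup_sub`); two disjoint caps have no homology there.

Betti-0 function. Polar coordinates give the integral of a zonal function
(`lintegral_toSphere_zonal`), so the points at angle at most t from the axis have mass G(t), and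
they form the superlevel set for r = A(t) = exp(-κ cos² t)/d(κ). Thus g(A(t)) = G(t) with A and G
continuous and strictly increasing on [0, π/2]; what is claimed of g and its inverse follows
formally. -/

namespace SimplexChain

/-! ### The augmented singular chain complex

Chains in degree `k` are spanned by the maps from the simplex with `k` vertices, so that degree `0`
is spanned by the empty simplex and the boundary map from degree `1` is the augmentation. -/

/-- The topological simplex with `k` vertices. -/
abbrev Simplex (k : ℕ) : Type := stdSimplex ℝ (Fin k)

instance : IsEmpty (Simplex 0) := by
  unfold Simplex
  rw [stdSimplex_of_isEmpty_index]
  infer_instance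

/-- Augmented singular chains, graded by the number of vertices. -/
abbrev Chain (F : Type u) [Field F] (k : ℕ) (X : Type) [TopologicalSpace X] : Type u :=
  C(Simplex k, X) →₀ F

/-- The inclusion of the face opposite to the `i`-th vertex. -/
def face {k : ℕ} (i : Fin (k + 1)) : C(Simplex k, Simplex (k + 1)) :=
  ⟨stdSimplex.map i.succAbove, stdSimplex.continuous_map _⟩

section

variable {F : Type u} [Field F] {X Y Z : Type} [TopologicalSpace X] [TopologicalSpace Y]
  [TopologicalSpace Z]

/-- The boundary map. -/
def bdry (k : ℕ) : Chain F (k + 1) X →ₗ[F] Chain F k X :=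
  ∑ i : Fin (k + 1), (-1 : F) ^ (i : ℕ) • Finsupp.lmapDomain F F fun σ => σ.comp (face i)

theorem bdry_single (k : ℕ) (σ : C(Simplex (k + 1), X)) (a : F) :
    bdry k (Finsupp.single σ a) =
      ∑ i : Fin (k + 1), (-1 : F) ^ (i : ℕ) • Finsupp.single (σ.comp (face i)) a := by
  simp [bdry, LinearMap.sum_apply, Finsupp.lmapDomain_apply, Finsupp.mapDomain_single]

/-- The map of chains induced by a continuous map. -/
def push (k : ℕ) (f : C(X, Y)) : Chain F k X →ₗ[F] Chain F k Y :=
  Finsupp.lmapDomain F F fun σ => f.comp σ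

@[simp]
theorem push_single (k : ℕ) (f : C(X, Y)) (σ : C(Simplex k, X)) (a : F) :
    push k f (Finsupp.single σ a) = Finsupp.single (f.comp σ) a := by
  simp [push]

theorem push_push (k : ℕ) (g : C(Y, Z)) (f : C(X, Y)) (c : Chain F k X) :
    push k g (push k f c) = push k (g.comp f) c := by
  induction c using Finsupp.induction_linear with
  | zero => simp
  | add a b ha hb => simp only [map_add, ha, hb]
  | single σ a => simp [ContinuousMap.comp_assoc]

theorem push_id (k : ℕ) (c : Chain F k X) : push k (ContinuousMap.id X) c = c := by
  induction c using Finsupp.induction_linear with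
  | zero => simp
  | add a b ha hb => simp only [map_add, ha, hb]
  | single σ a => simp

theorem bdry_push (k : ℕ) (f : C(X, Y)) (c : Chain F (k + 1) X) :
    bdry k (push (k + 1) f c) = push k f (bdry k c) := by
  induction c using Finsupp.induction_linear with
  | zero => simp
  | add a b ha hb => simp only [map_add, ha, hb]
  | single σ a => simp only [bdry_single, push_single, map_sum, map_smul, ContinuousMap.comp_assoc]

variable (F) in
/-- The chains of a subspace. -/
def sub (A : Set X) (k : ℕ) : Submodule F (Chain F k X) :=
  Finsupp.supported F F {σ | ∀ t, σ t ∈ A}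

theorem single_mem_sub {A : Set X} {k : ℕ} {σ : C(Simplex k, X)} (h : ∀ t, σ t ∈ A) (a : F) :
    Finsupp.single σ a ∈ sub F A k :=
  Finsupp.single_mem_supported F a h

/-- A linear map sends chains supported on a set to a subspace as soon as it does so on the
members of the set. -/
theorem map_mem_of_mem_supported {ι M : Type*} [AddCommGroup M] [Module F M] {T : Set ι}
    (S : Submodule F M) (φ : (ι →₀ F) →ₗ[F] M) (h : ∀ i ∈ T, φ (Finsupp.single i 1) ∈ S)
    {c : ι →₀ F} (hc : c ∈ Finsupp.supported F F T) : φ c ∈ S := by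
  rw [Finsupp.supported_eq_span_single] at hc
  have : Submodule.span F ((fun i => Finsupp.single i (1 : F)) '' T) ≤ S.comap φ := by
    rw [Submodule.span_le]
    rintro _ ⟨i, hi, rfl⟩
    exact h i hi
  exact this hc

theorem map_mem_of_mem_sub {A : Set X} {k : ℕ} {M : Type*} [AddCommGroup M] [Module F M]
    (S : Submodule F M) (φ : Chain F k X →ₗ[F] M)
    (h : ∀ σ : C(Simplex k, X), (∀ t, σ t ∈ A) → φ (Finsupp.single σ 1) ∈ S)
    {c : Chain F k X} (hc : c ∈ sub F A k) : φ c ∈ S :=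
  map_mem_of_mem_supported S φ h hc

theorem sub_mono {A B : Set X} (h : A ⊆ B) (k : ℕ) : sub F A k ≤ sub F B k :=
  Finsupp.supported_mono fun _ hσ t => h (hσ t)

theorem mem_sub_univ {k : ℕ} (c : Chain F k X) : c ∈ sub F Set.univ k := by
  simp [sub]

theorem mem_sub_inter {A B : Set X} {k : ℕ} {c : Chain F k X} (hA : c ∈ sub F A k)
    (hB : c ∈ sub F B k) : c ∈ sub F (A ∩ B) k := by
  rw [sub, Finsupp.mem_supported] at *
  exact fun σ hσ t => ⟨hA hσ t, hB hσ t⟩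

/-- The empty simplex has no points to test. In particular it is a chain of ∅, which makes ∅ a
homology sphere of index 0. -/
theorem mem_sub_zero (A : Set X) (c : Chain F 0 X) : c ∈ sub F A 0 := by
  rw [sub, Finsupp.mem_supported]
  exact fun σ _ t => isEmptyElim t

theorem eq_zero_of_mem_sub_empty {k : ℕ} {c : Chain F (k + 1) X} (h : c ∈ sub F ∅ (k + 1)) :
    c = 0 := by
  rw [sub, Finsupp.mem_supported] at h
  rw [← Finsupp.support_eq_empty, Finset.eq_empty_iff_forall_notMem]
  exact fun σ hσ => h hσ (stdSimplex.vertex 0)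

theorem push_mem_sub {B : Set Y} {k : ℕ} {f : C(X, Y)} (hf : ∀ x, f x ∈ B) (c : Chain F k X) :
    push k f c ∈ sub F B k :=
  map_mem_of_mem_sub _ _ (fun σ _ => by
    rw [push_single]
    exact single_mem_sub (fun t => hf _) _) (mem_sub_univ c)

theorem bdry_mem_sub {A : Set X} {k : ℕ} {c : Chain F (k + 1) X} (hc : c ∈ sub F A (k + 1)) :
    bdry k c ∈ sub F A k :=
  map_mem_of_mem_sub _ _ (fun σ hσ => by
    rw [bdry_single]
    exact Submodule.sum_mem _ fun i _ =>
      Submodule.smul_mem _ _ (single_mem_sub (fun t => hσ (face i t)) _)) hc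

/-- The inclusion of a subspace. -/
def incl (A : Set X) : C(A, X) := ⟨Subtype.val, continuous_subtype_val⟩

theorem exists_push_incl_eq {A : Set X} {k : ℕ} {c : Chain F k X} (hc : c ∈ sub F A k) :
    ∃ c' : Chain F k A, push k (incl A) c' = c := by
  refine map_mem_of_mem_sub (LinearMap.range (push k (incl A))) LinearMap.id (fun σ hσ => ?_) hc
  refine ⟨Finsupp.single ⟨fun t => ⟨σ t, hσ t⟩, by fun_prop⟩ 1, ?_⟩
  rw [push_single]
  rfl

theorem push_incl_injective (A : Set X) (k : ℕ) :
    Function.Injective (push (F := F) k (incl A)) := by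
  refine Finsupp.mapDomain_injective fun σ τ h => ?_
  ext t
  exact congrArg (fun ρ : C(Simplex k, X) => ρ t) h

/-- Reduced cycles. -/
def IsCyc : ∀ {k : ℕ}, Chain F k X → Prop
  | 0, _ => True
  | _ + 1, c => bdry _ c = 0

theorem IsCyc.push {k : ℕ} {c : Chain F k X} (hc : IsCyc c) (f : C(X, Y)) :
    IsCyc (push k f c) := by
  cases k with
  | zero => trivial
  | succ k =>
    change bdry k _ = 0
    rw [bdry_push, show bdry k c = 0 from hc, map_zero]

theorem IsCyc.add {k : ℕ} {c c' : Chain F k X} (hc : IsCyc c) (hc' : IsCyc c') :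
    IsCyc (c + c') := by
  cases k with
  | zero => trivial
  | succ k =>
    change bdry k _ = 0
    rw [map_add, show bdry k c = 0 from hc, show bdry k c' = 0 from hc', add_zero]

theorem IsCyc.smul {k : ℕ} {c : Chain F k X} (hc : IsCyc c) (a : F) : IsCyc (a • c) := by
  cases k with
  | zero => trivial
  | succ k =>
    change bdry k _ = 0
    rw [map_smul, show bdry k c = 0 from hc, smul_zero]

theorem IsCyc.of_push_incl {A : Set X} {k : ℕ} {c : Chain F k A}
    (hc : IsCyc (SimplexChain.push k (incl A) c)) : IsCyc c := by
  cases k with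
  | zero => trivial
  | succ k =>
    apply push_incl_injective A k
    rw [← bdry_push, map_zero]
    exact hc

end

/-! ### Convex combinations and affine chains -/

/-- Spaces with continuous convex combinations. -/
class ConvComb (V : Type) [TopologicalSpace V] where
  /-- the affine simplex with given vertices -/
  comb {k : ℕ} (v : Fin k → V) : C(Simplex k, V)
  comb_vertex {k : ℕ} (v : Fin k → V) (i : Fin k) : comb v (stdSimplex.vertex i) = v i
  -- The point `s` is described by its coordinates because convex combinations in `Simplex k` are
  -- themselves an instance of this class and are not available yet.
  comb_of_eq_sum {k l : ℕ} (v : Fin k → V) (w : Fin l → Simplex k) (t : Simplex l) (s : Simplex k)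
    (hs : ∀ j, s j = ∑ i, t i * w i j) : comb v s = comb (fun i => comb v (w i)) t

open ConvComb (comb comb_vertex comb_of_eq_sum)

/-- Convex subsets of normed spaces have convex combinations. -/
@[reducible]
def ConvComb.ofConvex {E : Type} [NormedAddCommGroup E] [NormedSpace ℝ E] {K : Set E}
    (hK : Convex ℝ K) : ConvComb K where
  comb v := ⟨fun t => ⟨∑ i, t i • (v i : E),
      hK.sum_mem (fun i _ => t.2.1 i) t.2.2 fun i _ => (v i).2⟩, by
    refine Continuous.subtype_mk (continuous_finsetSum _ fun i _ => ?_) _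
    exact ((continuous_apply i).comp continuous_subtype_val).smul continuous_const⟩
  comb_vertex v i := by
    ext1
    simp [Pi.single_apply]
  comb_of_eq_sum v w t s hs := by
    ext1
    simp only [ContinuousMap.coe_mk, hs, Finset.sum_smul, Finset.smul_sum, smul_smul]
    exact Finset.sum_comm

instance (m : ℕ) : ConvComb (Simplex m) := ConvComb.ofConvex (convex_stdSimplex ℝ (Fin m))

instance : ConvComb unitInterval := ConvComb.ofConvex (convex_Icc 0 1)

instance {V W : Type} [TopologicalSpace V] [TopologicalSpace W] [ConvComb V] [ConvComb W] :
    ConvComb (V × W) where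
  comb v := (comb fun i => (v i).1).prodMk (comb fun i => (v i).2)
  comb_vertex v i := by simp [comb_vertex]
  comb_of_eq_sum v w t s hs := by
    ext1
    · exact comb_of_eq_sum (fun i => (v i).1) w t s hs
    · exact comb_of_eq_sum (fun i => (v i).2) w t s hs

theorem comb_simplex_apply {k m : ℕ} (v : Fin k → Simplex m) (t : Simplex k) (j : Fin m) :
    comb v t j = ∑ i, t i * v i j := by
  change (∑ i, t i • (v i : Fin m → ℝ)) j = _
  simp [Finset.sum_apply]

theorem comb_comb {V : Type} [TopologicalSpace V] [ConvComb V] {k l : ℕ} (v : Fin k → V)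
    (w : Fin l → Simplex k) (t : Simplex l) :
    comb v (comb w t) = comb (fun i => comb v (w i)) t :=
  comb_of_eq_sum v w t _ (comb_simplex_apply w t)

theorem face_eq_comb {k : ℕ} (i : Fin (k + 1)) :
    face i = comb fun j => (stdSimplex.vertex (i.succAbove j) : Simplex (k + 1)) := by
  ext1 t
  apply stdSimplex.ext
  funext j
  rw [comb_simplex_apply]
  change FunOnFinite.linearMap ℝ ℝ i.succAbove t j = _
  rw [FunOnFinite.linearMap_apply_apply]
  simp [Pi.single_apply, Finset.sum_ite, eq_comm]

theorem comb_comp_face {V : Type} [TopologicalSpace V] [ConvComb V] {k : ℕ} (v : Fin (k + 1) → V)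
    (i : Fin (k + 1)) : (comb v).comp (face i) = comb (v ∘ i.succAbove) := by
  ext1 t
  rw [ContinuousMap.comp_apply, face_eq_comb, comb_comb]
  simp only [comb_vertex]
  rfl

theorem comb_vertices (k : ℕ) :
    comb (fun j => (stdSimplex.vertex j : Simplex k)) = ContinuousMap.id _ := by
  ext1 t
  apply stdSimplex.ext
  funext j
  rw [comb_simplex_apply]
  simp [Pi.single_apply]

/-- Maps preserving convex combinations. -/
def IsAff {V W : Type} [TopologicalSpace V] [ConvComb V] [TopologicalSpace W] [ConvComb W]
    (f : V → W) : Prop :=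
  ∀ (k : ℕ) (v : Fin k → V) (t : Simplex k), f (comb v t) = comb (f ∘ v) t

theorem isAff_comb {V : Type} [TopologicalSpace V] [ConvComb V] {k : ℕ} (v : Fin k → V) :
    IsAff (comb v) := fun _ w t => comb_comb v w t

theorem isAff_prodMap_id {V W U : Type} [TopologicalSpace V] [ConvComb V] [TopologicalSpace W]
    [ConvComb W] [TopologicalSpace U] [ConvComb U] {f : V → W} (hf : IsAff f) :
    IsAff (Prod.map f (id : U → U)) := fun k v t =>
  Prod.ext (hf k (fun i => (v i).1) t) rfl

theorem isAff_prodMk {V : Type} [TopologicalSpace V] [ConvComb V] (s : unitInterval) :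
    IsAff fun v : V => (v, s) := fun k v t => by
  refine Prod.ext rfl ?_
  change s = _
  ext1
  change (s : ℝ) = ∑ i, t i • (s : ℝ)
  rw [← Finset.sum_smul, stdSimplex.sum_eq_one, one_smul]

section

variable {F : Type u} [Field F] {V W : Type}

variable (F V) in
/-- Chains of affine simplices, given by their vertices. -/
abbrev AffChain (k : ℕ) : Type u := (Fin k → V) →₀ F

/-- The boundary of an affine chain. -/
def affBdry (k : ℕ) : AffChain F V (k + 1) →ₗ[F] AffChain F V k :=
  ∑ i : Fin (k + 1), (-1 : F) ^ (i : ℕ) • Finsupp.lmapDomain F F fun v => v ∘ i.succAbove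

theorem affBdry_single (k : ℕ) (v : Fin (k + 1) → V) (a : F) :
    affBdry k (Finsupp.single v a) =
      ∑ i : Fin (k + 1), (-1 : F) ^ (i : ℕ) • Finsupp.single (v ∘ i.succAbove) a := by
  simp [affBdry, LinearMap.sum_apply, Finsupp.lmapDomain_apply, Finsupp.mapDomain_single]

/-- The affine chain with vertices moved by a map. -/
def affPush (k : ℕ) (f : V → W) : AffChain F V k →ₗ[F] AffChain F W k :=
  Finsupp.lmapDomain F F fun v => f ∘ v

@[simp]
theorem affPush_single (k : ℕ) (f : V → W) (v : Fin k → V) (a : F) :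
    affPush k f (Finsupp.single v a) = Finsupp.single (f ∘ v) a := by
  simp [affPush]

theorem affBdry_push (k : ℕ) (f : V → W) (c : AffChain F V (k + 1)) :
    affBdry k (affPush (k + 1) f c) = affPush k f (affBdry k c) := by
  induction c using Finsupp.induction_linear with
  | zero => simp
  | add a b ha hb => simp only [map_add, ha, hb]
  | single v a => simp only [affBdry_single, affPush_single, map_sum, map_smul, Function.comp_assoc]

theorem affPush_affPush {U : Type} (k : ℕ) (g : W → U) (f : V → W) (c : AffChain F V k) :
    affPush k g (affPush k f c) = affPush k (g ∘ f) c := by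
  induction c using Finsupp.induction_linear with
  | zero => simp
  | add a b ha hb => simp only [map_add, ha, hb]
  | single v a => simp [Function.comp_assoc]

/-- The cone over an affine chain. -/
def cone (k : ℕ) (b : V) : AffChain F V k →ₗ[F] AffChain F V (k + 1) :=
  Finsupp.lmapDomain F F fun v => Fin.cons b v

@[simp]
theorem cone_single (k : ℕ) (b : V) (v : Fin k → V) (a : F) :
    cone k b (Finsupp.single v a) = Finsupp.single (Fin.cons b v : Fin (k + 1) → V) a := by
  simp [cone]

theorem affPush_cone (k : ℕ) (f : V → W) (b : V) (c : AffChain F V k) :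
    affPush (k + 1) f (cone k b c) = cone k (f b) (affPush k f c) := by
  induction c using Finsupp.induction_linear with
  | zero => simp
  | add a b ha hb => simp only [map_add, ha, hb]
  | single v a =>
    simp only [cone_single, affPush_single]
    congr 1
    ext i
    refine Fin.cases rfl (fun j => rfl) i

theorem affBdry_cone_zero (b : V) (c : AffChain F V 0) : affBdry 0 (cone 0 b c) = c := by
  induction c using Finsupp.induction_linear with
  | zero => simp
  | add a b ha hb => simp only [map_add, ha, hb]
  | single v a =>
    rw [cone_single, affBdry_single, Fin.sum_univ_succ]
    simp only [Fin.val_zero, pow_zero, one_smul, Finset.univ_eq_empty, Finset.sum_empty, add_zero]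
    congr 1

/-- Omitting the apex returns the base; omitting a vertex of the base gives the cone over a face,
with the sign reversed since the apex shifts the numbering by one. -/
theorem affBdry_cone (k : ℕ) (b : V) (c : AffChain F V (k + 1)) :
    affBdry (k + 1) (cone (k + 1) b c) = c - cone k b (affBdry k c) := by
  induction c using Finsupp.induction_linear with
  | zero => simp
  | add a b ha hb => simp only [map_add, ha, hb]; abel
  | single v a =>
    simp only [cone_single, affBdry_single]
    rw [Fin.sum_univ_succ, map_sum, sub_eq_add_neg, ← Finset.sum_neg_distrib]
    congr 1
    · simp only [Fin.val_zero, pow_zero, one_smul]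
      congr 1
    · refine Finset.sum_congr rfl fun i _ => ?_
      rw [map_smul, cone_single, Fin.val_succ, pow_succ, mul_neg_one, neg_smul]
      congr 3
      funext j
      refine Fin.cases ?_ (fun j => ?_) j
      · simp
      · simp [Fin.succ_succAbove_succ]

theorem affBdry_affBdry (k : ℕ) (c : AffChain F V (k + 2)) :
    affBdry k (affBdry (k + 1) c) = 0 := by
  induction c using Finsupp.induction_linear with
  | zero => simp
  | add a b ha hb => simp only [map_add, ha, hb, add_zero]
  | single v a =>
    -- Every simplex is the cone from its first vertex over the opposite face, so the cone formula
    -- and induction on `k` suffice.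
    rw [← Fin.cons_self_tail v, ← cone_single]
    rw [affBdry_cone, map_sub]
    cases k with
    | zero => rw [affBdry_cone_zero, sub_self]
    | succ k => rw [affBdry_cone, affBdry_affBdry, map_zero, sub_zero, sub_self]

end

end SimplexChain


namespace SimplexChain

open ConvComb (comb comb_vertex comb_of_eq_sum)

/-! ### Barycentric subdivision and the prism operator -/

/-- Coefficient 1 is enough for linear identities, and it is the form in which the operators defined
by `linearCombination` unfold. -/
theorem finsupp_induction {F ι : Type*} [Field F] {P : (ι →₀ F) → Prop} (c : ι →₀ F)
    (add : ∀ a b, P a → P b → P (a + b)) (smul : ∀ (r : F) a, P a → P (r • a))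
    (zero : P 0) (single : ∀ i, P (Finsupp.single i 1)) : P c := by
  induction c using Finsupp.induction_linear with
  | zero => exact zero
  | add a b ha hb => exact add a b ha hb
  | single i a => simpa using smul a _ (single i)

section

variable {F : Type u} [Field F] {V W : Type} [TopologicalSpace V] [ConvComb V]
  [TopologicalSpace W] [ConvComb W]

/-- The barycenter of an affine simplex. -/
def bary {k : ℕ} (v : Fin (k + 1) → V) : V := comb v stdSimplex.barycenter

theorem IsAff.map_bary {f : V → W} (hf : IsAff f) {k : ℕ} (v : Fin (k + 1) → V) :
    f (bary v) = bary (f ∘ v) := hf _ _ _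

/-- Barycentric subdivision of affine chains. -/
def sd : ∀ k : ℕ, AffChain F V k →ₗ[F] AffChain F V k
  | 0 => LinearMap.id
  | k + 1 => Finsupp.linearCombination F fun v =>
      cone k (bary v) (sd k (affBdry k (Finsupp.single v 1)))

theorem sd_single (k : ℕ) (v : Fin (k + 1) → V) :
    sd (k + 1) (Finsupp.single v (1 : F)) =
      cone k (bary v) (sd k (affBdry k (Finsupp.single v 1))) := by
  simp [sd]

/-- The chain homotopy between the top of a prism and its subdivided bottom. -/
def prism : ∀ k : ℕ, AffChain F V k →ₗ[F] AffChain F (V × unitInterval) (k + 1)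
  | 0 => 0
  -- The chain under the cone is the boundary that the prism is required to have. It is a cycle, so
  -- coning it off solves the equation.
  | k + 1 => Finsupp.linearCombination F fun v =>
      cone (k + 1) (bary v, 0) (affPush (k + 1) (fun x => (x, 1)) (sd (k + 1) (Finsupp.single v 1))
        - affPush (k + 1) (fun x => (x, 0)) (Finsupp.single v 1)
        - prism k (affBdry k (Finsupp.single v 1)))

theorem prism_single (k : ℕ) (v : Fin (k + 1) → V) :
    prism (k + 1) (Finsupp.single v (1 : F)) =
      cone (k + 1) (bary v, 0) (affPush (k + 1) (fun x => (x, 1)) (sd (k + 1) (Finsupp.single v 1))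
        - affPush (k + 1) (fun x => (x, 0)) (Finsupp.single v 1)
        - prism k (affBdry k (Finsupp.single v 1))) := by
  simp [prism]

theorem affBdry_sd (k : ℕ) (c : AffChain F V (k + 1)) :
    affBdry k (sd (k + 1) c) = sd k (affBdry k c) := by
  induction c using finsupp_induction with
  | zero => simp
  | add a b ha hb => simp only [map_add, ha, hb]
  | smul r a ha => simp only [map_smul, ha]
  | single v =>
    rw [sd_single]
    cases k with
    | zero => rw [affBdry_cone_zero]
    | succ k => rw [affBdry_cone, affBdry_sd k, affBdry_affBdry, map_zero, map_zero, sub_zero]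

theorem affBdry_prism (k : ℕ) (c : AffChain F V (k + 1)) :
    affBdry (k + 1) (prism (k + 1) c) + prism k (affBdry k c) =
      affPush (k + 1) (fun x => (x, 1)) (sd (k + 1) c) - affPush (k + 1) (fun x => (x, 0)) c := by
  induction c using finsupp_induction with
  | zero => simp
  | add a b ha hb =>
    simp only [map_add]
    rw [add_add_add_comm, ha, hb]
    abel
  | smul r a ha => simp only [map_smul, ← smul_add, ← smul_sub, ha]
  | single v =>
    rw [prism_single, affBdry_cone]
    set x : AffChain F V (k + 1) := Finsupp.single v 1
    suffices h : affBdry k (affPush (k + 1) (fun x => (x, (1 : unitInterval))) (sd (k + 1) x)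
        - affPush (k + 1) (fun x => (x, 0)) x - prism k (affBdry k x)) = 0 by
      rw [h, map_zero]
      abel
    simp only [map_sub, affBdry_push, affBdry_sd]
    cases k with
    | zero =>
      -- Only one map starts from `Fin 0`, so the top and bottom of the cylinder agree on the empty
      -- simplex.
      have h : ∀ y : AffChain F V 0, affPush 0 (fun x => (x, (1 : unitInterval))) y =
          affPush 0 (fun x => (x, 0)) y := fun y => by
        unfold affPush
        congr 2
        funext v
        exact Subsingleton.elim _ _
      simp [sd, prism, h]
    | succ k =>
      have := affBdry_prism k (affBdry (k + 1) x)
      rw [affBdry_affBdry, map_zero, add_zero] at this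
      rw [this]
      abel

theorem affPush_sd {f : V → W} (hf : IsAff f) (k : ℕ) (c : AffChain F V k) :
    affPush k f (sd k c) = sd k (affPush k f c) := by
  induction k with
  | zero => rfl
  | succ k ih =>
    induction c using finsupp_induction with
    | zero => simp
    | add a b ha hb => simp only [map_add, ha, hb]
    | smul r a ha => simp only [map_smul, ha]
    | single v => rw [sd_single, affPush_cone, ih, affPush_single, sd_single, hf.map_bary,
        ← affPush_single, affBdry_push]

theorem affPush_prism {f : V → W} (hf : IsAff f) (k : ℕ) (c : AffChain F V k) :
    affPush (k + 1) (Prod.map f id) (prism k c) = prism k (affPush k f c) := by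
  induction k with
  | zero => simp [prism]
  | succ k ih =>
    induction c using finsupp_induction with
    | zero => simp
    | add a b ha hb => simp only [map_add, ha, hb]
    | smul r a ha => simp only [map_smul, ha]
    | single v =>
      rw [affPush_single _ f, prism_single, prism_single, affPush_cone]
      simp only [map_sub]
      rw [ih, Prod.map_apply, hf.map_bary, ← affPush_single _ f, affBdry_push, affPush_affPush,
        affPush_affPush, ← affPush_sd hf, affPush_affPush, affPush_affPush]
      rfl

/-- The singular chain of an affine chain. -/
def toChain (k : ℕ) : AffChain F V k →ₗ[F] Chain F k V :=
  Finsupp.lmapDomain F F fun v => comb v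

@[simp]
theorem toChain_single (k : ℕ) (v : Fin k → V) (a : F) :
    toChain k (Finsupp.single v a) = Finsupp.single (comb v) a := by
  simp [toChain]

theorem bdry_toChain (k : ℕ) (c : AffChain F V (k + 1)) :
    bdry k (toChain (k + 1) c) = toChain k (affBdry k c) := by
  induction c using Finsupp.induction_linear with
  | zero => simp
  | add a b ha hb => simp only [map_add, ha, hb]
  | single v a =>
    simp only [toChain_single, bdry_single, affBdry_single, map_sum, map_smul, comb_comp_face]

theorem push_toChain (k : ℕ) {f : C(V, W)} (hf : IsAff f) (c : AffChain F V k) :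
    push k f (toChain k c) = toChain k (affPush k f c) := by
  induction c using Finsupp.induction_linear with
  | zero => simp
  | add a b ha hb => simp only [map_add, ha, hb]
  | single v a =>
    simp only [toChain_single, push_single, affPush_single]
    congr 1
    ext1 t
    exact hf _ v t

variable (F) in
/-- The universal affine simplex. -/
def univSimplex (k : ℕ) : AffChain F (Simplex k) k :=
  Finsupp.single (fun j => stdSimplex.vertex j) 1

theorem toChain_univSimplex (k : ℕ) :
    toChain k (univSimplex F k) = Finsupp.single (ContinuousMap.id _) 1 := by
  rw [univSimplex, toChain_single, comb_vertices]

theorem affBdry_univSimplex (k : ℕ) :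
    affBdry k (univSimplex F (k + 1)) =
      ∑ i : Fin (k + 1), (-1 : F) ^ (i : ℕ) • affPush k (face i) (univSimplex F k) := by
  rw [univSimplex, affBdry_single]
  refine Finset.sum_congr rfl fun i _ => ?_
  rw [univSimplex, affPush_single]
  congr 2
  funext j
  exact (stdSimplex.map_vertex _ _).symm

theorem isAff_face {k : ℕ} (i : Fin (k + 1)) : IsAff (face i) := by
  rw [face_eq_comb]
  exact isAff_comb _

end

section

variable {F : Type u} [Field F] {X Y Z : Type} [TopologicalSpace X] [TopologicalSpace Y]
  [TopologicalSpace Z]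

/-- Every singular simplex is the image of one universal affine simplex; natural identities need
only be checked on the latter. -/
theorem single_eq_push (k : ℕ) (σ : C(Simplex k, X)) :
    (Finsupp.single σ 1 : Chain F k X) = push k σ (toChain k (univSimplex F k)) := by
  rw [toChain_univSimplex, push_single, ContinuousMap.comp_id]

theorem bdry_bdry (k : ℕ) (c : Chain F (k + 2) X) : bdry k (bdry (k + 1) c) = 0 := by
  induction c using finsupp_induction with
  | zero => simp
  | add a b ha hb => simp only [map_add, ha, hb, add_zero]
  | smul r a ha => simp only [map_smul, ha, smul_zero]
  | single σ =>
    rw [single_eq_push, bdry_push, bdry_push, bdry_toChain, bdry_toChain, affBdry_affBdry,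
      map_zero, map_zero]

theorem isCyc_bdry {k : ℕ} (c : Chain F (k + 1) X) : IsCyc (bdry k c) := by
  cases k with
  | zero => trivial
  | succ k => exact bdry_bdry k c

/-- Barycentric subdivision of singular chains. -/
def subdiv (k : ℕ) : Chain F k X →ₗ[F] Chain F k X :=
  Finsupp.linearCombination F fun σ => push k σ (toChain k (sd k (univSimplex F k)))

theorem subdiv_single (k : ℕ) (σ : C(Simplex k, X)) :
    subdiv k (Finsupp.single σ (1 : F)) = push k σ (toChain k (sd k (univSimplex F k))) := by
  simp [subdiv]

theorem subdiv_push (k : ℕ) (f : C(X, Y)) (c : Chain F k X) :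
    subdiv k (push k f c) = push k f (subdiv k c) := by
  induction c using finsupp_induction with
  | zero => simp
  | add a b ha hb => simp only [map_add, ha, hb]
  | smul r a ha => simp only [map_smul, ha]
  | single σ => rw [push_single, subdiv_single, subdiv_single, push_push]

theorem subdiv_toChain {V : Type} [TopologicalSpace V] [ConvComb V] (k : ℕ) (c : AffChain F V k) :
    subdiv k (toChain k c) = toChain k (sd k c) := by
  induction c using finsupp_induction with
  | zero => simp
  | add a b ha hb => simp only [map_add, ha, hb]
  | smul r a ha => simp only [map_smul, ha]
  | single v =>
    rw [toChain_single, subdiv_single, push_toChain k (isAff_comb v), affPush_sd (isAff_comb v),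
      univSimplex, affPush_single]
    congr 3
    funext i
    exact comb_vertex v i

theorem bdry_subdiv (k : ℕ) (c : Chain F (k + 1) X) :
    bdry k (subdiv (k + 1) c) = subdiv k (bdry k c) := by
  induction c using finsupp_induction with
  | zero => simp
  | add a b ha hb => simp only [map_add, ha, hb]
  | smul r a ha => simp only [map_smul, ha]
  | single σ =>
    rw [subdiv_single, single_eq_push, bdry_push, bdry_push, bdry_toChain, bdry_toChain,
      subdiv_push, subdiv_toChain, affBdry_sd]

theorem subdiv_mem_sub {A : Set X} {k : ℕ} {c : Chain F k X} (hc : c ∈ sub F A k) :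
    subdiv k c ∈ sub F A k :=
  map_mem_of_mem_sub _ _ (fun σ hσ => by
    rw [subdiv_single]
    exact push_mem_sub hσ _) hc

/-- The time-`s` map of a homotopy. -/
def slice (H : C(X × unitInterval, Y)) (s : unitInterval) : C(X, Y) :=
  ⟨fun x => H (x, s), by fun_prop⟩

/-- The prism operator of a homotopy. -/
def prismMap (H : C(X × unitInterval, Y)) (k : ℕ) : Chain F k X →ₗ[F] Chain F (k + 1) Y :=
  Finsupp.linearCombination F fun σ =>
    push (k + 1) (H.comp (σ.prodMap (ContinuousMap.id _)))
      (toChain (k + 1) (prism k (univSimplex F k)))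

theorem prismMap_single (H : C(X × unitInterval, Y)) (k : ℕ) (σ : C(Simplex k, X)) :
    prismMap H k (Finsupp.single σ (1 : F)) =
      push (k + 1) (H.comp (σ.prodMap (ContinuousMap.id _)))
        (toChain (k + 1) (prism k (univSimplex F k))) := by
  simp [prismMap]

/-- By naturality this is `affBdry_prism` for the universal simplex. The ends of the cylinder become
the ends of the homotopy (`key`), and faces are affine, so the side term is the prism of the
boundary (`hd`). Only the top end is subdivided. -/
theorem bdry_prismMap (H : C(X × unitInterval, Y)) (k : ℕ) (c : Chain F (k + 1) X) :
    bdry (k + 1) (prismMap H (k + 1) c) + prismMap H k (bdry k c) =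
      push (k + 1) (slice H 1) (subdiv (k + 1) c) - push (k + 1) (slice H 0) c := by
  induction c using finsupp_induction with
  | zero => simp
  | add a b ha hb =>
    simp only [map_add]
    rw [add_add_add_comm, ha, hb]
    abel
  | smul r a ha => simp only [map_smul, ← smul_add, ← smul_sub, ha]
  | single σ =>
    have key (s : unitInterval) (x : AffChain F (Simplex (k + 1)) (k + 1)) :
        push (k + 1) (H.comp (σ.prodMap (ContinuousMap.id _)))
          (toChain (k + 1) (affPush (k + 1) (fun y => (y, s)) x)) =
        push (k + 1) (slice H s) (push (k + 1) σ (toChain (k + 1) x)) := by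
      have := push_toChain (F := F) (k + 1)
        (f := ⟨fun y : Simplex (k + 1) => (y, s), by fun_prop⟩) (isAff_prodMk s) x
      rw [ContinuousMap.coe_mk] at this
      rw [← this, push_push, push_push]
      rfl
    have hd : prismMap H k (bdry k (Finsupp.single σ (1 : F))) =
        push (k + 1) (H.comp (σ.prodMap (ContinuousMap.id _)))
          (toChain (k + 1) (prism k (affBdry k (univSimplex F (k + 1))))) := by
      rw [bdry_single, affBdry_univSimplex]
      simp only [map_sum, map_smul, prismMap_single]
      refine Finset.sum_congr rfl fun i _ => ?_
      have := push_toChain (F := F) (k + 1)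
        (f := (face i).prodMap (ContinuousMap.id unitInterval))
        (isAff_prodMap_id (isAff_face i)) (prism k (univSimplex F k))
      rw [← affPush_prism (isAff_face i)]
      erw [← this]
      rw [push_push]
      rfl
    rw [hd, prismMap_single, bdry_push, bdry_toChain, ← map_add, ← map_add, affBdry_prism,
      map_sub, map_sub, key, key, ← subdiv_single, ← single_eq_push]

theorem prismMap_mem_sub {A : Set X} {B : Set Y} {H : C(X × unitInterval, Y)}
    (hH : ∀ x ∈ A, ∀ s, H (x, s) ∈ B) {k : ℕ} {c : Chain F k X} (hc : c ∈ sub F A k) :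
    prismMap H k c ∈ sub F B (k + 1) :=
  map_mem_of_mem_sub _ _ (fun σ hσ => by
    rw [prismMap_single]
    exact push_mem_sub (fun x => hH _ (hσ x.1) _) _) hc

/-- On cycles, the prism operator is a homotopy from the bottom to the subdivided top. -/
theorem bdry_prismMap_of_isCyc (H : C(X × unitInterval, Y)) {k : ℕ} {c : Chain F k X}
    (hc : IsCyc c) :
    bdry k (prismMap H k c) = push k (slice H 1) (subdiv k c) - push k (slice H 0) c := by
  cases k with
  | zero =>
    have h : push (F := F) 0 (slice H 1) = push 0 (slice H 0) := by
      unfold push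
      congr 1
      funext σ
      ext1 t
      exact isEmptyElim t
    have h' : subdiv 0 c = c := by
      induction c using finsupp_induction with
      | zero => simp
      | add a b ha hb => simp only [map_add, ha trivial, hb trivial]
      | smul r a ha => simp only [map_smul, ha trivial]
      | single σ =>
        rw [subdiv_single]
        exact (single_eq_push 0 σ).symm
    have h'' : prismMap H 0 c = 0 := by
      simp [prismMap, prism, Finsupp.linearCombination_apply]
    rw [h, h', h'', map_zero, sub_self]
  | succ k =>
    have := bdry_prismMap H k c
    rwa [show bdry k c = 0 from hc, map_zero, add_zero] at this

/-- The projection of a cylinder, as the constant homotopy. -/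
def constHomotopy (f : C(X, Y)) : C(X × unitInterval, Y) := f.comp ⟨Prod.fst, continuous_fst⟩

theorem slice_constHomotopy (f : C(X, Y)) (s : unitInterval) : slice (constHomotopy f) s = f := rfl

/-- Homotopic maps have homologous values on cycles. -/
theorem exists_bdry_eq_push_sub_push {B : Set Y} {H : C(X × unitInterval, Y)}
    (hH : ∀ x s, H (x, s) ∈ B) {k : ℕ} {c : Chain F k X} (hc : IsCyc c) :
    ∃ e ∈ sub F B (k + 1), bdry k e = push k (slice H 1) c - push k (slice H 0) c := by
  -- The prism of `H` compares the bottom with the subdivided top; the constant homotopy at the top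
  -- compares the top with its own subdivision. The difference removes the subdivision.
  refine ⟨prismMap H k c - prismMap (constHomotopy (slice H 1)) k c, Submodule.sub_mem _
    (prismMap_mem_sub (A := Set.univ) (fun x _ s => hH x s) (mem_sub_univ c))
    (prismMap_mem_sub (A := Set.univ) (fun x _ s => hH x 1) (mem_sub_univ c)), ?_⟩
  rw [map_sub, bdry_prismMap_of_isCyc _ hc, bdry_prismMap_of_isCyc _ hc, slice_constHomotopy,
    slice_constHomotopy]
  abel

end

end SimplexChain


namespace SimplexChain

open ConvComb (comb comb_vertex comb_of_eq_sum)

/-! ### Small chains -/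

section

variable {F : Type u} [Field F] {m : ℕ}

theorem coe_comb {k : ℕ} (v : Fin k → Simplex m) (t : Simplex k) :
    (comb v t).1 = ∑ i, t i • (v i).1 := rfl

theorem dist_comb_le {k : ℕ} {v : Fin k → Simplex m} {x : Simplex m} {R : ℝ}
    (h : ∀ i, dist (v i) x ≤ R) (t : Simplex k) : dist (comb v t) x ≤ R := by
  have := (convex_closedBall x.1 R).sum_mem (t := Finset.univ)
    (fun i _ => t.2.1 i) t.2.2 fun i _ => Metric.mem_closedBall.2 (h i)
  exact Metric.mem_closedBall.1 this

/-- The vector from the barycenter to `v i` is the average of the `k + 1` differences `v i - v j`,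
one of which is zero; hence the factor k/(k+1). Any larger `r` is allowed so that one ratio serves
all lower dimensions. -/
theorem dist_bary_le {k : ℕ} {v : Fin (k + 1) → Simplex m} {D r : ℝ}
    (hr : (k : ℝ) ≤ r * (k + 1)) (hD : 0 ≤ D) (h : ∀ i j, dist (v i) (v j) ≤ D)
    (i : Fin (k + 1)) : dist (v i) (bary v) ≤ r * D := by
  have hk : (0 : ℝ) < k + 1 := by positivity
  have hb : (bary v).1 = ∑ j, ((k : ℝ) + 1)⁻¹ • (v j).1 := by
    rw [bary, coe_comb]
    refine Finset.sum_congr rfl fun j _ => ?_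
    congr 1
    change ((Fintype.card (Fin (k + 1)) : ℕ) : ℝ)⁻¹ = _
    simp
  have hs : (v i).1 = ∑ _j : Fin (k + 1), ((k : ℝ) + 1)⁻¹ • (v i).1 := by
    rw [Finset.sum_const, Finset.card_univ, Fintype.card_fin, ← Nat.cast_smul_eq_nsmul ℝ, smul_smul]
    push_cast
    rw [mul_inv_cancel₀ hk.ne', one_smul]
  rw [Subtype.dist_eq, dist_eq_norm, hb]
  nth_rw 1 [hs]
  rw [← Finset.sum_sub_distrib]
  refine (norm_sum_le _ _).trans ?_
  rw [Fin.sum_univ_succAbove _ i, sub_self, norm_zero, zero_add]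
  have : ∀ j : Fin k, ‖((k : ℝ) + 1)⁻¹ • (v i).1 -
      ((k : ℝ) + 1)⁻¹ • (v (i.succAbove j)).1‖ ≤ ((k : ℝ) + 1)⁻¹ * D := fun j => by
    rw [← smul_sub, norm_smul, Real.norm_of_nonneg (by positivity), ← dist_eq_norm]
    exact mul_le_mul_of_nonneg_left (h i _) (by positivity)
  refine (Finset.sum_le_sum fun j _ => this j).trans ?_
  rw [Finset.sum_const, Finset.card_univ, Fintype.card_fin, nsmul_eq_mul, ← mul_assoc]
  refine mul_le_mul_of_nonneg_right ?_ hD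
  rwa [← div_eq_mul_inv, div_le_iff₀ hk]

theorem affBdry_single_mem {V : Type} {k : ℕ} {T : Set (Fin k → V)} {v : Fin (k + 1) → V}
    (h : ∀ i : Fin (k + 1), v ∘ i.succAbove ∈ T) :
    affBdry k (Finsupp.single v (1 : F)) ∈ Finsupp.supported F F T := by
  rw [affBdry_single]
  exact Submodule.sum_mem _ fun i _ =>
    Submodule.smul_mem _ _ (Finsupp.single_mem_supported F _ (h i))

theorem cone_mem {V : Type} {k : ℕ} {b : V} {S : Set (Fin k → V)} {T : Set (Fin (k + 1) → V)}
    (h : ∀ w ∈ S, (Fin.cons b w : Fin (k + 1) → V) ∈ T) {c : AffChain F V k}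
    (hc : c ∈ Finsupp.supported F F S) : cone k b c ∈ Finsupp.supported F F T :=
  map_mem_of_mem_supported _ _ (fun w hw => by
    rw [cone_single]
    exact Finsupp.single_mem_supported F _ (h w hw)) hc

theorem sd_mem_ball (x : Simplex m) (R : ℝ) (k : ℕ) {c : AffChain F (Simplex m) k}
    (hc : c ∈ Finsupp.supported F F {w | ∀ j, dist (w j) x ≤ R}) :
    sd k c ∈ Finsupp.supported F F {w | ∀ j, dist (w j) x ≤ R} := by
  induction k with
  | zero => exact hc
  | succ k ih =>
    refine map_mem_of_mem_supported _ _ (fun v hv => ?_) hc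
    rw [sd_single]
    refine cone_mem (fun w hw j => ?_) (ih (affBdry_single_mem fun i j => hv _))
    refine Fin.cases ?_ (fun j => ?_) j
    · exact dist_comb_le hv _
    · exact hw j

/-- A subdivided simplex is a cone from the barycenter over a piece of a subdivided face. Edges
inside the face are handled by induction; edges at the barycenter are short because the original
vertices lie in a ball of radius `r * D` around it, and subdivision stays in that ball. With `k`
vertices the condition on `r` reads r ≥ (k-1)/k. -/
theorem sd_mem_mesh {r D : ℝ} (hr0 : 0 ≤ r) (hr1 : r ≤ 1) (hD : 0 ≤ D) (k : ℕ)
    (hk : (k : ℝ) ≤ r * k + 1) {c : AffChain F (Simplex m) k}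
    (hc : c ∈ Finsupp.supported F F {w | ∀ i j, dist (w i) (w j) ≤ D}) :
    sd k c ∈ Finsupp.supported F F {w | ∀ i j, dist (w i) (w j) ≤ r * D} := by
  induction k with
  | zero => exact Finsupp.supported_mono (fun w _ i => i.elim0) hc
  | succ k ih =>
    refine map_mem_of_mem_supported _ _ (fun v hv => ?_) hc
    rw [sd_single]
    push_cast at hk
    have h1 := ih (by linarith) (c := affBdry k (Finsupp.single v 1))
      (affBdry_single_mem fun i a b => hv _ _)
    have hb := dist_bary_le (v := v) (r := r) (by linarith) hD hv
    have h2 := sd_mem_ball (F := F) (bary v) (r * D) k (c := affBdry k (Finsupp.single v 1))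
      (affBdry_single_mem fun i a => hb _)
    have h3 : sd k (affBdry k (Finsupp.single v (1 : F))) ∈ Finsupp.supported F F
        ({w | ∀ i j, dist (w i) (w j) ≤ r * D} ∩ {w | ∀ j, dist (w j) (bary v) ≤ r * D}) := by
      rw [Finsupp.mem_supported] at *
      exact Set.subset_inter h1 h2
    refine cone_mem (fun w hw i j => ?_) h3
    refine Fin.cases ?_ (fun i => ?_) i <;> refine Fin.cases ?_ (fun j => ?_) j
    · simpa using mul_nonneg hr0 hD
    · rw [Fin.cons_zero, Fin.cons_succ, dist_comm]
      exact hw.2 j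
    · exact hw.2 i
    · exact hw.1 i j

theorem iterate_sd_mem_mesh {r D : ℝ} (hr0 : 0 ≤ r) (hr1 : r ≤ 1) (hD : 0 ≤ D) (k : ℕ)
    (hk : (k : ℝ) ≤ r * k + 1) {c : AffChain F (Simplex m) k}
    (hc : c ∈ Finsupp.supported F F {w | ∀ i j, dist (w i) (w j) ≤ D}) (n : ℕ) :
    (sd k)^[n] c ∈ Finsupp.supported F F {w | ∀ i j, dist (w i) (w j) ≤ r ^ n * D} := by
  induction n with
  | zero => simpa using hc
  | succ n ih =>
    rw [Function.iterate_succ_apply', pow_succ', mul_assoc]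
    exact sd_mem_mesh hr0 hr1 (by positivity) k hk ih

end

section

variable {F : Type u} [Field F] {X : Type} [TopologicalSpace X]

theorem iterate_subdiv_push_toChain {V : Type} [TopologicalSpace V] [ConvComb V] (k : ℕ)
    (f : C(V, X)) (c : AffChain F V k) (n : ℕ) :
    (subdiv k)^[n] (push k f (toChain k c)) = push k f (toChain k ((sd k)^[n] c)) := by
  induction n with
  | zero => rfl
  | succ n ih => rw [Function.iterate_succ_apply', Function.iterate_succ_apply', ih, subdiv_push,
      subdiv_toChain]

/-- Sums of chains of two subspaces. -/
def small (F : Type u) [Field F] (U V : Set X) (k : ℕ) : Submodule F (Chain F k X) :=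
  sub F U k ⊔ sub F V k

theorem subdiv_mem_small {U V : Set X} {k : ℕ} {c : Chain F k X} (hc : c ∈ small F U V k) :
    subdiv k c ∈ small F U V k := by
  obtain ⟨a, ha, b, hb, rfl⟩ := Submodule.mem_sup.1 hc
  rw [map_add]
  exact Submodule.add_mem_sup (subdiv_mem_sub ha) (subdiv_mem_sub hb)

theorem iterate_subdiv_mem_small {U V : Set X} {k : ℕ} {c : Chain F k X}
    (hc : c ∈ small F U V k) (n : ℕ) : (subdiv k)^[n] c ∈ small F U V k := by
  induction n with
  | zero => exact hc
  | succ n ih =>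
    rw [Function.iterate_succ_apply']
    exact subdiv_mem_small ih

/-- Lebesgue's number lemma for the cover of the simplex by the preimages of `U` and `V`: once the
mesh `r ^ n * D` is below that number, each piece lies in the ball around its first vertex, hence in
a single preimage. -/
theorem exists_iterate_subdiv_single_mem_small {A U V : Set X} (hU : IsOpen U) (hV : IsOpen V)
    (hA : A ⊆ U ∪ V) {k : ℕ} (σ : C(Simplex k, X)) (hσ : ∀ t, σ t ∈ A) :
    ∃ n, (subdiv k)^[n] (Finsupp.single σ (1 : F)) ∈ small F (A ∩ U) (A ∩ V) k := by
  cases k with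
  | zero => exact ⟨0, Submodule.mem_sup_left (mem_sub_zero _ _)⟩
  | succ k =>
    obtain ⟨δ, hδ, hball⟩ := lebesgue_number_lemma_of_metric
      (s := (Set.univ : Set (Simplex (k + 1)))) isCompact_univ
      (c := fun b : Bool => σ ⁻¹' (if b then U else V))
      (fun b => by cases b <;> simp [hU.preimage σ.continuous, hV.preimage σ.continuous])
      (fun t _ => by
        rcases hA (hσ t) with h | h
        · exact Set.mem_iUnion.2 ⟨true, by simpa using h⟩
        · exact Set.mem_iUnion.2 ⟨false, by simpa using h⟩)
    set D : ℝ := Metric.diam (Set.univ : Set (Simplex (k + 1)))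
    have hD : 0 ≤ D := Metric.diam_nonneg
    set r : ℝ := (k : ℝ) / (k + 1)
    have hk : (0 : ℝ) < k + 1 := by positivity
    have hr0 : 0 ≤ r := by positivity
    have hr1 : r < 1 := (div_lt_one hk).2 (by linarith)
    have hrk : ((k + 1 : ℕ) : ℝ) ≤ r * (k + 1 : ℕ) + 1 := by
      push_cast
      rw [div_mul_cancel₀ _ hk.ne']
    obtain ⟨n, hn⟩ : ∃ n : ℕ, r ^ n * D < δ := by
      have := (tendsto_pow_atTop_nhds_zero_of_lt_one hr0 hr1).mul_const D
      rw [zero_mul] at this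
      exact (this.eventually (gt_mem_nhds hδ)).exists
    refine ⟨n, ?_⟩
    rw [single_eq_push, iterate_subdiv_push_toChain]
    refine map_mem_of_mem_supported _ ((push (k + 1) σ).comp (toChain (k + 1))) (fun w hw => ?_)
      (iterate_sd_mem_mesh hr0 hr1.le hD (k + 1) hrk (c := univSimplex F (k + 1))
        (Finsupp.single_mem_supported F _ fun i j =>
          Metric.dist_le_diam_of_mem (isCompact_univ.isBounded) trivial trivial) n)
    rw [LinearMap.comp_apply, toChain_single, push_single]
    obtain ⟨b, hb⟩ := hball (w 0) trivial
    have hw' : ∀ t, comb w t ∈ Metric.ball (w 0) δ := fun t =>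
      (dist_comb_le (fun i => hw i 0) t).trans_lt hn
    cases b with
    | true =>
      have h : ∀ t, σ (comb w t) ∈ A ∩ U := fun t => ⟨hσ _, by simpa using hb (hw' t)⟩
      exact Submodule.mem_sup_left (single_mem_sub h _)
    | false =>
      have h : ∀ t, σ (comb w t) ∈ A ∩ V := fun t => ⟨hσ _, by simpa using hb (hw' t)⟩
      exact Submodule.mem_sup_right (single_mem_sub h _)

theorem exists_iterate_subdiv_mem_small {A U V : Set X} (hU : IsOpen U) (hV : IsOpen V)
    (hA : A ⊆ U ∪ V) {k : ℕ} {c : Chain F k X} (hc : c ∈ sub F A k) :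
    ∃ n, (subdiv k)^[n] c ∈ small F (A ∩ U) (A ∩ V) k := by
  -- Smallness survives further subdivision, so the numbers of subdivisions of two summands can be
  -- added; the chains that become small form a subspace.
  let S : Submodule F (Chain F k X) :=
    { carrier := {c | ∃ n, (subdiv k)^[n] c ∈ small F (A ∩ U) (A ∩ V) k}
      zero_mem' := ⟨0, Submodule.zero_mem _⟩
      add_mem' := by
        rintro a b ⟨n, hn⟩ ⟨l, hl⟩
        refine ⟨n + l, ?_⟩
        rw [← Module.End.pow_apply, map_add, Module.End.pow_apply, Module.End.pow_apply]
        refine Submodule.add_mem _ ?_ ?_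
        · rw [add_comm, Function.iterate_add_apply]
          exact iterate_subdiv_mem_small hn l
        · rw [Function.iterate_add_apply]
          exact iterate_subdiv_mem_small hl n
      smul_mem' := by
        rintro r a ⟨n, hn⟩
        refine ⟨n, ?_⟩
        rw [← Module.End.pow_apply, map_smul, Module.End.pow_apply]
        exact Submodule.smul_mem _ r hn }
  exact map_mem_of_mem_sub S LinearMap.id
    (fun σ hσ => exists_iterate_subdiv_single_mem_small hU hV hA σ hσ) hc

theorem isCyc_subdiv {k : ℕ} {c : Chain F k X} (hc : IsCyc c) : IsCyc (subdiv k c) := by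
  cases k with
  | zero => trivial
  | succ k =>
    change bdry k _ = 0
    rw [bdry_subdiv, show bdry k c = 0 from hc, map_zero]

theorem isCyc_iterate_subdiv {k : ℕ} {c : Chain F k X} (hc : IsCyc c) (n : ℕ) :
    IsCyc ((subdiv k)^[n] c) := by
  induction n with
  | zero => exact hc
  | succ n ih =>
    rw [Function.iterate_succ_apply']
    exact isCyc_subdiv ih

theorem prismMap_constHomotopy_mem_sub {A : Set X} {k : ℕ} {c : Chain F k X}
    (hc : c ∈ sub F A k) :
    prismMap (constHomotopy (ContinuousMap.id X)) k c ∈ sub F A (k + 1) :=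
  prismMap_mem_sub (fun _ hx _ => hx) hc

theorem bdry_prismMap_constHomotopy {k : ℕ} {c : Chain F k X} (hc : IsCyc c) :
    bdry k (prismMap (constHomotopy (ContinuousMap.id X)) k c) = subdiv k c - c := by
  rw [bdry_prismMap_of_isCyc _ hc, slice_constHomotopy, slice_constHomotopy, push_id, push_id]

theorem exists_bdry_eq_iterate_subdiv_sub {A : Set X} {k : ℕ} {c : Chain F k X}
    (hc : c ∈ sub F A k) (hcyc : IsCyc c) (n : ℕ) :
    ∃ e ∈ sub F A (k + 1), bdry k e = (subdiv k)^[n] c - c := by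
  induction n with
  | zero => exact ⟨0, Submodule.zero_mem _, by simp⟩
  | succ n ih =>
    obtain ⟨e, he, h⟩ := ih
    have hn : (subdiv k)^[n] c ∈ sub F A k := by
      simpa [small] using iterate_subdiv_mem_small (U := A) (V := A) (by simpa [small] using hc) n
    refine ⟨_, Submodule.add_mem _ he (prismMap_constHomotopy_mem_sub hn), ?_⟩
    rw [map_add, h, bdry_prismMap_constHomotopy (isCyc_iterate_subdiv hcyc n),
      Function.iterate_succ_apply']
    abel

/-- The prism of the constant homotopy does not enlarge supports, so applied to the two summands of
a small chain it stays small. -/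
theorem exists_small_bdry_eq_iterate_subdiv_sub {U V : Set X} {k : ℕ} {c : Chain F k X}
    (hc : c ∈ small F U V k) (hcyc : IsCyc c) (n : ℕ) :
    ∃ e ∈ small F U V (k + 1), bdry k e = (subdiv k)^[n] c - c := by
  induction n with
  | zero => exact ⟨0, Submodule.zero_mem _, by simp⟩
  | succ n ih =>
    obtain ⟨e, he, h⟩ := ih
    obtain ⟨a, ha, b, hb, hab⟩ := Submodule.mem_sup.1 (iterate_subdiv_mem_small hc n)
    refine ⟨e + prismMap (constHomotopy (ContinuousMap.id X)) k ((subdiv k)^[n] c),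
      Submodule.add_mem _ he ?_, ?_⟩
    · rw [← hab, map_add]
      exact Submodule.add_mem_sup (prismMap_constHomotopy_mem_sub ha)
        (prismMap_constHomotopy_mem_sub hb)
    · rw [map_add, h, bdry_prismMap_constHomotopy (isCyc_iterate_subdiv hcyc n),
        Function.iterate_succ_apply']
      abel

theorem bdry_iterate_subdiv (k n : ℕ) (c : Chain F (k + 1) X) :
    bdry k ((subdiv (k + 1))^[n] c) = (subdiv k)^[n] (bdry k c) := by
  induction n with
  | zero => rfl
  | succ n ih => rw [Function.iterate_succ_apply', Function.iterate_succ_apply', bdry_subdiv, ih]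

/-- Every cycle is homologous to a small one. -/
theorem exists_small_homologous {A U V : Set X} (hU : IsOpen U) (hV : IsOpen V) (hA : A ⊆ U ∪ V)
    {k : ℕ} {c : Chain F k X} (hc : c ∈ sub F A k) (hcyc : IsCyc c) :
    ∃ c' ∈ small F (A ∩ U) (A ∩ V) k, ∃ e ∈ sub F A (k + 1), bdry k e = c' - c := by
  obtain ⟨n, hn⟩ := exists_iterate_subdiv_mem_small hU hV hA hc
  exact ⟨_, hn, exists_bdry_eq_iterate_subdiv_sub hc hcyc n⟩

/-- A small cycle which is a boundary is the boundary of a small chain. -/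
theorem exists_small_bdry_eq {A U V : Set X} (hU : IsOpen U) (hV : IsOpen V) (hA : A ⊆ U ∪ V)
    {k : ℕ} {c : Chain F (k + 1) X} (hc : c ∈ sub F A (k + 1))
    (hsmall : bdry k c ∈ small F (A ∩ U) (A ∩ V) k) :
    ∃ c' ∈ small F (A ∩ U) (A ∩ V) (k + 1), bdry k c' = bdry k c := by
  obtain ⟨n, hn⟩ := exists_iterate_subdiv_mem_small hU hV hA hc
  -- Subdividing `c` also subdivides its boundary. The chain `e` is small and accounts for exactly
  -- that change, so subtracting it restores the boundary.
  obtain ⟨e, he, h⟩ := exists_small_bdry_eq_iterate_subdiv_sub hsmall (isCyc_bdry c) n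
  refine ⟨_, Submodule.sub_mem _ hn he, ?_⟩
  rw [map_sub, h, bdry_iterate_subdiv]
  abel

end

end SimplexChain


namespace SimplexChain

/-! ### Acyclic subspaces and homology spheres -/

section

variable {F : Type u} [Field F] {X : Type} [TopologicalSpace X]

theorem IsCyc.sub {k : ℕ} {c c' : Chain F k X} (hc : IsCyc c) (hc' : IsCyc c') :
    IsCyc (c - c') := by
  rw [sub_eq_add_neg, ← neg_one_smul F]
  exact hc.add (hc'.smul _)

/-- The boundaries of the chains of a subspace. -/
def bounds (A : Set X) (k : ℕ) : Submodule F (Chain F k X) := (sub F A (k + 1)).map (bdry k)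

theorem bounds_mono {A B : Set X} (h : A ⊆ B) (k : ℕ) :
    bounds (F := F) A k ≤ bounds B k :=
  Submodule.map_mono (sub_mono h _)

variable (F) in
/-- All reduced cycles of a subspace in a given degree are boundaries. -/
def AcyclicAt (A : Set X) (k : ℕ) : Prop :=
  ∀ c ∈ sub F A k, IsCyc c → c ∈ bounds A k

/-- The reduced homology of `A` is concentrated in degree `n` and freely generated by the class of
`w` there. -/
structure IsHomologySphere (A : Set X) (n : ℕ) (w : Chain F n X) : Prop where
  mem : w ∈ sub F A n
  isCyc : IsCyc w
  acyclicAt : ∀ k, k ≠ n → AcyclicAt F A k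
  spans : ∀ c ∈ sub F A n, IsCyc c → ∃ a : F, c - a • w ∈ bounds A n
  notMem_bounds : w ∉ bounds A n

/-- If the empty simplex bounds, some nonzero chain of points of `A` exists. -/
theorem AcyclicAt.nonempty {A : Set X} (h : AcyclicAt F A 0) : A.Nonempty := by
  obtain ⟨e, he, h'⟩ := h (Finsupp.single ⟨fun t => isEmptyElim t, by fun_prop⟩ 1)
    (mem_sub_zero _ _) trivial
  by_contra hA
  rw [Set.not_nonempty_iff_eq_empty] at hA
  subst hA
  rw [eq_zero_of_mem_sub_empty he, map_zero] at h'
  exact Finsupp.single_ne_zero.2 one_ne_zero h'.symm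

/-! ### Constant simplices -/

/-- The constant simplex at a point. -/
def cst (k : ℕ) (x : X) : C(Simplex k, X) := ContinuousMap.const _ x

theorem bdry_single_cst (k : ℕ) (x : X) (a : F) :
    bdry k (Finsupp.single (cst (k + 1) x) a) =
      if Even k then Finsupp.single (cst k x) a else 0 := by
  rw [bdry_single]
  change ∑ i : Fin (k + 1), (-1 : F) ^ (i : ℕ) • Finsupp.single (cst k x) a = _
  rw [← Finset.sum_smul, Fin.sum_neg_one_pow]
  simp only [Nat.even_add_one]
  split_ifs <;> simp_all

theorem eq_cst {k : ℕ} {x : X} {σ : C(Simplex k, X)} (h : ∀ t, σ t ∈ ({x} : Set X)) :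
    σ = cst k x := by
  ext1 t
  exact h t

/-- There is one simplex in each index. In even index it is the boundary of the next one; in odd
index it is not a cycle. -/
theorem acyclicAt_singleton (x : X) (k : ℕ) : AcyclicAt F {x} k := by
  intro c hc hcyc
  obtain ⟨a, rfl⟩ : ∃ a : F, c = Finsupp.single (cst k x) a := by
    have : c ∈ Submodule.span F {Finsupp.single (cst k x) (1 : F)} :=
      map_mem_of_mem_sub _ LinearMap.id (fun σ hσ => by
        rw [eq_cst hσ]
        exact Submodule.mem_span_singleton_self _) hc
    obtain ⟨a, ha⟩ := Submodule.mem_span_singleton.1 this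
    exact ⟨a, by simpa using ha.symm⟩
  by_cases hk : Even k
  · exact ⟨Finsupp.single (cst (k + 1) x) a, single_mem_sub (fun _ => rfl) _, by
      rw [bdry_single_cst, if_pos hk]⟩
  · obtain ⟨l, rfl⟩ : ∃ l, k = l + 1 :=
      ⟨k - 1, by rcases k with _ | k <;> simp_all⟩
    have h : bdry l (Finsupp.single (cst (l + 1) x) a) = 0 := hcyc
    rw [bdry_single_cst, if_pos (by simpa [Nat.even_add_one] using hk)] at h
    rw [Finsupp.single_eq_zero.1 h, Finsupp.single_zero]
    exact Submodule.zero_mem _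

/-- The contraction of the constant simplices. -/
def constCone (k : ℕ) : Chain F (k + 1) X →ₗ[F] Chain F (k + 2) X :=
  Finsupp.lmapDomain F F fun σ => cst (k + 2) (σ stdSimplex.barycenter)

variable (F X) in
/-- The span of the constant simplices. -/
def consts (k : ℕ) : Submodule F (Chain F k X) := ⨆ x : X, sub F {x} k

/-- For each point the constant simplices form a complex with boundaries alternately 1 and 0, and
raising the dimension contracts it. The indices start at 2 because `constCone` needs a point of the
simplex and so is not defined on the empty one. -/
theorem bdry_constCone (k : ℕ) {c : Chain F (k + 2) X} (hc : c ∈ consts F X (k + 2)) :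
    bdry (k + 2) (constCone (k + 1) c) + constCone k (bdry (k + 1) c) = c := by
  suffices h : consts F X (k + 2) ≤ LinearMap.eqLocus
      ((bdry (k + 2)).comp (constCone (k + 1)) + (constCone k).comp (bdry (k + 1)))
      LinearMap.id from h hc
  refine iSup_le fun x c hc => ?_
  refine map_mem_of_mem_sub _ LinearMap.id (fun σ hσ => ?_) hc
  rw [eq_cst hσ, LinearMap.mem_eqLocus]
  have h (l : ℕ) : constCone l (Finsupp.single (cst (l + 1) x) (1 : F)) =
      Finsupp.single (cst (l + 2) x) 1 := by
    simp [constCone, cst]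
  simp only [LinearMap.id_apply, LinearMap.add_apply, LinearMap.comp_apply, h, bdry_single_cst]
  by_cases hk : Even k
  · rw [if_pos (by simpa [Nat.even_add] using hk), if_neg (by simpa [Nat.even_add_one] using hk)]
    simp
  · rw [if_neg (by simpa [Nat.even_add] using hk), if_pos (by simpa [Nat.even_add_one] using hk),
      h, zero_add]

theorem constCone_mem_consts (k : ℕ) (c : Chain F (k + 1) X) :
    constCone k c ∈ consts F X (k + 2) := by
  refine map_mem_of_mem_sub (consts F X (k + 2)) (constCone k) (fun σ _ => ?_) (mem_sub_univ c)
  refine Submodule.mem_iSup_of_mem (p := fun x : X => sub (X := X) F {x} (k + 2)) (σ stdSimplex.barycenter) ?_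
  simp only [constCone, Finsupp.lmapDomain_apply, Finsupp.mapDomain_single]
  exact single_mem_sub (fun t => rfl) _

theorem constCone_mem_sub {A : Set X} {k : ℕ} {c : Chain F (k + 1) X}
    (hc : c ∈ sub F A (k + 1)) : constCone k c ∈ sub F A (k + 2) := by
  refine map_mem_of_mem_sub _ _ (fun σ hσ => ?_) hc
  simp only [constCone, Finsupp.lmapDomain_apply, Finsupp.mapDomain_single]
  exact single_mem_sub (fun t => hσ stdSimplex.barycenter) _

/-- A cycle which is a sum of constant simplices and of a chain of `A` bounds a chain of the same
kind if all cycles of `A` are boundaries. -/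
theorem exists_bdry_eq_of_mem_consts_sup_sub {A : Set X} {k : ℕ} (hA : AcyclicAt F A (k + 2))
    {c : Chain F (k + 2) X} (hc : c ∈ consts F X (k + 2) ⊔ sub F A (k + 2)) (hcyc : IsCyc c) :
    ∃ e ∈ consts F X (k + 3) ⊔ sub F A (k + 3), bdry (k + 2) e = c := by
  obtain ⟨q, hq, a, ha, rfl⟩ := Submodule.mem_sup.1 hc
  have hqa : bdry (k + 1) q = -bdry (k + 1) a :=
    eq_neg_of_add_eq_zero_left (by rw [← map_add]; exact hcyc)
  have h := bdry_constCone k hq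
  -- The boundaries of `q` and `a` cancel, so that of `q` is a chain of `A`, and `constCone` stays
  -- in `A`. Modulo the boundary of `constCone (k + 1) q`, the cycle `q + a` thus becomes a cycle of
  -- `A`.
  have hm : constCone k (bdry (k + 1) q) ∈ sub F A (k + 2) := by
    rw [hqa]
    exact constCone_mem_sub (Submodule.neg_mem _ (bdry_mem_sub ha))
  obtain ⟨e, he, h'⟩ := hA (constCone k (bdry (k + 1) q) + a) (Submodule.add_mem _ hm ha) (by
    have := hcyc.sub (isCyc_bdry (constCone (k + 1) q))
    convert this using 1
    nth_rw 2 [← h]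
    abel)
  refine ⟨_, Submodule.add_mem_sup (constCone_mem_consts (k + 1) q) he, ?_⟩
  rw [map_add, h', ← add_assoc, h]

/-! ### Deformation retracts -/

section

variable {A B : Set X} {H : C(A × unitInterval, X)}

theorem exists_homologous_of_retract (hA : ∀ a s, H (a, s) ∈ A) (h0 : ∀ a, H (a, 0) = a)
    (h1 : ∀ a, H (a, 1) ∈ B) {k : ℕ} {c : Chain F k X} (hc : c ∈ sub F A k) (hcyc : IsCyc c) :
    ∃ c' ∈ sub F B k, IsCyc c' ∧ c' - c ∈ bounds A k := by
  obtain ⟨c, rfl⟩ := exists_push_incl_eq hc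
  have hc0 := hcyc.of_push_incl
  refine ⟨push k (slice H 1) c, push_mem_sub h1 c, hc0.push _, ?_⟩
  obtain ⟨e, he, h⟩ := exists_bdry_eq_push_sub_push hA hc0
  refine ⟨e, he, ?_⟩
  rw [h, show slice H 0 = incl A from ContinuousMap.ext h0]

/-- Only the end map of `H` matters: it sends a bounding chain of `A` into `B` and fixes the given
chain of `B`. -/
theorem bdry_mem_bounds_of_retract (hBA : B ⊆ A) (h1 : ∀ a, H (a, 1) ∈ B)
    (hB : ∀ a : A, (a : X) ∈ B → H (a, 1) = a) {k : ℕ} {c : Chain F k X} (hc : c ∈ bounds A k)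
    (hcB : c ∈ sub F B k) : c ∈ bounds B k := by
  obtain ⟨e, he, rfl⟩ := hc
  obtain ⟨b, hb⟩ := exists_push_incl_eq hcB
  obtain ⟨e, rfl⟩ := exists_push_incl_eq he
  refine ⟨push _ (slice H 1) e, push_mem_sub h1 e, ?_⟩
  let j : C(B, A) := ⟨Set.inclusion hBA, continuous_inclusion hBA⟩
  have hj : push k j b = bdry k e := by
    apply push_incl_injective A k
    rw [push_push, ← bdry_push, ← hb]
    rfl
  rw [bdry_push, ← hj, push_push, ← hb]
  congr 1
  congr 1
  exact ContinuousMap.ext fun x => hB _ x.2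

theorem AcyclicAt.of_retract (hBA : B ⊆ A) (hA : ∀ a s, H (a, s) ∈ A) (h0 : ∀ a, H (a, 0) = a)
    (h1 : ∀ a, H (a, 1) ∈ B) {k : ℕ} (h : AcyclicAt F B k) : AcyclicAt F A k := by
  intro c hc hcyc
  obtain ⟨c', hc', hcyc', he⟩ := exists_homologous_of_retract hA h0 h1 hc hcyc
  simpa using Submodule.sub_mem _ (bounds_mono hBA k (h c' hc' hcyc')) he

theorem IsHomologySphere.of_retract (hBA : B ⊆ A) (hA : ∀ a s, H (a, s) ∈ A)
    (h0 : ∀ a, H (a, 0) = a) (h1 : ∀ a, H (a, 1) ∈ B) (hB : ∀ a : A, (a : X) ∈ B → H (a, 1) = a)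
    {n : ℕ} {w : Chain F n X} (h : IsHomologySphere B n w) : IsHomologySphere A n w where
  mem := sub_mono hBA n h.mem
  isCyc := h.isCyc
  acyclicAt k hk := (h.acyclicAt k hk).of_retract hBA hA h0 h1
  spans c hc hcyc := by
    obtain ⟨c', hc', hcyc', he⟩ := exists_homologous_of_retract hA h0 h1 hc hcyc
    obtain ⟨a, ha⟩ := h.spans c' hc' hcyc'
    refine ⟨a, ?_⟩
    convert Submodule.sub_mem _ (bounds_mono hBA n ha) he using 1
    abel
  notMem_bounds hw := h.notMem_bounds (bdry_mem_bounds_of_retract hBA h1 hB hw h.mem)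

/-- A contractible subspace is acyclic. -/
theorem acyclicAt_of_contractible {x : X} (hx : x ∈ A) (hA : ∀ a s, H (a, s) ∈ A)
    (h0 : ∀ a, H (a, 0) = a) (h1 : ∀ a, H (a, 1) = x) (k : ℕ) : AcyclicAt F A k :=
  (acyclicAt_singleton x k).of_retract (Set.singleton_subset_iff.2 hx) hA h0 h1

end

/-! ### The Mayer–Vietoris argument -/

/-- The augmented complex of ∅ is the field in index 0 and zero elsewhere: ∅ is the sphere of
dimension -1, from which the induction starts. -/
theorem isHomologySphere_empty :
    IsHomologySphere (∅ : Set X) 0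
      (Finsupp.single ⟨fun t => isEmptyElim t, by fun_prop⟩ (1 : F)) where
  mem := mem_sub_zero _ _
  isCyc := trivial
  acyclicAt k hk c hc _ := by
    obtain ⟨l, rfl⟩ := Nat.exists_eq_succ_of_ne_zero hk
    rw [eq_zero_of_mem_sub_empty hc]
    exact Submodule.zero_mem _
  spans c _ _ := by
    refine ⟨c ⟨fun t => isEmptyElim t, by fun_prop⟩, ?_⟩
    convert Submodule.zero_mem _
    rw [sub_eq_zero]
    ext σ
    obtain rfl : σ = ⟨fun t => isEmptyElim t, by fun_prop⟩ := by
      ext1 t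
      exact isEmptyElim t
    simp
  notMem_bounds := by
    rintro ⟨e, he, h⟩
    rw [eq_zero_of_mem_sub_empty he, map_zero] at h
    exact Finsupp.single_ne_zero.2 one_ne_zero h.symm

theorem isCyc_of_bdry_add_eq_zero {k : ℕ} {u v : Chain F (k + 1) X} (h : IsCyc (u + v)) :
    bdry k u = -bdry k v :=
  eq_neg_of_add_eq_zero_left (by rw [← map_add]; exact h)

/-- Mayer–Vietoris by hand. The cycle `w` bounds `u₀` in one piece and `v₀` in the other, and `u₀ -
v₀` is its suspension. Conversely a small cycle `u + v` is sent to the boundary of `u`, a cycle of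
the intersection; since both pieces are acyclic, this identifies the homology of `A` with that of
the intersection one index lower. -/
theorem IsHomologySphere.suspend {A U V : Set X} (hU : IsOpen U) (hV : IsOpen V)
    (hA : A ⊆ U ∪ V) (hAU : ∀ k, AcyclicAt F (A ∩ U) k) (hAV : ∀ k, AcyclicAt F (A ∩ V) k)
    {n : ℕ} {w : Chain F n X} (hW : IsHomologySphere ((A ∩ U) ∩ (A ∩ V)) n w) :
    ∃ z : Chain F (n + 1) X, IsHomologySphere A (n + 1) z := by
  have hUA : A ∩ U ⊆ A := Set.inter_subset_left
  have hVA : A ∩ V ⊆ A := Set.inter_subset_left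
  have hWU : (A ∩ U) ∩ (A ∩ V) ⊆ A ∩ U := Set.inter_subset_left
  have hWV : (A ∩ U) ∩ (A ∩ V) ⊆ A ∩ V := Set.inter_subset_right
  obtain ⟨u₀, hu₀, hu₀w⟩ := hAU n w (sub_mono hWU n hW.mem) hW.isCyc
  obtain ⟨v₀, hv₀, hv₀w⟩ := hAV n w (sub_mono hWV n hW.mem) hW.isCyc
  -- Up to a boundary every cycle is a sum of chains of the two pieces, whose boundaries then
  -- cancel.
  have key : ∀ k, ∀ c ∈ sub F A (k + 1), IsCyc c → ∃ u ∈ sub F (A ∩ U) (k + 1),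
      ∃ v ∈ sub F (A ∩ V) (k + 1), bdry k u = -bdry k v ∧ c - (u + v) ∈ bounds A (k + 1) := by
    intro k c hc hcyc
    obtain ⟨c', hc', e, he, hec⟩ := exists_small_homologous hU hV hA hc hcyc
    obtain ⟨u, hu, v, hv, rfl⟩ := Submodule.mem_sup.1 hc'
    refine ⟨u, hu, v, hv, isCyc_of_bdry_add_eq_zero ?_, -e, Submodule.neg_mem _ he, ?_⟩
    · convert (isCyc_bdry e).add hcyc using 1
      rw [hec]
      abel
    · rw [map_neg, hec]
      abel
  -- Injectivity of the connecting map: if the common boundary bounds `w'` in the intersection, then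
  -- `u - w'` and `v + w'` are cycles of the acyclic pieces.
  have fill : ∀ k, ∀ u ∈ sub F (A ∩ U) (k + 1), ∀ v ∈ sub F (A ∩ V) (k + 1), ∀ w',
      w' ∈ sub F ((A ∩ U) ∩ (A ∩ V)) (k + 1) → bdry k u = bdry k w' → bdry k v = -bdry k w' →
      u + v ∈ bounds A (k + 1) := by
    intro k u hu v hv w' hw' huw hvw
    have h1 := hAU (k + 1) (u - w') (Submodule.sub_mem _ hu (sub_mono hWU _ hw')) (by
      change bdry k _ = 0
      rw [map_sub, huw, sub_self])
    have h2 := hAV (k + 1) (v + w') (Submodule.add_mem _ hv (sub_mono hWV _ hw')) (by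
      change bdry k _ = 0
      rw [map_add, hvw, neg_add_cancel])
    convert Submodule.add_mem _ (bounds_mono hUA _ h1) (bounds_mono hVA _ h2) using 1
    abel
  have hmeet : ∀ k, ∀ u ∈ sub F (A ∩ U) (k + 1), ∀ v ∈ sub F (A ∩ V) (k + 1),
      bdry k u = -bdry k v → bdry k u ∈ sub F ((A ∩ U) ∩ (A ∩ V)) k := fun k u hu v hv h =>
    mem_sub_inter (bdry_mem_sub hu) (h ▸ Submodule.neg_mem _ (bdry_mem_sub hv))
  refine ⟨u₀ - v₀, Submodule.sub_mem _ (sub_mono hUA _ hu₀) (sub_mono hVA _ hv₀), ?_, ?_, ?_, ?_⟩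
  · change bdry n _ = 0
    rw [map_sub, hu₀w, hv₀w, sub_self]
  · intro k hk c hc hcyc
    cases k with
    -- The empty simplex already bounds in the piece `A ∩ U`.
    | zero => exact bounds_mono hUA 0 (hAU 0 c (mem_sub_zero _ _) hcyc)
    | succ k =>
      obtain ⟨u, hu, v, hv, huv, h⟩ := key k c hc hcyc
      obtain ⟨w', hw', hw'u⟩ := hW.acyclicAt k (by simpa using hk) _ (hmeet k u hu v hv huv)
        (isCyc_bdry u)
      have := fill k u hu v hv w' hw' hw'u.symm (by rw [hw'u, huv, neg_neg])
      simpa using Submodule.add_mem _ h this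
  · intro c hc hcyc
    obtain ⟨u, hu, v, hv, huv, h⟩ := key n c hc hcyc
    obtain ⟨a, w', hw', hw'u⟩ := hW.spans _ (hmeet n u hu v hv huv) (isCyc_bdry u)
    refine ⟨a, ?_⟩
    have := fill n (u - a • u₀) (Submodule.sub_mem _ hu (Submodule.smul_mem _ _ hu₀))
      (v + a • v₀) (Submodule.add_mem _ hv (Submodule.smul_mem _ _ hv₀)) w' hw'
      (by rw [map_sub, map_smul, hu₀w, hw'u])
      (by rw [map_add, map_smul, hv₀w, hw'u, huv]; abel)
    convert Submodule.add_mem _ h this using 1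
    rw [smul_sub]
    abel
  · rintro ⟨e, he, h⟩
    obtain ⟨e', he', h'⟩ := exists_small_bdry_eq hU hV hA he
      (h ▸ Submodule.sub_mem _ (Submodule.mem_sup_left hu₀) (Submodule.mem_sup_right hv₀))
    -- If `u₀ - v₀` is the boundary of `a + b`, then `u₀ - ∂a = v₀ + ∂b` lies in both pieces and
    -- bounds `w` in the intersection.
    obtain ⟨a, ha, b, hb, rfl⟩ := Submodule.mem_sup.1 he'
    refine hW.notMem_bounds ⟨u₀ - bdry (n + 1) a, mem_sub_inter
      (Submodule.sub_mem _ hu₀ (bdry_mem_sub ha)) ?_, ?_⟩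
    · have : u₀ - bdry (n + 1) a = v₀ + bdry (n + 1) b := by
        rw [h, map_add] at h'
        rw [sub_eq_iff_eq_add, add_assoc, add_comm (bdry _ b), h']
        abel
      rw [this]
      exact Submodule.add_mem _ hv₀ (bdry_mem_sub hb)
    · rw [map_sub, bdry_bdry, sub_zero, hu₀w]

/-- All cycles of positive dimension bound in a disjoint union of two subspaces if they do so in
the parts. -/
theorem AcyclicAt.union {A B : Set X} (hA : IsClosed A) (hB : IsClosed B) (hAB : A ∩ B = ∅)
    {k : ℕ} (h : AcyclicAt F A (k + 2)) (h' : AcyclicAt F B (k + 2)) :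
    AcyclicAt F (A ∪ B) (k + 2) := by
  intro c hc hcyc
  -- The image of a simplex is connected, so it lies in one of the two disjoint closed sets.
  have : c ∈ small F A B (k + 2) := map_mem_of_mem_sub _ LinearMap.id (fun σ hσ => by
    have hconn : IsPreconnected (Set.range σ) := isPreconnected_range σ.continuous
    rcases isPreconnected_iff_subset_of_disjoint_closed.1 hconn A B hA hB
      (Set.range_subset_iff.2 hσ) (by rw [hAB, Set.inter_empty]) with h | h
    · exact Submodule.mem_sup_left (single_mem_sub (fun t => h ⟨t, rfl⟩) _)
    · exact Submodule.mem_sup_right (single_mem_sub (fun t => h ⟨t, rfl⟩) _)) hc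
  obtain ⟨a, ha, b, hb, rfl⟩ := Submodule.mem_sup.1 this
  have hab := isCyc_of_bdry_add_eq_zero hcyc
  -- This boundary is supported in both disjoint sets, and a simplex with at least one vertex cannot
  -- lie in ∅. In index 1 the empty simplex would remain, so two components are not acyclic there.
  have h0 : bdry (k + 1) a = 0 := by
    refine eq_zero_of_mem_sub_empty ?_
    rw [← hAB]
    refine mem_sub_inter (bdry_mem_sub ha) ?_
    rw [hab]
    exact Submodule.neg_mem _ (bdry_mem_sub hb)
  exact Submodule.add_mem _ (bounds_mono Set.subset_union_left _ (h a ha h0))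
    (bounds_mono Set.subset_union_right _ (h' b hb (by
      change bdry (k + 1) b = 0
      rw [← neg_eq_zero, ← hab, h0])))

end

end SimplexChain


namespace SimplexChain

/-! ### Subsets of spheres -/

section

variable {F : Type u} [Field F] {E : Type} [NormedAddCommGroup E] [InnerProductSpace ℝ E]

local notation "𝕊" => Metric.sphere (0 : E) 1

/-- Radial projection of a nowhere vanishing map to the unit sphere. -/
def normalizeMap {T : Type} [TopologicalSpace T] (g : C(T, E)) (hg : ∀ t, g t ≠ 0) : C(T, 𝕊) where
  toFun t := ⟨‖g t‖⁻¹ • g t, by simp [norm_smul, norm_ne_zero_iff.2 (hg t)]⟩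
  continuous_toFun := by
    refine Continuous.subtype_mk (Continuous.smul (Continuous.inv₀ (by fun_prop) fun t => ?_)
      (by fun_prop)) _
    exact norm_ne_zero_iff.2 (hg t)

theorem norm_smul_normalizeMap {T : Type} [TopologicalSpace T] (g : C(T, E)) (hg : ∀ t, g t ≠ 0)
    (t : T) : ‖g t‖ • (normalizeMap g hg t : E) = g t := by
  change ‖g t‖ • ‖g t‖⁻¹ • g t = g t
  rw [smul_smul, mul_inv_cancel₀ (norm_ne_zero_iff.2 (hg t)), one_smul]

theorem normalizeMap_eq {T : Type} [TopologicalSpace T] {g : C(T, E)} {hg : ∀ t, g t ≠ 0}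
    {t : T} {x : 𝕊} (h : g t = x) : normalizeMap g hg t = x := by
  ext1
  change ‖g t‖⁻¹ • g t = x
  rw [h, norm_eq_of_mem_sphere, inv_one, one_smul]

theorem eq_neg_of_smul_eq_neg_smul {x a : 𝕊} {r s : ℝ} (hr : 0 ≤ r) (hs : 0 < s)
    (h : r • (x : E) = -(s • (a : E))) : (x : E) = -a := by
  have hn := congrArg norm h
  rw [norm_neg, norm_smul, norm_smul, norm_eq_of_mem_sphere, norm_eq_of_mem_sphere,
    Real.norm_of_nonneg hr, Real.norm_of_nonneg hs.le, mul_one, mul_one] at hn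
  rw [hn, ← smul_neg] at h
  exact smul_right_injective E hs.ne' h

/-- A subset of a sphere which is star-shaped along great circles is acyclic. -/
theorem acyclicAt_of_starShaped {A : Set 𝕊} {a : 𝕊} (ha : a ∈ A)
    (hne : ∀ x ∈ A, (x : E) ≠ -a)
    -- The radial projection of a point of the chord is described as a unit vector `y` with `N • y`
    -- equal to that point, which avoids dividing by the norm.
    (hA : ∀ x ∈ A, ∀ s ∈ Set.Icc (0 : ℝ) 1, ∀ y : 𝕊, ∀ N : ℝ, 0 < N →
      N • (y : E) = (1 - s) • (x : E) + s • (a : E) → N = ‖(1 - s) • (x : E) + s • (a : E)‖ → y ∈ A)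
    (k : ℕ) : AcyclicAt F A k := by
  let g : C(A × unitInterval, E) :=
    ⟨fun q => (1 - (q.2 : ℝ)) • ((q.1 : 𝕊) : E) + (q.2 : ℝ) • (a : E), by fun_prop⟩
  have hg : ∀ q, g q ≠ 0 := by
    rintro ⟨x, s⟩ h
    have h : (1 - (s : ℝ)) • ((x : 𝕊) : E) + (s : ℝ) • (a : E) = 0 := h
    rcases s.2.1.eq_or_lt with h0 | h0
    · rw [← h0, sub_zero, one_smul, zero_smul, add_zero] at h
      exact ne_zero_of_mem_unit_sphere _ h
    · exact hne x x.2 (eq_neg_of_smul_eq_neg_smul (sub_nonneg.2 s.2.2) h0 (eq_neg_of_add_eq_zero_left h))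
  refine acyclicAt_of_contractible (H := normalizeMap g hg) ha (fun x s => ?_) (fun x => ?_)
    (fun x => ?_) k
  · exact hA x x.2 s s.2 _ _ (norm_pos_iff.2 (hg _)) (norm_smul_normalizeMap g hg (x, s)) rfl
  · exact normalizeMap_eq (by simp [g])
  · exact normalizeMap_eq (by simp [g])

/-- Spherical caps are acyclic. -/
theorem acyclicAt_cap (μ : 𝕊) {c : ℝ} (hc0 : 0 ≤ c) (hc1 : c ≤ 1) (k : ℕ) :
    AcyclicAt F {x : 𝕊 | c ≤ inner ℝ (x : E) (μ : E)} k := by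
  have hμ : inner ℝ (μ : E) (μ : E) = 1 := by
    rw [real_inner_self_eq_norm_sq, norm_eq_of_mem_sphere, one_pow]
  refine acyclicAt_of_starShaped (a := μ) (by simpa [hμ] using hc1) (fun x hx h => ?_)
    (fun x hx s hs y N hN h hN' => ?_) k
  · rw [Set.mem_ofPred_eq, h, inner_neg_left, hμ] at hx
    linarith
  -- Chords lie in the unit ball, so projecting outwards multiplies a nonnegative inner product by
  -- 1/N ≥ 1 and cannot leave the cap.
  · have h1 : N ≤ 1 := by
      rw [hN']
      refine (norm_add_le _ _).trans ?_
      rw [norm_smul, norm_smul, norm_eq_of_mem_sphere, norm_eq_of_mem_sphere,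
        Real.norm_of_nonneg (sub_nonneg.2 hs.2), Real.norm_of_nonneg hs.1]
      linarith
    have h2 := congrArg (fun z => inner ℝ z (μ : E)) h
    simp only [inner_add_left, real_inner_smul_left, hμ] at h2
    have hx : c ≤ inner ℝ (x : E) (μ : E) := hx
    change c ≤ inner ℝ (y : E) (μ : E)
    have h3 : c ≤ N * inner ℝ (y : E) (μ : E) := by
      rw [h2]
      nlinarith [hs.1, hs.2, mul_le_mul_of_nonneg_left hx (sub_nonneg.2 hs.2)]
    have h4 : 0 ≤ inner ℝ (y : E) (μ : E) := by
      by_contra hneg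
      nlinarith
    nlinarith

/-- The unit sphere of a subspace. -/
def subsphere (K : Submodule ℝ E) : Set 𝕊 := {x | (x : E) ∈ K}

theorem coe_ne_neg_coe (a : 𝕊) : (a : E) ≠ -a := fun h =>
  ne_neg_of_mem_unit_sphere ℝ a (Subtype.ext h)

/-- A punctured sphere is star-shaped about the antipode `a` of the puncture: if a point on the way
from `x` projected to `-a`, then `x` would equal `-a`. -/
theorem acyclicAt_subsphere_diff {K : Submodule ℝ E} {a b : 𝕊} (ha : (a : E) ∈ K)
    (hb : (b : E) = -a) (k : ℕ) : AcyclicAt F (subsphere K ∩ {b}ᶜ) k := by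
  have hne : ∀ x : 𝕊, x ∈ ({b}ᶜ : Set 𝕊) ↔ (x : E) ≠ -a := fun x => by
    rw [Set.mem_compl_iff, Set.mem_singleton_iff, Subtype.ext_iff, hb]
  refine acyclicAt_of_starShaped (A := subsphere K ∩ {b}ᶜ) (a := a) ⟨ha, (hne a).2 (coe_ne_neg_coe a)⟩
    (fun x hx => (hne x).1 hx.2) (fun x hx s hs y N hN h _ => ?_) k
  · refine ⟨?_, (hne y).2 fun hy => ?_⟩
    · have : N • (y : E) ∈ K := h ▸ K.add_mem (K.smul_mem _ hx.1) (K.smul_mem _ ha)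
      exact (K.smul_mem_iff hN.ne').1 this
    · refine (hne x).1 hx.2 (eq_neg_of_smul_eq_neg_smul (r := 1 - s) (s := N + s)
        (sub_nonneg.2 hs.2) (by linarith [hs.1]) ?_)
      rw [hy, smul_neg] at h
      rw [add_smul, neg_add, h]
      abel

/-- A subset of a sphere which is invariant under the flow to an equator is equivalent to it. -/
theorem IsHomologySphere.of_equator {K : Submodule ℝ E} {A : Set 𝕊} {μ : 𝕊}
    (hμK : (μ : E) ∈ K) (hAK : A ⊆ subsphere K)
    (hA1 : ∀ x ∈ A, |inner ℝ (x : E) (μ : E)| < 1)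
    (hA : ∀ x ∈ A, ∀ s ∈ Set.Icc (0 : ℝ) 1, ∀ y : 𝕊, ∀ N : ℝ, 0 < N →
      N • (y : E) = (x : E) - (s * inner ℝ (x : E) (μ : E)) • (μ : E) →
      N = ‖(x : E) - (s * inner ℝ (x : E) (μ : E)) • (μ : E)‖ → y ∈ A)
    (hsub : subsphere ((ℝ ∙ (μ : E))ᗮ ⊓ K) ⊆ A)
    {n : ℕ} {w : Chain F n 𝕊} (hw : IsHomologySphere (subsphere ((ℝ ∙ (μ : E))ᗮ ⊓ K)) n w) :
    IsHomologySphere A n w := by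
  have hμ : inner ℝ (μ : E) (μ : E) = 1 := by
    rw [real_inner_self_eq_norm_sq, norm_eq_of_mem_sphere, one_pow]
  -- The homotopy shrinks the component along `μ` to zero. It never vanishes because a unit vector
  -- with |⟨x,μ⟩| < 1 is not a multiple of `μ`.
  let g : C(A × unitInterval, E) :=
    ⟨fun q => ((q.1 : 𝕊) : E) - ((q.2 : ℝ) * inner ℝ ((q.1 : 𝕊) : E) (μ : E)) • (μ : E),
      by fun_prop⟩
  have hg : ∀ q, g q ≠ 0 := by
    rintro ⟨x, s⟩ h
    have h : ((x : 𝕊) : E) = ((s : ℝ) * inner ℝ ((x : 𝕊) : E) (μ : E)) • (μ : E) :=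
      sub_eq_zero.1 h
    have hn := congrArg norm h
    rw [norm_smul, norm_eq_of_mem_sphere, norm_eq_of_mem_sphere, mul_one, norm_mul,
      Real.norm_of_nonneg s.2.1, Real.norm_eq_abs] at hn
    have := hA1 x x.2
    nlinarith [s.2.1, s.2.2, abs_nonneg (inner ℝ ((x : 𝕊) : E) (μ : E))]
  refine IsHomologySphere.of_retract (H := normalizeMap g hg) hsub (fun x s => ?_) (fun x => ?_)
    (fun x => ?_) (fun x hx => ?_) hw
  · exact hA x x.2 s s.2 _ _ (norm_pos_iff.2 (hg _)) (norm_smul_normalizeMap g hg (x, s)) rfl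
  · exact normalizeMap_eq (by simp [g])
  · have h := norm_smul_normalizeMap g hg (x, 1)
    have hmem : g (x, 1) ∈ (ℝ ∙ (μ : E))ᗮ ⊓ K := by
      refine ⟨?_, K.sub_mem (hAK x.2) (K.smul_mem _ hμK)⟩
      refine Submodule.mem_orthogonal_singleton_iff_inner_left.2 ?_
      simp [g, inner_sub_left, real_inner_smul_left]
    rw [← h] at hmem
    exact (Submodule.smul_mem_iff _ (norm_ne_zero_iff.2 (hg (x, 1)))).1 hmem
  · have : inner ℝ ((x : 𝕊) : E) (μ : E) = 0 :=
      Submodule.mem_orthogonal_singleton_iff_inner_left.1 hx.1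
    exact normalizeMap_eq (by simp [g, this])

theorem abs_inner_lt_one {x μ : 𝕊} (h : x ≠ μ) (h' : (x : E) ≠ -μ) :
    |inner ℝ (x : E) (μ : E)| < 1 := by
  have hx := norm_eq_of_mem_sphere x
  have hμ := norm_eq_of_mem_sphere μ
  rw [abs_lt]
  constructor
  · have : inner ℝ (x : E) (-(μ : E)) < 1 :=
      (inner_lt_one_iff_real_of_norm_eq_one hx (by rwa [norm_neg])).2 h'
    rw [inner_neg_right] at this
    linarith
  · exact (inner_lt_one_iff_real_of_norm_eq_one hx hμ).2 fun h'' => h (Subtype.ext h'')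

/-- The unit sphere of an `n`-dimensional space is a homology sphere. -/
theorem exists_isHomologySphere_subsphere (F : Type u) [Field F] [FiniteDimensional ℝ E] (n : ℕ)
    (K : Submodule ℝ E) (hK : Module.finrank ℝ K = n) :
    ∃ w : Chain F n 𝕊, IsHomologySphere (subsphere K) n w := by
  induction n generalizing K with
  | zero =>
    have : subsphere K = ∅ := by
      rw [Submodule.finrank_eq_zero.1 hK]
      refine Set.eq_empty_of_forall_notMem fun x hx => ?_
      exact ne_zero_of_mem_unit_sphere x ((Submodule.mem_bot ℝ).1 hx)
    rw [this]
    exact ⟨_, isHomologySphere_empty⟩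
  | succ n ih =>
    obtain ⟨v, hv, hv0⟩ := K.exists_mem_ne_zero_of_ne_bot (by
      rintro rfl
      simp at hK)
    let μ : 𝕊 := ⟨‖v‖⁻¹ • v, by simp [norm_smul, norm_ne_zero_iff.2 hv0]⟩
    have hμK : (μ : E) ∈ K := K.smul_mem _ hv
    have hnμK : ((-μ : 𝕊) : E) ∈ K := by simpa using hμK
    have hμ0 := ne_zero_of_mem_unit_sphere μ
    -- The equator of the sphere of `K` with respect to the pole `μ` has one dimension less.
    obtain ⟨w, hw⟩ := ih ((ℝ ∙ (μ : E))ᗮ ⊓ K) (by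
      have := Submodule.finrank_add_inf_finrank_orthogonal
        ((Submodule.span_singleton_le_iff_mem (μ : E) K).2 hμK)
      rw [finrank_span_singleton hμ0, hK] at this
      omega)
    have hne : ∀ x : 𝕊, x ∈ (subsphere K ∩ {-μ}ᶜ) ∩ (subsphere K ∩ {μ}ᶜ) ↔
        x ∈ subsphere K ∧ |inner ℝ (x : E) (μ : E)| < 1 := by
      intro x
      constructor
      · rintro ⟨⟨h, h1⟩, -, h2⟩
        refine ⟨h, abs_inner_lt_one h2 fun h' => h1 (Subtype.ext h')⟩
      · rintro ⟨h, h1⟩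
        refine ⟨⟨h, ?_⟩, h, ?_⟩
        · rintro rfl
          simp at h1
        · rintro rfl
          simp at h1
    have hW : IsHomologySphere ((subsphere K ∩ {-μ}ᶜ) ∩ (subsphere K ∩ {μ}ᶜ)) n w := by
      refine hw.of_equator hμK (fun x hx => hx.1.1) (fun x hx => ((hne x).1 hx).2)
        (fun x hx s hs y N hN h _ => (hne y).2 ?_) (fun x hx => (hne x).2 ⟨hx.2, ?_⟩)
      · have hy : N • (y : E) ∈ K := h ▸ K.sub_mem hx.1.1 (K.smul_mem _ hμK)
        refine ⟨(K.smul_mem_iff hN.ne').1 hy, abs_inner_lt_one ?_ ?_⟩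
        -- Were the projected point a pole, `x` would be a multiple of `μ` and hence have |⟨x,μ⟩| =
        -- 1.
        · rintro rfl
          have hx' : (x : E) = (N + s * inner ℝ (x : E) (μ : E)) • (μ : E) := by
            rw [add_smul, h]
            abel
          have hlt := ((hne x).1 hx).2
          have hn := congrArg norm hx'
          rw [norm_smul, norm_eq_of_mem_sphere, norm_eq_of_mem_sphere, mul_one] at hn
          have hi := congrArg (fun z => inner ℝ z (μ : E)) hx'
          simp only [real_inner_smul_left] at hi
          rw [real_inner_self_eq_norm_sq, norm_eq_of_mem_sphere, one_pow, mul_one] at hi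
          rw [Real.norm_eq_abs, ← hi] at hn
          linarith
        · intro hy
          rw [hy] at h
          have hx' : (x : E) = (-N + s * inner ℝ (x : E) (μ : E)) • (μ : E) := by
            rw [add_smul, neg_smul, ← smul_neg, h]
            abel
          have hlt := ((hne x).1 hx).2
          have hn := congrArg norm hx'
          rw [norm_smul, norm_eq_of_mem_sphere, norm_eq_of_mem_sphere, mul_one] at hn
          have hi := congrArg (fun z => inner ℝ z (μ : E)) hx'
          simp only [real_inner_smul_left] at hi
          rw [real_inner_self_eq_norm_sq, norm_eq_of_mem_sphere, one_pow, mul_one] at hi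
          rw [Real.norm_eq_abs, ← hi] at hn
          linarith
      · rw [Submodule.mem_orthogonal_singleton_iff_inner_left.1 hx.1, abs_zero]
        exact one_pos
    refine hW.suspend isOpen_compl_singleton isOpen_compl_singleton (fun x _ => ?_)
      (acyclicAt_subsphere_diff hμK (by simp)) (acyclicAt_subsphere_diff hnμK (by simp))
    by_cases hx : x = μ
    · left
      rw [hx]
      intro h
      have h := congrArg (fun z : 𝕊 => (z : E)) h
      exact coe_ne_neg_coe μ (by simpa using h)
    · exact Or.inr hx

/-- A band around an equator is a homology sphere, generated by the cycle of the equator. -/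
theorem IsHomologySphere.band {μ : 𝕊} {n : ℕ} {w : Chain F n 𝕊}
    (hw : IsHomologySphere (subsphere (ℝ ∙ (μ : E))ᗮ) n w) {c : ℝ} (hc0 : 0 ≤ c) (hc1 : c < 1) :
    IsHomologySphere {x : 𝕊 | |inner ℝ (x : E) (μ : E)| ≤ c} n w := by
  have hμ : inner ℝ (μ : E) (μ : E) = 1 := by
    rw [real_inner_self_eq_norm_sq, norm_eq_of_mem_sphere, one_pow]
  rw [← inf_top_eq (ℝ ∙ (μ : E))ᗮ] at hw
  refine hw.of_equator (K := ⊤) trivial (fun x _ => trivial) (fun x hx => lt_of_le_of_lt hx hc1)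
    (fun x hx s hs y N hN h hN' => ?_) (fun x hx => ?_)
  · have hx : |inner ℝ (x : E) (μ : E)| ≤ c := hx
    change |inner ℝ (y : E) (μ : E)| ≤ c
    refine le_trans ?_ hx
    set a := inner ℝ (x : E) (μ : E) with ha
    have hsq : N ^ 2 = 1 - a ^ 2 * (2 * s - s ^ 2) := by
      rw [hN', @norm_sub_sq_real, real_inner_smul_right, norm_smul, norm_eq_of_mem_sphere,
        norm_eq_of_mem_sphere, ← ha, mul_one, Real.norm_eq_abs, sq_abs]
      ring
    have ha1 : a ^ 2 ≤ 1 := by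
      rw [← sq_abs]
      nlinarith [abs_nonneg a]
    -- With a² ≤ 1, N² = 1 - a²(2s - s²) ≥ (1 - s)². Hence the new inner product, of absolute value
    -- (1 - s)|a|/N, is no larger than |a| and the flow stays in the band.
    have hsN : 1 - s ≤ N := by
      refine le_of_sq_le_sq ?_ hN.le
      rw [hsq]
      nlinarith [mul_nonneg hs.1 (by linarith [hs.2] : (0 : ℝ) ≤ 2 - s)]
    have h2 := congrArg (fun z => inner ℝ z (μ : E)) h
    simp only [inner_sub_left, real_inner_smul_left, hμ, ← ha] at h2
    have h3 : N * |inner ℝ (y : E) (μ : E)| = (1 - s) * |a| := by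
      nth_rw 1 [← abs_of_pos hN]
      nth_rw 1 [← abs_of_nonneg (sub_nonneg.2 hs.2)]
      rw [← abs_mul, ← abs_mul, h2]
      congr 1
      ring
    have h4 : N * |inner ℝ (y : E) (μ : E)| ≤ N * |a| := by
      rw [h3]
      exact mul_le_mul_of_nonneg_right hsN (abs_nonneg _)
    exact le_of_mul_le_mul_left h4 hN
  · change |inner ℝ (x : E) (μ : E)| ≤ c
    rw [Submodule.mem_orthogonal_singleton_iff_inner_left.1 hx.1, abs_zero]
    exact hc0

end

end SimplexChain


namespace SimplexChain

open CategoryTheory.Limits Simplicial Persistence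

/-! ### Comparison with the singular chain complex -/

section

variable (F : Type u) [Field F] {X : Type} [TopologicalSpace X]

variable (X) in
/-- Simplices of the singular simplicial set are maps from the standard simplices. -/
def simplexEquiv (k : ℕ) : (TopCat.toSSet.obj (TopCat.of X)) _⦋k⦌ ≃ C(Simplex (k + 1), X) :=
  TopCat.toSSetObjEquiv (TopCat.of X) (Opposite.op ⦋k⦌)

/-- The summand of the singular chains belonging to a simplex. -/
def ιSimplex (k : ℕ) (σ : C(Simplex (k + 1), X)) : ModuleCat.of F F ⟶ (singularChains F X).X k :=
  SSet.ιChainComplex (TopCat.toSSet.obj (TopCat.of X)) ((simplexEquiv X k).symm σ)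

/-- The singular chains as finitely supported functions. -/
def toFinsupp (k : ℕ) : (singularChains F X).X k ⟶ ModuleCat.of F (Chain F (k + 1) X) :=
  (SSet.isColimitChainComplexXCofan (TopCat.toSSet.obj (TopCat.of X)) (ModuleCat.of F F) k).desc
    (Cofan.mk _ fun x => ModuleCat.ofHom (Finsupp.lsingle (simplexEquiv X k x)))

theorem ιSimplex_toFinsupp (k : ℕ) (σ : C(Simplex (k + 1), X)) :
    ιSimplex F k σ ≫ toFinsupp F k = ModuleCat.ofHom (Finsupp.lsingle σ) := by
  have := (SSet.isColimitChainComplexXCofan (TopCat.toSSet.obj (TopCat.of X))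
    (ModuleCat.of F F) k).fac (Cofan.mk _ fun x => ModuleCat.ofHom
      (Finsupp.lsingle (simplexEquiv X k x))) ⟨(simplexEquiv X k).symm σ⟩
  refine this.trans ?_
  simp

variable {F} in
theorem singularChains_hom_ext {k : ℕ} {T : ModuleCat.{u} F}
    {f g : (singularChains F X).X k ⟶ T} (h : ∀ σ, ιSimplex F k σ ≫ f = ιSimplex F k σ ≫ g) :
    f = g := by
  refine SSet.chainComplex_hom_ext fun x => ?_
  have := h (simplexEquiv X k x)
  rwa [ιSimplex, Equiv.symm_apply_apply] at this

/-- The singular chain of a finitely supported function. -/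
def ofFinsupp (k : ℕ) : ModuleCat.of F (Chain F (k + 1) X) ⟶ (singularChains F X).X k :=
  ModuleCat.ofHom (Finsupp.lsum F fun σ => (ιSimplex F k σ).hom)

variable (X) in
/-- Singular chains are finitely supported functions on singular simplices. -/
def chainIso (k : ℕ) : (singularChains F X).X k ≅ ModuleCat.of F (Chain F (k + 1) X) where
  hom := toFinsupp F k
  inv := ofFinsupp F k
  hom_inv_id := by
    refine singularChains_hom_ext fun σ => ?_
    rw [← Category.assoc, ιSimplex_toFinsupp, Category.comp_id]
    ext1
    change (Finsupp.lsum F fun σ => (ιSimplex F k σ).hom).comp (Finsupp.lsingle σ) = _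
    ext1
    simp
  inv_hom_id := by
    ext1
    refine Finsupp.lhom_ext' fun σ => ?_
    have := congrArg ModuleCat.Hom.hom (ιSimplex_toFinsupp F k σ)
    rw [ModuleCat.hom_comp] at this
    ext1
    change (toFinsupp F k).hom (Finsupp.lsum F (fun σ => (ιSimplex F k σ).hom)
      (Finsupp.single σ 1)) = Finsupp.single σ 1
    rw [Finsupp.lsum_single]
    exact LinearMap.congr_fun this 1

variable (X) in
/-- Singular chains are finitely supported functions on singular simplices. -/
def chainEquiv (k : ℕ) : (singularChains F X).X k ≃ₗ[F] Chain F (k + 1) X :=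
  (chainIso F X k).toLinearEquiv

theorem ιSimplex_d (k : ℕ) (σ : C(Simplex (k + 2), X)) :
    ιSimplex F (k + 1) σ ≫ (singularChains F X).d (k + 1) k =
      ∑ i : Fin (k + 2), (-1) ^ (i : ℕ) • ιSimplex F k (σ.comp (face i)) := by
  exact SSet.ιChainComplex_d (TopCat.toSSet.obj (TopCat.of X)) (ModuleCat.of F F) _

theorem chainEquiv_d (k : ℕ) (c : (singularChains F X).X (k + 1)) :
    chainEquiv F X k (((singularChains F X).d (k + 1) k).hom c) =
      bdry (k + 1) (chainEquiv F X (k + 1) c) := by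
  have : (singularChains F X).d (k + 1) k ≫ toFinsupp F k =
      toFinsupp F (k + 1) ≫ ModuleCat.ofHom (bdry (k + 1)) := by
    refine singularChains_hom_ext fun σ => ?_
    rw [← Category.assoc, ιSimplex_d, ← Category.assoc, ιSimplex_toFinsupp, Preadditive.sum_comp]
    simp only [Preadditive.zsmul_comp, ιSimplex_toFinsupp]
    ext1
    ext1
    rw [ModuleCat.hom_comp, LinearMap.comp_apply]
    simp only [ModuleCat.hom_ofHom, Finsupp.lsingle_apply, bdry_single, ModuleCat.hom_sum,
      LinearMap.sum_apply]
    refine Finset.sum_congr rfl fun i _ => ?_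
    -- On one side the signs are integers, on the other elements of the field; splitting by parity
    -- avoids comparing the two scalar actions.
    rcases Nat.even_or_odd (i : ℕ) with h | h
    · simp only [h.neg_one_pow, one_smul, ModuleCat.hom_ofHom, Finsupp.lsingle_apply]
    · simp only [h.neg_one_pow, neg_smul, one_smul, ModuleCat.hom_neg, ModuleCat.hom_ofHom,
        LinearMap.neg_apply, Finsupp.lsingle_apply]
  exact congrArg (fun f => f.hom c) this

theorem chainEquiv_inclusionMap (A : Set X) (k : ℕ) (c : (singularChains F A).X k) :
    chainEquiv F X k (((inclusionMap F A).f k).hom c) =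
      push (k + 1) (incl A) (chainEquiv F A k c) := by
  have : (inclusionMap F A).f k ≫ toFinsupp F k =
      toFinsupp F k ≫ ModuleCat.ofHom (push (k + 1) (incl A)) := by
    refine singularChains_hom_ext fun σ => ?_
    have h : ιSimplex F k σ ≫ (inclusionMap F A).f k = ιSimplex F k ((incl A).comp σ) := by
      exact SSet.ι_chainComplexMap_f _ _ (TopCat.toSSet.map (TopCat.ofHom (incl A)))
        (ModuleCat.of F F) _
    rw [← Category.assoc, h, ← Category.assoc, ιSimplex_toFinsupp, ιSimplex_toFinsupp]
    ext1
    ext1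
    simp
  exact congrArg (fun f => f.hom c) this

theorem mem_subspaceChains_iff {A : Set X} {k : ℕ} {c : (singularChains F X).X k} :
    c ∈ subspaceChains F A k ↔ chainEquiv F X k c ∈ sub F A (k + 1) := by
  constructor
  · rintro ⟨a, rfl⟩
    rw [chainEquiv_inclusionMap]
    exact push_mem_sub (fun x => x.2) _
  · intro h
    obtain ⟨c', hc'⟩ := exists_push_incl_eq h
    refine ⟨(chainEquiv F A k).symm c', ?_⟩
    apply (chainEquiv F X k).injective
    rw [chainEquiv_inclusionMap, LinearEquiv.apply_symm_apply, hc']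

theorem mem_constChains_iff {k : ℕ} {c : (singularChains F X).X k} :
    c ∈ constChains F X k ↔ chainEquiv F X k c ∈ consts F X (k + 1) := by
  have : constChains F X k = (consts F X (k + 1)).comap (chainEquiv F X k).toLinearMap := by
    rw [constChains, consts, Submodule.comap_equiv_eq_map_symm, Submodule.map_iSup]
    refine iSup_congr fun x => ?_
    rw [← Submodule.comap_equiv_eq_map_symm]
    ext c
    exact mem_subspaceChains_iff F
  rw [this]
  rfl

/-- Positive degrees only: in degree 0 every singular chain is a cycle, while `IsCyc` still asks for
augmentation zero. -/
theorem mem_allCycles_succ_iff {k : ℕ} {c : (singularChains F X).X (k + 1)} :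
    c ∈ allCycles (singularChains F X) (k + 1) ↔ IsCyc (chainEquiv F X (k + 1) c) := by
  change ((singularChains F X).d (k + 1) k).hom c = 0 ↔ bdry (k + 1) _ = 0
  rw [← chainEquiv_d, LinearEquiv.map_eq_zero_iff]

theorem mem_allCycles_zero (c : (singularChains F X).X 0) :
    c ∈ allCycles (singularChains F X) 0 := by
  change ((singularChains F X).d 0 0).hom c = 0
  rw [HomologicalComplex.shape _ 0 0 (by simp)]
  rfl

end

end SimplexChain


namespace Persistence

/-! ### Criteria for barcodes with no bar, one bar or two bars -/

namespace Filtration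

variable {F : Type u} [Field F] {K : ChainComplex (ModuleCat.{u} F) ℕ} {𝓕 : Filtration K} {k : ℕ}

theorem homologyClass_eq_zero_iff {r : EReal} {c : 𝓕.cycles r k} :
    𝓕.homologyClass r k c = 0 ↔ (c : K.X k) ∈ 𝓕.boundaries r k :=
  Submodule.Quotient.mk_eq_zero _

theorem mem_persistenceInterval_iff {r : EReal} {c : allCycles K k} :
    r ∈ 𝓕.persistenceInterval k c ↔
      (c : K.X k) ∈ 𝓕.chains r k ∧ (c : K.X k) ∉ 𝓕.boundaries r k := by
  constructor
  · rintro ⟨h, h'⟩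
    exact ⟨h.2, fun hb => h' (homologyClass_eq_zero_iff.2 hb)⟩
  · rintro ⟨h, h'⟩
    exact ⟨⟨c.2, h⟩, fun hb => h' (homologyClass_eq_zero_iff.1 hb)⟩

/-- A finite set of cycles defines a barcode if its living members are linearly independent and
span at each level. -/
theorem isBettiBarcode_of_linearIndependent {S : Finset (allCycles K k)}
    (hord : ∀ c ∈ S, (𝓕.persistenceInterval k c).OrdConnected)
    (hli : ∀ r, LinearIndependent F
      fun c : {c // c ∈ S ∧ r ∈ 𝓕.persistenceInterval k c} =>
        𝓕.homologyClass r k ⟨c.1, c.2.2.1⟩)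
    (hspan : ∀ r, ∀ x : 𝓕.cycles r k, 𝓕.homologyClass r k x ∈ Submodule.span F
      (Set.range fun c : {c // c ∈ S ∧ r ∈ 𝓕.persistenceInterval k c} =>
        𝓕.homologyClass r k ⟨c.1, c.2.2.1⟩)) :
    𝓕.IsBettiBarcode k S (𝓕.persistenceInterval k) where
  ordConnected := hord
  subinterval _ _ := subset_rfl
  basis r := by
    refine ⟨Module.Basis.mk (hli r) fun x _ => ?_, fun c => ⟨c.2.2.1, Module.Basis.mk_apply _ _ _⟩⟩
    obtain ⟨x, rfl⟩ := Submodule.Quotient.mk_surjective _ x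
    exact hspan r x

theorem hasBettiBarcode_zero (h : ∀ r, ∀ c ∈ 𝓕.cycles r k, c ∈ 𝓕.boundaries r k) :
    𝓕.HasBettiBarcode k 0 := by
  refine ⟨∅, isBettiBarcode_of_linearIndependent (by simp) (fun r => ?_) fun r x => ?_, by simp⟩
  · have : IsEmpty {c // c ∈ (∅ : Finset (allCycles K k)) ∧ r ∈ 𝓕.persistenceInterval k c} :=
      ⟨fun c => by simpa using c.2.1⟩
    exact linearIndependent_empty_type
  · rw [homologyClass_eq_zero_iff.2 (h r x x.2)]
    exact Submodule.zero_mem _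

theorem homologyClass_eq_smul {r : EReal} {x z : 𝓕.cycles r k} {a : F}
    (h : (x : K.X k) - a • (z : K.X k) ∈ 𝓕.boundaries r k) :
    𝓕.homologyClass r k x = a • 𝓕.homologyClass r k z :=
  (Submodule.Quotient.eq _).2 h

/-- Off `I` the homology vanishes, so `z` is alive exactly on `I`, and a single nonzero class is
independent. An empty `I` is permitted, which covers [min f, max f) at κ = 0. -/
theorem hasBettiBarcode_singleton {z : allCycles K k} {I : Set EReal} (hI : I.OrdConnected)
    (hz : ∀ r ∈ I, (z : K.X k) ∈ 𝓕.chains r k ∧ (z : K.X k) ∉ 𝓕.boundaries r k ∧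
      ∀ c ∈ 𝓕.cycles r k, ∃ a : F, c - a • (z : K.X k) ∈ 𝓕.boundaries r k)
    (h : ∀ r, r ∉ I → ∀ c ∈ 𝓕.cycles r k, c ∈ 𝓕.boundaries r k) :
    𝓕.HasBettiBarcode k {I} := by
  have hzI : 𝓕.persistenceInterval k z = I := by
    ext r
    rw [mem_persistenceInterval_iff]
    refine ⟨fun hr => ?_, fun hr => ⟨(hz r hr).1, (hz r hr).2.1⟩⟩
    by_contra hrI
    exact hr.2 (h r hrI z ⟨z.2, hr.1⟩)
  refine ⟨{z}, isBettiBarcode_of_linearIndependent (by simpa [hzI]) (fun r => ?_) fun r x => ?_,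
    by simp [hzI]⟩
  · have : Subsingleton {c // c ∈ ({z} : Finset (allCycles K k)) ∧
        r ∈ 𝓕.persistenceInterval k c} :=
      ⟨fun c c' => Subtype.ext ((Finset.mem_singleton.1 c.2.1).trans
        (Finset.mem_singleton.1 c'.2.1).symm)⟩
    exact (linearIndependent_subsingleton_index_iff _).2 fun c => c.2.2.2
  · by_cases hr : r ∈ I
    · obtain ⟨a, ha⟩ := (hz r hr).2.2 x x.2
      rw [homologyClass_eq_smul (z := ⟨z, z.2, (hz r hr).1⟩) ha]
      exact Submodule.smul_mem _ _ (Submodule.subset_span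
        ⟨⟨z, Finset.mem_singleton_self z, hzI ▸ hr⟩, rfl⟩)
    · rw [homologyClass_eq_zero_iff.2 (h r hr x x.2)]
      exact Submodule.zero_mem _

/-- Since `J ⊆ I`, the living cycles are both on `J`, only `z` on the rest of `I`, and none outside.
`hw'` keeps the persistence interval of `w` from extending beyond `J`. -/
theorem hasBettiBarcode_pair {z w : allCycles K k} (hzw : z ≠ w) {I J : Set EReal}
    (hI : I.OrdConnected) (hJ : J.OrdConnected) (hJI : J ⊆ I)
    (hz : ∀ r ∈ I, (z : K.X k) ∈ 𝓕.chains r k ∧ (z : K.X k) ∉ 𝓕.boundaries r k)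
    (hw : ∀ r ∈ J, (w : K.X k) ∈ 𝓕.chains r k ∧ (w : K.X k) ∉ 𝓕.boundaries r k ∧
      (∀ a b : F, a • (z : K.X k) + b • (w : K.X k) ∈ 𝓕.boundaries r k → a = 0 ∧ b = 0) ∧
      ∀ c ∈ 𝓕.cycles r k, ∃ a b : F, c - (a • (z : K.X k) + b • (w : K.X k)) ∈ 𝓕.boundaries r k)
    (hw' : ∀ r, r ∉ J → (w : K.X k) ∈ 𝓕.chains r k → (w : K.X k) ∈ 𝓕.boundaries r k)
    (hzspan : ∀ r ∈ I, r ∉ J → ∀ c ∈ 𝓕.cycles r k, ∃ a : F,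
      c - a • (z : K.X k) ∈ 𝓕.boundaries r k)
    (h : ∀ r, r ∉ I → ∀ c ∈ 𝓕.cycles r k, c ∈ 𝓕.boundaries r k) :
    𝓕.HasBettiBarcode k {I, J} := by
  classical
  have hzI : 𝓕.persistenceInterval k z = I := by
    ext r
    rw [mem_persistenceInterval_iff]
    refine ⟨fun hr => ?_, fun hr => hz r hr⟩
    by_contra hrI
    exact hr.2 (h r hrI z ⟨z.2, hr.1⟩)
  have hwJ : 𝓕.persistenceInterval k w = J := by
    ext r
    rw [mem_persistenceInterval_iff]
    refine ⟨fun hr => ?_, fun hr => ⟨(hw r hr).1, (hw r hr).2.1⟩⟩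
    by_contra hrJ
    exact hr.2 (hw' r hrJ hr.1)
  refine ⟨{z, w}, isBettiBarcode_of_linearIndependent (by simp [hzI, hwJ, hI, hJ]) (fun r => ?_)
    fun r x => ?_, by simp [hzI, hwJ, hzw]⟩
  · by_cases hr : r ∈ J
    · have hli : LinearIndependent F ![𝓕.homologyClass r k ⟨z, z.2, (hz r (hJI hr)).1⟩,
          𝓕.homologyClass r k ⟨w, w.2, (hw r hr).1⟩] := by
        rw [LinearIndependent.pair_iff]
        intro a b hab
        let z' : 𝓕.cycles r k := ⟨z, z.2, (hz r (hJI hr)).1⟩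
        let w' : 𝓕.cycles r k := ⟨w, w.2, (hw r hr).1⟩
        exact (hw r hr).2.2.1 a b (homologyClass_eq_zero_iff (c := a • z' + b • w') |>.1 hab)
      have hc : ∀ c : {c // c ∈ ({z, w} : Finset (allCycles K k)) ∧
          r ∈ 𝓕.persistenceInterval k c}, c.1 = z ∨ c.1 = w := fun c => by
        simpa using c.2.1
      convert hli.comp (fun c : {c // c ∈ ({z, w} : Finset (allCycles K k)) ∧
        r ∈ 𝓕.persistenceInterval k c} => if c.1 = z then (0 : Fin 2) else 1) ?_ using 1
      · funext c
        rcases hc c with h | h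
        · simp [h]
        · simp [h, hzw.symm]
      · intro c c' hcc'
        rcases hc c with h | h <;> rcases hc c' with h' | h' <;>
          simp [h, h', hzw.symm] at hcc' <;> exact Subtype.ext (h.trans h'.symm)
    · have : Subsingleton {c // c ∈ ({z, w} : Finset (allCycles K k)) ∧
          r ∈ 𝓕.persistenceInterval k c} := by
        have hc : ∀ c : {c // c ∈ ({z, w} : Finset (allCycles K k)) ∧
            r ∈ 𝓕.persistenceInterval k c}, c.1 = z := by
          rintro ⟨c, hc, hcr⟩
          rcases Finset.mem_insert.1 hc with rfl | hc
          · rfl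
          · rw [Finset.mem_singleton.1 hc, hwJ] at hcr
            exact absurd hcr hr
        exact ⟨fun c c' => Subtype.ext ((hc c).trans (hc c').symm)⟩
      exact (linearIndependent_subsingleton_index_iff _).2 fun c => c.2.2.2
  · by_cases hrI : r ∈ I
    · have hzm := Submodule.subset_span (R := F) (s := Set.range fun c : {c //
        c ∈ ({z, w} : Finset (allCycles K k)) ∧ r ∈ 𝓕.persistenceInterval k c} =>
        𝓕.homologyClass r k ⟨c.1, c.2.2.1⟩)
        ⟨⟨z, Finset.mem_insert_self z _, hzI ▸ hrI⟩, rfl⟩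
      by_cases hr : r ∈ J
      · obtain ⟨a, b, hab⟩ := (hw r hr).2.2.2 x x.2
        have : 𝓕.homologyClass r k x = a • 𝓕.homologyClass r k ⟨z, z.2, (hz r hrI).1⟩ +
            b • 𝓕.homologyClass r k ⟨w, w.2, (hw r hr).1⟩ := (Submodule.Quotient.eq _).2 hab
        rw [this]
        exact Submodule.add_mem _ (Submodule.smul_mem _ _ hzm) (Submodule.smul_mem _ _
          (Submodule.subset_span ⟨⟨w, by simp, hwJ ▸ hr⟩, rfl⟩))
      · obtain ⟨a, ha⟩ := hzspan r hrI hr x x.2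
        rw [homologyClass_eq_smul (z := ⟨z, z.2, (hz r hrI).1⟩) ha]
        exact Submodule.smul_mem _ _ hzm
    · rw [homologyClass_eq_zero_iff.2 (h r hrI x x.2)]
      exact Submodule.zero_mem _

end Filtration

open SimplexChain

/-! ### Barcodes of the Morse filtration from the topology of sublevel sets -/

section Morse

variable {F : Type u} [Field F] {X : Type} [TopologicalSpace X] {f : X → ℝ≥0∞}

theorem chainEquiv_mem_bounds_iff {A : Set X} {k : ℕ} {c : (singularChains F X).X k} :
    c ∈ (subspaceChains F A (k + 1)).map ((singularChains F X).d (k + 1) k).hom ↔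
      chainEquiv F X k c ∈ bounds A (k + 1) := by
  constructor
  · rintro ⟨e, he, rfl⟩
    exact ⟨_, (mem_subspaceChains_iff F).1 he, (chainEquiv_d F k e).symm⟩
  · rintro ⟨e, he, h⟩
    refine ⟨(chainEquiv F X (k + 1)).symm e, (mem_subspaceChains_iff F).2 (by simpa using he), ?_⟩
    apply (chainEquiv F X k).injective
    rw [chainEquiv_d, LinearEquiv.apply_symm_apply, h]

theorem mem_morse_boundaries_iff {k : ℕ} {r : EReal} {c : (singularChains F X).X k} :
    c ∈ (morseFiltration F f).boundaries r k ↔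
      chainEquiv F X k c ∈ bounds (sublevel f r) (k + 1) :=
  chainEquiv_mem_bounds_iff

theorem mem_morse_boundaries_of_acyclicAt {k : ℕ} {r : EReal}
    (h : AcyclicAt F (sublevel f r) (k + 2)) {c : (singularChains F X).X (k + 1)}
    (hc : c ∈ (morseFiltration F f).cycles r (k + 1)) :
    c ∈ (morseFiltration F f).boundaries r (k + 1) :=
  mem_morse_boundaries_iff.2 (h _ ((mem_subspaceChains_iff F).1 hc.2)
    ((mem_allCycles_succ_iff F).1 hc.1))

theorem morse_hasBettiBarcode_zero {k : ℕ} (h : ∀ r, AcyclicAt F (sublevel f r) (k + 2)) :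
    (morseFiltration F f).HasBettiBarcode (k + 1) 0 :=
  Filtration.hasBettiBarcode_zero fun r _ hc => mem_morse_boundaries_of_acyclicAt (h r) hc

/-- The singular cycle of a cycle of simplices. -/
def toCycle {k : ℕ} (w : Chain F (k + 2) X) (hw : IsCyc w) :
    allCycles (singularChains F X) (k + 1) :=
  ⟨(chainEquiv F X (k + 1)).symm w,
    (mem_allCycles_succ_iff F).2 (by rwa [LinearEquiv.apply_symm_apply])⟩

theorem morse_hasBettiBarcode_singleton {k : ℕ} {w : Chain F (k + 2) X} (hw : IsCyc w)
    {I : Set EReal} (hI : I.OrdConnected)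
    (h : ∀ r ∈ I, IsHomologySphere (sublevel f r) (k + 2) w)
    (h' : ∀ r, r ∉ I → AcyclicAt F (sublevel f r) (k + 2)) :
    (morseFiltration F f).HasBettiBarcode (k + 1) {I} := by
  refine Filtration.hasBettiBarcode_singleton (z := toCycle w hw) hI (fun r hr => ⟨?_, ?_, ?_⟩)
    fun r hr c hc => mem_morse_boundaries_of_acyclicAt (h' r hr) hc
  · exact (mem_subspaceChains_iff F).2 (by simpa [toCycle] using (h r hr).mem)
  · rw [mem_morse_boundaries_iff]
    simpa [toCycle] using (h r hr).notMem_bounds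
  · intro c hc
    obtain ⟨a, ha⟩ := (h r hr).spans _ ((mem_subspaceChains_iff F).1 hc.2)
      ((mem_allCycles_succ_iff F).1 hc.1)
    refine ⟨a, mem_morse_boundaries_iff.2 ?_⟩
    simpa [toCycle] using ha

/-- The `0`-cycle of a chain of points. -/
def toZeroCycle (w : Chain F 1 X) : allCycles (singularChains F X) 0 :=
  ⟨(chainEquiv F X 0).symm w, mem_allCycles_zero F _⟩

/-- A singular point has augmentation one. -/
theorem exists_isCyc_sub_smul (x : X) (c : Chain F 1 X) :
    ∃ a : F, IsCyc (c - a • Finsupp.single (cst 1 x) (1 : F)) := by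
  let e : C(Simplex 0, X) := cst 0 x
  -- The augmentation of `c`: the coefficient of its boundary at the only empty simplex.
  refine ⟨bdry 0 c e, ?_⟩
  change bdry 0 _ = 0
  rw [map_sub, map_smul, bdry_single_cst, if_pos Even.zero, sub_eq_zero]
  ext σ
  obtain rfl : σ = e := by
    ext1 t
    exact isEmptyElim t
  simp [e]

theorem not_isCyc_point (x : X) : ¬ IsCyc (Finsupp.single (cst 1 x) (1 : F)) := by
  intro h
  have h : bdry 0 (Finsupp.single (cst 1 x) (1 : F)) = 0 := h
  rw [bdry_single_cst, if_pos Even.zero] at h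
  exact Finsupp.single_ne_zero.2 one_ne_zero h

theorem isCyc_of_mem_bounds {A : Set X} {k : ℕ} {c : Chain F k X} (h : c ∈ bounds A k) :
    IsCyc c := by
  obtain ⟨e, -, rfl⟩ := h
  exact isCyc_bdry e

theorem mem_morse_boundaries_of_sublevel_eq_empty {r : EReal} (h : sublevel f r = ∅)
    {c : (singularChains F X).X 0} (hc : c ∈ (morseFiltration F f).cycles r 0) :
    c ∈ (morseFiltration F f).boundaries r 0 := by
  have h0 := (mem_subspaceChains_iff F).1 hc.2
  rw [h] at h0
  rw [mem_morse_boundaries_iff, eq_zero_of_mem_sub_empty h0]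
  exact Submodule.zero_mem _

/-- Unreduced H_0 is the reduced one plus the class of a point, which never bounds because
boundaries have augmentation zero. One fixed point `x` serves at all levels. -/
theorem morse_hasBettiBarcode_degree_zero {x : X} {I : Set EReal} (hI : I.OrdConnected)
    (hx : ∀ r ∈ I, x ∈ sublevel f r) (h : ∀ r ∈ I, AcyclicAt F (sublevel f r) 1)
    (h' : ∀ r, r ∉ I → sublevel f r = ∅) :
    (morseFiltration F f).HasBettiBarcode 0 {I} := by
  refine Filtration.hasBettiBarcode_singleton
    (z := toZeroCycle (Finsupp.single (cst 1 x) 1)) hI (fun r hr => ⟨?_, ?_, fun c hc => ?_⟩)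
    fun r hr c hc => mem_morse_boundaries_of_sublevel_eq_empty (h' r hr) hc
  · refine (mem_subspaceChains_iff F).2 ?_
    simpa [toZeroCycle] using single_mem_sub (fun _ => hx r hr) _
  · rw [mem_morse_boundaries_iff]
    intro hb
    exact not_isCyc_point (F := F) x (isCyc_of_mem_bounds (by simpa [toZeroCycle] using hb))
  · obtain ⟨a, ha⟩ := exists_isCyc_sub_smul x (chainEquiv F X 0 c)
    refine ⟨a, mem_morse_boundaries_iff.2 ?_⟩
    have := h r hr _ (Submodule.sub_mem _ ((mem_subspaceChains_iff F).1 hc.2)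
      (Submodule.smul_mem _ a (single_mem_sub (fun _ => hx r hr) _))) ha
    simpa [toZeroCycle] using this

theorem morse_hasBettiBarcode_degree_zero_pair {x : X} {w : Chain F 1 X} (hw : IsCyc w)
    {I J : Set EReal} (hI : I.OrdConnected) (hJ : J.OrdConnected) (hJI : J ⊆ I)
    (hx : ∀ r ∈ I, x ∈ sublevel f r) (hJw : ∀ r ∈ J, IsHomologySphere (sublevel f r) 1 w)
    (h : ∀ r ∈ I, r ∉ J → AcyclicAt F (sublevel f r) 1)
    (h' : ∀ r, r ∉ I → sublevel f r = ∅) :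
    (morseFiltration F f).HasBettiBarcode 0 {I, J} := by
  have hpt (r) (hr : r ∈ I) : Finsupp.single (cst 1 x) (1 : F) ∈ sub F (sublevel f r) 1 :=
    single_mem_sub (fun _ => hx r hr) _
  refine Filtration.hasBettiBarcode_pair
    (z := toZeroCycle (Finsupp.single (cst 1 x) 1)) (w := toZeroCycle w) ?_ hI hJ hJI
    (fun r hr => ⟨?_, ?_⟩) (fun r hr => ⟨?_, ?_, fun a b hab => ?_, fun c hc => ?_⟩)
    (fun r hr hrw => ?_) (fun r hrI hrJ c hc => ?_)
    fun r hr c hc => mem_morse_boundaries_of_sublevel_eq_empty (h' r hr) hc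
  · intro hzw
    have := congrArg (fun c : allCycles _ 0 => chainEquiv F X 0 c) hzw
    simp only [toZeroCycle, LinearEquiv.apply_symm_apply] at this
    exact not_isCyc_point (F := F) x (this ▸ hw)
  · exact (mem_subspaceChains_iff F).2 (by simpa [toZeroCycle] using hpt r hr)
  · rw [mem_morse_boundaries_iff]
    intro hb
    exact not_isCyc_point (F := F) x (isCyc_of_mem_bounds (by simpa [toZeroCycle] using hb))
  · exact (mem_subspaceChains_iff F).2 (by simpa [toZeroCycle] using (hJw r hr).mem)
  · rw [mem_morse_boundaries_iff]
    simpa [toZeroCycle] using (hJw r hr).notMem_bounds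
  · rw [mem_morse_boundaries_iff] at hab
    simp only [toZeroCycle, map_add, map_smul, LinearEquiv.apply_symm_apply] at hab
    -- The augmentation sees only the point, since `w` and boundaries have augmentation zero.
    have ha : a = 0 := by
      by_contra ha
      have := ((isCyc_of_mem_bounds hab).sub (hw.smul b)).smul a⁻¹
      rw [add_sub_cancel_right, smul_smul, inv_mul_cancel₀ ha, one_smul] at this
      exact not_isCyc_point x this
    subst ha
    refine ⟨rfl, ?_⟩
    by_contra hb
    rw [zero_smul, zero_add (b • w)] at hab
    have := Submodule.smul_mem _ b⁻¹ hab
    rw [smul_smul, inv_mul_cancel₀ hb, one_smul] at this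
    exact (hJw r hr).notMem_bounds this
  · obtain ⟨a, ha⟩ := exists_isCyc_sub_smul x (chainEquiv F X 0 c)
    obtain ⟨b, hb⟩ := (hJw r hr).spans _ (Submodule.sub_mem _ ((mem_subspaceChains_iff F).1 hc.2)
      (Submodule.smul_mem _ a (hpt r (hJI hr)))) ha
    refine ⟨a, b, mem_morse_boundaries_iff.2 ?_⟩
    simpa [toZeroCycle, sub_sub] using hb
  · by_cases hrI : r ∈ I
    · have := (mem_subspaceChains_iff F).1 hrw
      exact mem_morse_boundaries_iff.2 (h r hrI hr _ this (by simpa [toZeroCycle] using hw))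
    · exact mem_morse_boundaries_of_sublevel_eq_empty (h' r hrI) ⟨mem_allCycles_zero F _, hrw⟩
  · obtain ⟨a, ha⟩ := exists_isCyc_sub_smul x (chainEquiv F X 0 c)
    refine ⟨a, mem_morse_boundaries_iff.2 ?_⟩
    have := h r hrI hrJ _ (Submodule.sub_mem _ ((mem_subspaceChains_iff F).1 hc.2)
      (Submodule.smul_mem _ a (hpt r hrI))) ha
    simpa [toZeroCycle] using this

/-! ### The Čech filtration -/

theorem cech_chains_of_neg {r : EReal} (hr : r < 0) (k : ℕ) :
    (cechFiltration F f).chains r k = ⊥ := if_pos hr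

theorem cech_chains_of_nonneg {r : EReal} (hr : 0 ≤ r) (k : ℕ) :
    (cechFiltration F f).chains r k =
      constChains F X k ⊔ subspaceChains F (superlevel f r.toENNReal) k := if_neg hr.not_gt

theorem mem_constChains_sup_subspaceChains_iff {A : Set X} {k : ℕ}
    {c : (singularChains F X).X k} :
    c ∈ constChains F X k ⊔ subspaceChains F A k ↔
      chainEquiv F X k c ∈ consts F X (k + 1) ⊔ sub F A (k + 1) := by
  constructor
  · intro h
    obtain ⟨a, ha, b, hb, rfl⟩ := Submodule.mem_sup.1 h
    rw [map_add]
    exact Submodule.add_mem_sup ((mem_constChains_iff F).1 ha) ((mem_subspaceChains_iff F).1 hb)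
  · intro h
    obtain ⟨a, ha, b, hb, hab⟩ := Submodule.mem_sup.1 h
    rw [← (chainEquiv F X k).symm_apply_apply c, ← hab, map_add]
    exact Submodule.add_mem_sup ((mem_constChains_iff F).2 (by simpa using ha))
      ((mem_subspaceChains_iff F).2 (by simpa using hb))

/-- The constant simplices add no homology in positive degree, so acyclicity of the superlevel set
suffices; at negative levels there are no chains. -/
theorem mem_cech_boundaries_of_acyclicAt {k : ℕ} {r : EReal}
    (h : AcyclicAt F (superlevel f r.toENNReal) (k + 2)) {c : (singularChains F X).X (k + 1)}
    (hc : c ∈ (cechFiltration F f).cycles r (k + 1)) :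
    c ∈ (cechFiltration F f).boundaries r (k + 1) := by
  rcases lt_or_ge r 0 with hr | hr
  · have h0 := hc.2
    rw [cech_chains_of_neg hr] at h0
    rw [(Submodule.mem_bot F).1 h0]
    exact Submodule.zero_mem _
  · have h0 : c ∈ (cechFiltration F f).chains r (k + 1) := hc.2
    rw [cech_chains_of_nonneg hr, mem_constChains_sup_subspaceChains_iff] at h0
    obtain ⟨e, he, h'⟩ := exists_bdry_eq_of_mem_consts_sup_sub h h0
      ((mem_allCycles_succ_iff F).1 hc.1)
    refine ⟨(chainEquiv F X (k + 2)).symm e, ?_, ?_⟩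
    · rw [cech_chains_of_nonneg hr]
      exact mem_constChains_sup_subspaceChains_iff.2 (by simpa using he)
    · apply (chainEquiv F X (k + 1)).injective
      rw [chainEquiv_d, LinearEquiv.apply_symm_apply, h']

theorem cech_chains_of_superlevel_eq_univ {r : EReal} (hr : 0 ≤ r)
    (h : superlevel f r.toENNReal = Set.univ) (k : ℕ) :
    (cechFiltration F f).chains r k = subspaceChains F Set.univ k := by
  rw [cech_chains_of_nonneg hr, h]
  refine sup_eq_right.2 fun c _ => (mem_subspaceChains_iff F).2 (mem_sub_univ _)

theorem cech_hasBettiBarcode_zero {k : ℕ}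
    (h : ∀ r : ℝ≥0∞, AcyclicAt F (superlevel f r) (k + 2)) :
    (cechFiltration F f).HasBettiBarcode (k + 1) 0 :=
  Filtration.hasBettiBarcode_zero fun _ _ hc => mem_cech_boundaries_of_acyclicAt (h _) hc

theorem cech_hasBettiBarcode_singleton {k : ℕ} {w : Chain F (k + 2) X} {I : Set EReal}
    (hI : I.OrdConnected) (hw : IsHomologySphere (Set.univ : Set X) (k + 2) w)
    (h : ∀ r ∈ I, 0 ≤ r ∧ superlevel f r.toENNReal = Set.univ)
    (h' : ∀ r, r ∉ I → 0 ≤ r → AcyclicAt F (superlevel f r.toENNReal) (k + 2)) :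
    (cechFiltration F f).HasBettiBarcode (k + 1) {I} := by
  have hch (r) (hr : r ∈ I) := cech_chains_of_superlevel_eq_univ (F := F) (h r hr).1 (h r hr).2
  have hb (r) (hr : r ∈ I) : (cechFiltration F f).boundaries r (k + 1) =
      (subspaceChains F (Set.univ : Set X) (k + 2)).map
        ((singularChains F X).d (k + 2) (k + 1)).hom := by
    rw [Filtration.boundaries, hch r hr]
  refine Filtration.hasBettiBarcode_singleton (z := toCycle w hw.isCyc) hI
    (fun r hr => ⟨?_, ?_, ?_⟩) fun r hr c hc => ?_
  · rw [hch r hr]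
    exact (mem_subspaceChains_iff F).2 (mem_sub_univ _)
  · rw [hb r hr, chainEquiv_mem_bounds_iff]
    simpa [toCycle] using hw.notMem_bounds
  · intro c hc
    obtain ⟨a, ha⟩ := hw.spans _ (mem_sub_univ _) ((mem_allCycles_succ_iff F).1 hc.1)
    refine ⟨a, ?_⟩
    rw [hb r hr, chainEquiv_mem_bounds_iff]
    simpa [toCycle] using ha
  · rcases lt_or_ge r 0 with hr0 | hr0
    · have h0 := hc.2
      rw [cech_chains_of_neg hr0] at h0
      rw [(Submodule.mem_bot F).1 h0]
      exact Submodule.zero_mem _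
    · exact mem_cech_boundaries_of_acyclicAt (h' r hr hr0) hc

end Morse

end Persistence


/-! ### Integration of zonal functions over a sphere -/

namespace SphereIntegral

open Set Metric

/-- Polar coordinates: the punctured space is the product of the unit sphere and the half-line with
density r^(dim-1), and the origin has measure zero. -/
theorem lintegral_eq_lintegral_sphere {E : Type*} [NormedAddCommGroup E] [NormedSpace ℝ E]
    [FiniteDimensional ℝ E] [MeasurableSpace E] [BorelSpace E] [Nontrivial E] (μ : Measure E)
    [μ.IsAddHaarMeasure] {G : E → ℝ≥0∞} (hG : Measurable G) :
    ∫⁻ x, G x ∂μ = ∫⁻ s : sphere (0 : E) 1, (∫⁻ r in Ioi (0 : ℝ),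
      ENNReal.ofReal (r ^ (Module.finrank ℝ E - 1)) * G (r • (s : E))) ∂μ.toSphere := by
  have hmeas : Measurable fun q : sphere (0 : E) 1 × Ioi (0 : ℝ) => G ((q.2 : ℝ) • (q.1 : E)) := by
    fun_prop
  calc
    ∫⁻ x, G x ∂μ = ∫⁻ x : ({(0)}ᶜ : Set E), G x ∂(μ.comap (↑)) := by
      rw [lintegral_subtype_comap (measurableSet_singleton _).compl, restrict_compl_singleton]
    _ = ∫⁻ q : sphere (0 : E) 1 × Ioi (0 : ℝ), G ((q.2 : ℝ) • (q.1 : E))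
          ∂μ.toSphere.prod (.volumeIoiPow (Module.finrank ℝ E - 1)) := by
      rw [← μ.measurePreserving_homeomorphUnitSphereProd.lintegral_comp_emb
        (Homeomorph.measurableEmbedding _)]
      refine lintegral_congr fun x => ?_
      congr 1
      have hx : ‖(x : E)‖ ≠ 0 := norm_ne_zero_iff.2 x.2
      simp [smul_smul, hx]
    _ = ∫⁻ s : sphere (0 : E) 1, ∫⁻ r : Ioi (0 : ℝ), G ((r : ℝ) • (s : E))
          ∂(.volumeIoiPow (Module.finrank ℝ E - 1)) ∂μ.toSphere :=
      lintegral_prod _ hmeas.aemeasurable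
    _ = _ := by
      refine lintegral_congr fun s => ?_
      rw [Measure.volumeIoiPow, lintegral_withDensity_eq_lintegral_mul _ (by fun_prop)
        (by fun_prop)]
      exact lintegral_subtype_comap measurableSet_Ioi
        fun r : ℝ => ENNReal.ofReal (r ^ (Module.finrank ℝ E - 1)) * G (r • (s : E))

/-- Splitting off the first coordinate of a Euclidean space. -/
theorem lintegral_euclidean_succ (n : ℕ) {Φ : ℝ → ℝ → ℝ≥0∞} (hΦ : Measurable (Function.uncurry Φ)) :
    ∫⁻ x : EuclideanSpace ℝ (Fin (n + 1)), Φ (x 0) ‖x‖ =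
      ∫⁻ a : ℝ, ∫⁻ y : EuclideanSpace ℝ (Fin n), Φ a √(a ^ 2 + ‖y‖ ^ 2) := by
  have hΦ' : ∀ {α : Type} [MeasurableSpace α] {u v : α → ℝ}, Measurable u → Measurable v →
      Measurable fun x => Φ (u x) (v x) := fun hu hv => hΦ.comp (hu.prodMk hv)
  calc
    _ = ∫⁻ x : Fin (n + 1) → ℝ, Φ (x 0) √(∑ i, x i ^ 2) := by
      rw [← (PiLp.volume_preserving_toLp (Fin (n + 1))).lintegral_comp]
      · simp [EuclideanSpace.norm_eq]
      · exact hΦ' (by fun_prop) (by fun_prop)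
    _ = ∫⁻ q : ℝ × (Fin n → ℝ), Φ q.1 √(q.1 ^ 2 + ∑ i, q.2 i ^ 2) := by
      rw [← (volume_preserving_piFinSuccAbove (fun _ : Fin (n + 1) => ℝ) 0).symm.lintegral_comp]
      · simp [MeasurableEquiv.piFinSuccAbove, Fin.sum_univ_succ]
      · exact hΦ' (by fun_prop) (by fun_prop)
    _ = ∫⁻ a : ℝ, ∫⁻ y : Fin n → ℝ, Φ a √(a ^ 2 + ∑ i, y i ^ 2) :=
      lintegral_prod _ (hΦ' (by fun_prop) (by fun_prop)).aemeasurable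
    _ = _ := by
      refine lintegral_congr fun a => ?_
      rw [← (PiLp.volume_preserving_toLp (Fin n)).lintegral_comp]
      · simp [EuclideanSpace.norm_eq, Real.sq_sqrt, Finset.sum_nonneg, sq_nonneg]
      · exact hΦ' (by fun_prop) (by fun_prop)

/-- Complete `μ` to an orthonormal basis; the coordinate map preserves volume and norms and turns
⟨x,μ⟩ into the first coordinate. -/
theorem lintegral_inner_norm (n : ℕ) (μ : sphere (0 : EuclideanSpace ℝ (Fin (n + 1))) 1)
    {Φ : ℝ → ℝ → ℝ≥0∞} (hΦ : Measurable (Function.uncurry Φ)) :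
    ∫⁻ x : EuclideanSpace ℝ (Fin (n + 1)), Φ (inner ℝ x (μ : EuclideanSpace ℝ (Fin (n + 1)))) ‖x‖ =
      ∫⁻ x : EuclideanSpace ℝ (Fin (n + 1)), Φ (x 0) ‖x‖ := by
  have hon : Orthonormal ℝ (({0} : Set (Fin (n + 1))).domRestrict
      fun _ => (μ : EuclideanSpace ℝ (Fin (n + 1)))) := by
    rw [orthonormal_iff_ite]
    intro i j
    have : i = j := Subsingleton.elim _ _
    simp [this]
  obtain ⟨b, hb⟩ := hon.exists_orthonormalBasis_extension_of_card_eq (by simp)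
  have hb0 : b 0 = μ := hb 0 rfl
  rw [← b.measurePreserving_repr.lintegral_comp (f := fun x => Φ (x 0) ‖x‖)]
  · refine lintegral_congr fun x => ?_
    rw [b.repr_apply_apply, hb0, LinearIsometryEquiv.norm_map, real_inner_comm]
  · exact hΦ.comp (Measurable.prodMk (by fun_prop) (by fun_prop))

/-- The integral of a zonal function over the unit sphere. -/
theorem lintegral_toSphere_zonal (n : ℕ) (μ : sphere (0 : EuclideanSpace ℝ (Fin (n + 2))) 1)
    {h : ℝ → ℝ≥0∞} (hh : Measurable h) :
    ∫⁻ x, h (inner ℝ (x : EuclideanSpace ℝ (Fin (n + 2))) (μ : EuclideanSpace ℝ (Fin (n + 2))))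
        ∂(volume : Measure (EuclideanSpace ℝ (Fin (n + 2)))).toSphere =
      (volume : Measure (EuclideanSpace ℝ (Fin (n + 1)))).toSphere univ *
        ∫⁻ θ in Ioo 0 Real.pi, ENNReal.ofReal (Real.sin θ ^ n) * h (Real.cos θ) := by
  set σ := (volume : Measure (EuclideanSpace ℝ (Fin (n + 2)))).toSphere
  set τ := (volume : Measure (EuclideanSpace ℝ (Fin (n + 1)))).toSphere univ
  -- The cutoff makes the radial integral `I` finite. The integral of χ(‖x‖) h(⟨x,μ⟩/‖x‖) over the
  -- space is computed in two ways, and `I`, which is neither 0 nor ∞, is cancelled.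
  let χ : ℝ → ℝ≥0∞ := (Ioo (0 : ℝ) 1).indicator 1
  have hχ : Measurable χ := measurable_one.indicator measurableSet_Ioo
  set I : ℝ≥0∞ := ∫⁻ r in Ioi (0 : ℝ), ENNReal.ofReal (r ^ (n + 1)) * χ r with hIdef
  have hI : I = ENNReal.ofReal ((n + 2 : ℝ)⁻¹) := by
    have h1 : I = ∫⁻ r in Ioo (0 : ℝ) 1, ENNReal.ofReal (r ^ (n + 1)) := by
      rw [hIdef, ← lintegral_indicator measurableSet_Ioi, ← lintegral_indicator measurableSet_Ioo]
      refine lintegral_congr fun r => ?_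
      by_cases h0 : 0 < r <;> by_cases h1 : r < 1 <;> simp [χ, indicator, h0, h1]
    rw [h1, ← ofReal_integral_eq_lintegral_ofReal, ← integral_Ioc_eq_integral_Ioo,
      ← intervalIntegral.integral_of_le zero_le_one, integral_pow]
    · congr 1
      push_cast
      rw [one_pow, zero_pow (by omega), sub_zero, one_div]
      congr 1
      ring
    · exact ((by fun_prop : Continuous fun r : ℝ => r ^ (n + 1)).integrableOn_Icc).mono_set
        Ioo_subset_Icc_self
    · filter_upwards [self_mem_ae_restrict measurableSet_Ioo] with r hr
      exact pow_nonneg hr.1.le _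
  set J : ℝ≥0∞ := ∫⁻ θ in Ioo 0 Real.pi, ENNReal.ofReal (Real.sin θ ^ n) * h (Real.cos θ)
  let Φ : ℝ → ℝ → ℝ≥0∞ := fun a R => χ R * h (a / R)
  have hΦ : Measurable (Function.uncurry Φ) :=
    (hχ.comp measurable_snd).mul (hh.comp (measurable_fst.div measurable_snd))
  have hΦ' : ∀ {α : Type} [MeasurableSpace α] {u v : α → ℝ}, Measurable u → Measurable v →
      Measurable fun x => Φ (u x) (v x) := fun hu hv => hΦ.comp (hu.prodMk hv)
  have hh1 : Measurable fun x : sphere (0 : EuclideanSpace ℝ (Fin (n + 2))) 1 =>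
      h (inner ℝ (x : EuclideanSpace ℝ (Fin (n + 2))) (μ : EuclideanSpace ℝ (Fin (n + 2)))) :=
    hh.comp (Continuous.measurable (by fun_prop))
  have hh2 : Measurable fun θ : ℝ => ENNReal.ofReal (Real.sin θ ^ n) * h (Real.cos θ) :=
    Measurable.mul (by fun_prop) (hh.comp (by fun_prop))
  have hleft : ∫⁻ x : EuclideanSpace ℝ (Fin (n + 2)),
      Φ (inner ℝ x (μ : EuclideanSpace ℝ (Fin (n + 2)))) ‖x‖ =
      I * ∫⁻ x, h (inner ℝ (x : EuclideanSpace ℝ (Fin (n + 2)))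
        (μ : EuclideanSpace ℝ (Fin (n + 2)))) ∂σ := by
    rw [lintegral_eq_lintegral_sphere _ (hΦ' (by fun_prop) (by fun_prop)),
      ← lintegral_const_mul _ hh1]
    refine lintegral_congr fun s => ?_
    rw [hIdef, ← lintegral_mul_const _ (by fun_prop)]
    refine setLIntegral_congr_fun measurableSet_Ioi fun r hr => ?_
    have hr : 0 < r := hr
    simp only [Φ, finrank_euclideanSpace, Fintype.card_fin, norm_smul, norm_eq_of_mem_sphere,
      mul_one, Real.norm_of_nonneg hr.le, real_inner_smul_left, mul_div_cancel_left₀ _ hr.ne']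
    rw [mul_assoc]
    rfl
  let f : ℝ × ℝ → ℝ≥0∞ := fun q => (Ioi (0 : ℝ)).indicator 1 q.2 *
    (ENNReal.ofReal (q.2 ^ n) * Φ q.1 √(q.1 ^ 2 + q.2 ^ 2))
  have hf : Measurable f := ((measurable_one.indicator measurableSet_Ioi).comp measurable_snd).mul
    ((by fun_prop : Measurable fun q : ℝ × ℝ => ENNReal.ofReal (q.2 ^ n)).mul
      (hΦ' (by fun_prop) (by fun_prop)))
  -- Split off the axis and use polar coordinates in the complementary hyperplane. There remains an
  -- integral over the half-plane of axis coordinate and distance to the axis; the indicator in `f`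
  -- extends it to the plane.
  have hright : ∫⁻ x : EuclideanSpace ℝ (Fin (n + 2)),
      Φ (inner ℝ x (μ : EuclideanSpace ℝ (Fin (n + 2)))) ‖x‖ = τ * ∫⁻ q, f q := by
    rw [lintegral_inner_norm _ _ hΦ, lintegral_euclidean_succ _ hΦ, Measure.volume_eq_prod,
      lintegral_prod _ hf.aemeasurable, ← lintegral_const_mul _ hf.lintegral_prod_right']
    refine lintegral_congr fun a => ?_
    rw [lintegral_eq_lintegral_sphere _ (hΦ' (by fun_prop) (by fun_prop))]
    have : ∀ s : sphere (0 : EuclideanSpace ℝ (Fin (n + 1))) 1, ∫⁻ r in Ioi (0 : ℝ),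
        ENNReal.ofReal (r ^ (Module.finrank ℝ (EuclideanSpace ℝ (Fin (n + 1))) - 1)) *
          Φ a √(a ^ 2 + ‖r • (s : EuclideanSpace ℝ (Fin (n + 1)))‖ ^ 2) = ∫⁻ ρ, f (a, ρ) := by
      intro s
      rw [← lintegral_indicator measurableSet_Ioi]
      refine lintegral_congr fun r => ?_
      simp only [f, finrank_euclideanSpace, Fintype.card_fin, norm_smul, norm_eq_of_mem_sphere,
        mul_one, Real.norm_eq_abs, sq_abs]
      by_cases hr : 0 < r <;> simp [indicator, hr]
    simp only [this, lintegral_const]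
    rw [mul_comm]
  -- Polar coordinates in the plane: the factor (r sin θ)^n and the Jacobian r give r^(n+1) sin^n θ,
  -- separating radius and angle. Negative angles lie outside the half-plane.
  have hpolar : ∫⁻ q, f q = I * J := by
    rw [← lintegral_comp_polarCoord_symm, polarCoord_target, Measure.volume_eq_prod,
      ← Measure.prod_restrict, lintegral_prod _ (by
        refine Measurable.aemeasurable ?_
        exact (by fun_prop : Measurable fun q : ℝ × ℝ => ENNReal.ofReal q.1).smul
          (hf.comp continuous_polarCoord_symm.measurable)), hIdef, ← lintegral_mul_const _ (by fun_prop)]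
    refine setLIntegral_congr_fun measurableSet_Ioi fun r hr => ?_
    have hr : 0 < r := hr
    rw [← lintegral_const_mul _ hh2,
      ← lintegral_indicator measurableSet_Ioo, ← lintegral_indicator measurableSet_Ioo]
    refine lintegral_congr fun θ => ?_
    by_cases hθ : θ ∈ Ioo (-Real.pi) Real.pi
    · rw [indicator_of_mem hθ]
      have hsq : √((r * Real.cos θ) ^ 2 + (r * Real.sin θ) ^ 2) = r := by
        rw [mul_pow, mul_pow, ← mul_add, Real.cos_sq_add_sin_sq, mul_one, Real.sqrt_sq hr.le]
      by_cases hθ0 : 0 < θ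
      · have hs : 0 < Real.sin θ := Real.sin_pos_of_pos_of_lt_pi hθ0 hθ.2
        rw [indicator_of_mem (show θ ∈ Ioo 0 Real.pi from ⟨hθ0, hθ.2⟩)]
        simp only [f, Φ, polarCoord_symm_apply, hsq, mul_div_cancel_left₀ _ hr.ne']
        rw [indicator_of_mem (show r * Real.sin θ ∈ Ioi (0 : ℝ) from mul_pos hr hs), Pi.one_apply, one_mul,
          smul_eq_mul, mul_pow, ENNReal.ofReal_mul (by positivity), pow_succ' r n,
          ENNReal.ofReal_mul hr.le]
        ring
      · have hs : Real.sin θ ≤ 0 := Real.sin_nonpos_of_nonpos_of_neg_pi_le (not_lt.1 hθ0) hθ.1.le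
        rw [indicator_of_notMem fun h => hθ0 h.1]
        simp only [f, polarCoord_symm_apply]
        rw [indicator_of_notMem (show r * Real.sin θ ∉ Ioi (0 : ℝ) from
          not_lt.2 (mul_nonpos_of_nonneg_of_nonpos hr.le hs)), zero_mul,
          smul_zero]
    · rw [indicator_of_notMem hθ, indicator_of_notMem fun h => hθ ⟨by linarith [h.1, h.2], h.2⟩]
  have hI0 : I ≠ 0 := by
    rw [hI]
    simp only [ne_eq, ENNReal.ofReal_eq_zero, not_le]
    positivity
  have hIt : I ≠ ∞ := hI ▸ ENNReal.ofReal_ne_top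
  rw [← ENNReal.mul_right_inj hI0 hIt, ← hleft, hright, hpolar]
  ring

end SphereIntegral


/-! ### Areas of spheres and means of even zonal functions -/

namespace SphereIntegral

open Set Metric

/-- The area is the dimension times the volume of the ball, and Γ(x + 1) = xΓ(x) with x = (m + 1)/2
absorbs the dimension up to the factor 2. -/
theorem toSphere_univ_eq (m : ℕ) :
    (volume : Measure (EuclideanSpace ℝ (Fin (m + 1)))).toSphere univ =
      ENNReal.ofReal (Watson.sphereArea m) := by
  rw [Measure.toSphere_apply_univ, EuclideanSpace.volume_ball, finrank_euclideanSpace,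
    Fintype.card_fin, ENNReal.ofReal_one, one_pow, one_mul, ← ENNReal.ofReal_natCast,
    ← ENNReal.ofReal_mul (Nat.cast_nonneg _)]
  congr 1
  rw [Watson.sphereArea]
  push_cast
  have h : ((m : ℝ) + 1) / 2 ≠ 0 := by positivity
  have hG : Real.Gamma (((m : ℝ) + 1) / 2) ≠ 0 := (Real.Gamma_pos_of_pos (by positivity)).ne'
  rw [Real.Gamma_add_one h, Real.sqrt_eq_rpow, ← Real.rpow_natCast, ← Real.rpow_mul Real.pi_nonneg]
  push_cast
  rw [show (1 / 2 * ((m : ℝ) + 1)) = ((m : ℝ) + 1) / 2 by ring]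
  field_simp

theorem sphereArea_pos (m : ℕ) : 0 < Watson.sphereArea m := by
  have := Real.Gamma_pos_of_pos (s := ((m : ℝ) + 1) / 2) (by positivity)
  have := Real.pi_pos
  unfold Watson.sphereArea
  positivity

instance (n : ℕ) : IsProbabilityMeasure (Watson.uniform (n + 1)) where
  measure_univ := by
    rw [Watson.uniform, Measure.smul_apply, smul_eq_mul]
    refine ENNReal.inv_mul_cancel ?_ (measure_ne_top _ _)
    rw [toSphere_univ_eq]
    simpa using sphereArea_pos n

theorem lintegral_Ioo_pi_eq {F : ℝ → ℝ≥0∞} (hF : ∀ θ, F (Real.pi - θ) = F θ) :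
    ∫⁻ θ in Ioo 0 Real.pi, F θ = 2 * ∫⁻ θ in Ioc 0 (Real.pi / 2), F θ := by
  have hpi := Real.pi_pos
  have hunion : Ioo 0 Real.pi = Ioc 0 (Real.pi / 2) ∪ Ioo (Real.pi / 2) Real.pi :=
    (Ioc_union_Ioo_eq_Ioo (by linarith) (by linarith)).symm
  have hrefl : ∫⁻ θ in Ioo (Real.pi / 2) Real.pi, F θ = ∫⁻ θ in Ioc 0 (Real.pi / 2), F θ := by
    rw [← setLIntegral_congr (Ioo_ae_eq_Ioc (a := (0 : ℝ)) (b := Real.pi / 2)),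
      ← lintegral_indicator measurableSet_Ioo, ← lintegral_indicator measurableSet_Ioo,
      ← lintegral_sub_left_eq_self _ Real.pi]
    refine lintegral_congr fun θ => ?_
    have : Real.pi - θ ∈ Ioo (Real.pi / 2) Real.pi ↔ θ ∈ Ioo 0 (Real.pi / 2) := by
      constructor <;> rintro ⟨h1, h2⟩ <;> constructor <;> linarith
    by_cases h : θ ∈ Ioo 0 (Real.pi / 2)
    · rw [indicator_of_mem h, indicator_of_mem (this.2 h), hF]
    · rw [indicator_of_notMem h, indicator_of_notMem fun h' => h (this.1 h')]
  rw [hunion, lintegral_union measurableSet_Ioo, hrefl, two_mul]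
  exact Set.disjoint_left.2 fun θ h h' => absurd h.2 (not_le.2 h'.1)

/-- The mean over the sphere of an even zonal function. -/
theorem lintegral_uniform_zonal (n : ℕ) (μ : Watson.Sphere (n + 2)) {H : ℝ → ℝ≥0∞}
    (hH : Measurable H) :
    ∫⁻ x, H (inner ℝ (x : EuclideanSpace ℝ (Fin (n + 2)))
        (μ : EuclideanSpace ℝ (Fin (n + 2))) ^ 2) ∂Watson.uniform (n + 2) =
      ENNReal.ofReal (2 * (Watson.sphereArea n / Watson.sphereArea (n + 1))) *
        ∫⁻ θ in Ioc 0 (Real.pi / 2), ENNReal.ofReal (Real.sin θ ^ n) * H (Real.cos θ ^ 2) := by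
  rw [Watson.uniform, lintegral_smul_measure,
    lintegral_toSphere_zonal n μ (h := fun u => H (u ^ 2)) (hH.comp (by fun_prop)),
    toSphere_univ_eq, toSphere_univ_eq, lintegral_Ioo_pi_eq (fun θ => by
      rw [Real.sin_pi_sub, Real.cos_pi_sub, neg_sq]),
    ENNReal.ofReal_mul zero_le_two, ENNReal.ofReal_div_of_pos (sphereArea_pos _), ENNReal.div_eq_inv_mul,
    ENNReal.ofReal_ofNat, smul_eq_mul]
  ring

end SphereIntegral

/-! ### The mass of a superlevel set as a function of its angle -/

namespace Watson

open Set

section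

variable {n : ℕ} (μ : Sphere (n + 2)) {κ : ℝ}

theorem continuous_kernel (κ : ℝ) : Continuous (kernel μ κ) := by
  unfold kernel
  fun_prop

theorem inner_sq_le_one (x : Sphere (n + 2)) :
    (inner ℝ (x : EuclideanSpace ℝ (Fin (n + 2))) (μ : EuclideanSpace ℝ (Fin (n + 2)))) ^ 2 ≤ 1 := by
  rw [sq_le_one_iff_abs_le_one]
  have := abs_real_inner_le_norm (x : EuclideanSpace ℝ (Fin (n + 2)))
    (μ : EuclideanSpace ℝ (Fin (n + 2)))
  simpa using this

theorem one_le_kernel (hκ : 0 ≤ κ) (x : Sphere (n + 2)) : 1 ≤ kernel μ κ x :=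
  Real.one_le_exp (by positivity)

theorem kernel_le (hκ : 0 ≤ κ) (x : Sphere (n + 2)) : kernel μ κ x ≤ Real.exp κ :=
  Real.exp_le_exp.2 (mul_le_of_le_one_right hκ (inner_sq_le_one μ x))

theorem integrable_kernel (hκ : 0 ≤ κ) : Integrable (kernel μ κ) (uniform (n + 2)) :=
  Integrable.of_bound (continuous_kernel μ κ).aestronglyMeasurable (Real.exp κ)
    (ae_of_all _ fun x => by
      rw [Real.norm_of_nonneg (show 0 ≤ kernel μ κ x from (Real.exp_pos _).le)]
      exact kernel_le μ hκ x)

theorem normConst_pos (hκ : 0 ≤ κ) : 0 < normConst μ κ := by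
  refine inv_pos.2 (zero_lt_one.trans_le ?_)
  calc (1 : ℝ) = ∫ _x, (1 : ℝ) ∂uniform (n + 2) := by simp
    _ ≤ _ := integral_mono (integrable_const _) (integrable_kernel μ hκ) (one_le_kernel μ hκ)

theorem lintegral_density (hκ : 0 ≤ κ) : ∫⁻ x, density μ κ x ∂uniform (n + 2) = 1 := by
  have hd := normConst_pos μ hκ
  unfold density
  rw [← ofReal_integral_eq_lintegral_ofReal ((integrable_kernel μ hκ).const_mul _)
    (ae_of_all _ fun x => mul_nonneg hd.le (Real.exp_pos _).le), integral_const_mul]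
  have : ∫ x, kernel μ κ x ∂uniform (n + 2) ≠ 0 := fun h => by simp [normConst, h] at hd
  rw [normConst, inv_mul_cancel₀ this, ENNReal.ofReal_one]

/-- The level of the density at angle `t` from the axis, inverted. -/
def levelInv (d κ t : ℝ) : ℝ := Real.exp (-κ * Real.cos t ^ 2) / d

theorem le_density_iff (hκ : 0 < κ) (t : ℝ) (x : Sphere (n + 2)) :
    x ∈ Persistence.superlevel (density μ κ) (ENNReal.ofReal (levelInv (normConst μ κ) κ t)) ↔
      Real.cos t ^ 2 ≤ (inner ℝ (x : EuclideanSpace ℝ (Fin (n + 2)))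
        (μ : EuclideanSpace ℝ (Fin (n + 2)))) ^ 2 := by
  have hd := normConst_pos μ hκ.le
  change (ENNReal.ofReal (Real.exp (-κ * Real.cos t ^ 2) / normConst μ κ))⁻¹ ≤
    ENNReal.ofReal (normConst μ κ * Real.exp _) ↔ _
  rw [← ENNReal.ofReal_inv_of_pos (by positivity), ENNReal.ofReal_le_ofReal_iff (by positivity),
    inv_div, neg_mul, Real.exp_neg, div_inv_eq_mul, mul_le_mul_iff_right₀ hd, Real.exp_le_exp,
    mul_le_mul_iff_right₀ hκ]

/-- At this level the superlevel set consists of the points at angle at most `t` from the axis. Its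
indicator times the density is a function `H` of ⟨x,μ⟩², and cosine is nonnegative and decreasing on
[0, π/2], so the zonal integral is cut off at θ = t. -/
theorem superlevelMass_levelInv (hκ : 0 < κ) {t : ℝ} (ht : t ∈ Icc 0 (Real.pi / 2)) :
    Persistence.superlevelMass (uniform (n + 2)) (density μ κ)
        (ENNReal.ofReal (levelInv (normConst μ κ) κ t)) =
      ENNReal.ofReal (angularMass (n + 2) (normConst μ κ) κ t) := by
  have hd := normConst_pos μ hκ.le
  have hpi := Real.pi_pos
  set d := normConst μ κ with hdd
  let H : ℝ → ℝ≥0∞ := (Ici (Real.cos t ^ 2)).indicator fun u => ENNReal.ofReal (d * Real.exp (κ * u))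
  have hH : Measurable H := Measurable.indicator (by fun_prop) measurableSet_Ici
  have hset : MeasurableSet (Persistence.superlevel (density μ κ)
      (ENNReal.ofReal (levelInv d κ t))) := by
    have hc : Continuous (density μ κ) :=
      ENNReal.continuous_ofReal.comp ((continuous_kernel μ κ).const_mul _ )
    exact measurableSet_le measurable_const hc.measurable
  have h1 : Persistence.superlevelMass (uniform (n + 2)) (density μ κ)
      (ENNReal.ofReal (levelInv d κ t)) = ∫⁻ x, H (inner ℝ (x : EuclideanSpace ℝ (Fin (n + 2)))
        (μ : EuclideanSpace ℝ (Fin (n + 2))) ^ 2) ∂uniform (n + 2) := by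
    rw [Persistence.superlevelMass, ← lintegral_indicator hset]
    refine lintegral_congr fun x => ?_
    by_cases hx : Real.cos t ^ 2 ≤ (inner ℝ (x : EuclideanSpace ℝ (Fin (n + 2)))
        (μ : EuclideanSpace ℝ (Fin (n + 2)))) ^ 2
    · rw [indicator_of_mem ((le_density_iff μ hκ t x).2 hx)]
      symm
      exact indicator_of_mem (show _ ∈ Ici (Real.cos t ^ 2) from hx) _
    · rw [indicator_of_notMem fun h' => hx ((le_density_iff μ hκ t x).1 h')]
      symm
      exact indicator_of_notMem (show _ ∉ Ici (Real.cos t ^ 2) from hx) _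
  have h2 : ∫⁻ θ in Ioc 0 (Real.pi / 2), ENNReal.ofReal (Real.sin θ ^ n) * H (Real.cos θ ^ 2) =
      ∫⁻ θ in Ioc 0 t, ENNReal.ofReal (d * Real.exp (κ * Real.cos θ ^ 2) * Real.sin θ ^ n) := by
    rw [← lintegral_indicator measurableSet_Ioc, ← lintegral_indicator measurableSet_Ioc]
    refine lintegral_congr fun θ => ?_
    by_cases hθ : θ ∈ Ioc 0 (Real.pi / 2)
    · have hcos : Real.cos t ^ 2 ≤ Real.cos θ ^ 2 ↔ θ ≤ t := by
        rw [sq_le_sq₀ (Real.cos_nonneg_of_mem_Icc ⟨by linarith [ht.1], ht.2⟩)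
          (Real.cos_nonneg_of_mem_Icc ⟨by linarith [hθ.1], hθ.2⟩)]
        exact Real.strictAntiOn_cos.le_iff_ge ⟨ht.1, by linarith [ht.2]⟩
          ⟨hθ.1.le, by linarith [hθ.2]⟩
      rw [indicator_of_mem hθ]
      by_cases hθt : θ ≤ t
      · rw [indicator_of_mem (show θ ∈ Ioc 0 t from ⟨hθ.1, hθt⟩),
          show H (Real.cos θ ^ 2) = _ from indicator_of_mem (mem_Ici.2 (hcos.2 hθt)) _, mul_comm,
          ← ENNReal.ofReal_mul (by positivity)]
      · rw [indicator_of_notMem fun h => hθt h.2,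
          show H (Real.cos θ ^ 2) = _ from indicator_of_notMem
            (show _ ∉ Ici (Real.cos t ^ 2) from fun h => hθt (hcos.1 h)) _, mul_zero]
    · rw [indicator_of_notMem hθ, indicator_of_notMem fun h => hθ ⟨h.1, h.2.trans ht.2⟩]
  have hC := SphereIntegral.sphereArea_pos n
  have hC' := SphereIntegral.sphereArea_pos (n + 1)
  rw [h1, SphereIntegral.lintegral_uniform_zonal n μ hH, h2,
    ← ofReal_integral_eq_lintegral_ofReal, ← ENNReal.ofReal_mul (by positivity),
    ← intervalIntegral.integral_of_le ht.1]
  · rfl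
  · exact ((by fun_prop : Continuous fun θ : ℝ =>
      d * Real.exp (κ * Real.cos θ ^ 2) * Real.sin θ ^ n).integrableOn_Icc).mono_set
      Ioc_subset_Icc_self
  · filter_upwards [self_mem_ae_restrict measurableSet_Ioc] with θ hθ
    have := Real.sin_nonneg_of_nonneg_of_le_pi hθ.1.le (by linarith [hθ.2, ht.2])
    positivity

theorem angularMass_strictMonoOn {d : ℝ} (hd : 0 < d) (n : ℕ) (κ : ℝ) :
    StrictMonoOn (angularMass (n + 2) d κ) (Icc 0 (Real.pi / 2)) := by
  intro s hs t ht hst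
  have hC := SphereIntegral.sphereArea_pos n
  have hC' := SphereIntegral.sphereArea_pos (n + 1)
  have hcont : Continuous fun θ : ℝ => d * Real.exp (κ * Real.cos θ ^ 2) * Real.sin θ ^ n := by
    fun_prop
  have hpi := Real.pi_pos
  refine mul_lt_mul_of_pos_left ?_ (by
    change 0 < 2 * (sphereArea n / sphereArea (n + 1))
    positivity)
  change (∫ θ in (0 : ℝ)..s, d * Real.exp (κ * Real.cos θ ^ 2) * Real.sin θ ^ n) <
    ∫ θ in (0 : ℝ)..t, d * Real.exp (κ * Real.cos θ ^ 2) * Real.sin θ ^ n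
  rw [← sub_pos, intervalIntegral.integral_interval_sub_left (hcont.intervalIntegrable _ _)
    (hcont.intervalIntegrable _ _)]
  refine intervalIntegral.intervalIntegral_pos_of_pos_on (hcont.intervalIntegrable _ _)
    (fun θ hθ => ?_) hst
  have := Real.sin_pos_of_pos_of_lt_pi (hs.1.trans_lt hθ.1) (by linarith [hθ.2, ht.2])
  positivity

theorem continuous_angularMass (p : ℕ) (d κ : ℝ) : Continuous (angularMass p d κ) := by
  have hcont : Continuous fun θ : ℝ =>
      d * Real.exp (κ * Real.cos θ ^ 2) * Real.sin θ ^ (p - 2) := by fun_prop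
  exact continuous_const.mul
    (intervalIntegral.continuous_primitive (fun _ _ => hcont.intervalIntegrable _ _) 0)

theorem angularMass_zero (p : ℕ) (d κ : ℝ) : angularMass p d κ 0 = 0 := by
  simp [angularMass]

theorem levelInv_strictMonoOn {d : ℝ} (hd : 0 < d) (hκ : 0 < κ) :
    StrictMonoOn (levelInv d κ) (Icc 0 (Real.pi / 2)) := by
  intro s hs t ht hst
  have hpi := Real.pi_pos
  refine div_lt_div_of_pos_right (Real.exp_lt_exp.2 ?_) hd
  have h1 := Real.strictAntiOn_cos ⟨hs.1, by linarith [hs.2]⟩ ⟨ht.1, by linarith [ht.2]⟩ hst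
  have h2 := Real.cos_nonneg_of_mem_Icc (x := t) ⟨by linarith [ht.1], ht.2⟩
  nlinarith [mul_pos hκ (sub_pos.2 h1)]

theorem continuous_levelInv (d κ : ℝ) : Continuous (levelInv d κ) := by
  unfold levelInv
  fun_prop

/-- The equation exp(-κ cos² t)/d = r is solved for cos² t. The bounds on `r` say exactly that the
solution lies in [0, 1], where the square root and `arccos` are true inverses. -/
theorem levelInv_arccos {d r : ℝ} (hd : 0 < d) (hκ : 0 < κ)
    (hr : r ∈ Icc (levelInv d κ 0) (levelInv d κ (Real.pi / 2))) :
    levelInv d κ (Real.arccos (Real.sqrt (-(1 / κ) * Real.log (d * r)))) = r := by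
  have h0 : Real.exp (-κ) ≤ d * r := by
    have := hr.1
    rw [levelInv, Real.cos_zero, one_pow, mul_one, div_le_iff₀ hd] at this
    linarith
  have h1 : d * r ≤ 1 := by
    have := hr.2
    rw [levelInv, Real.cos_pi_div_two, zero_pow two_ne_zero, mul_zero, Real.exp_zero,
      le_div_iff₀ hd] at this
    linarith
  have hpos : 0 < d * r := (Real.exp_pos _).trans_le h0
  have hlog0 : -κ ≤ Real.log (d * r) := (Real.le_log_iff_exp_le hpos).2 h0
  have hlog1 : Real.log (d * r) ≤ 0 := Real.log_nonpos hpos.le h1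
  have ha : 0 ≤ -(1 / κ) * Real.log (d * r) := by
    rw [neg_mul, ← mul_neg]
    exact mul_nonneg (by positivity) (by linarith)
  have hb : -(1 / κ) * Real.log (d * r) ≤ 1 := by
    rw [neg_mul, ← mul_neg, one_div_mul_eq_div, div_le_one hκ]
    linarith
  rw [levelInv, Real.cos_arccos (by linarith [Real.sqrt_nonneg (-(1 / κ) * Real.log (d * r))])
    (Real.sqrt_le_one.2 hb), Real.sq_sqrt ha]
  rw [show -κ * (-(1 / κ) * Real.log (d * r)) = Real.log (d * r) by field_simp, Real.exp_log hpos]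
  field_simp

end

end Watson


/-! ### Monotone functions in parametric form -/

namespace Parametric

open Set

theorem bijOn_Icc {α : Type*} [LinearOrder α] [TopologicalSpace α] [OrderClosedTopology α]
    {a b : ℝ} (hab : a ≤ b) {A : ℝ → α} (hA : StrictMonoOn A (Icc a b))
    (hAc : ContinuousOn A (Icc a b)) : BijOn A (Icc a b) (Icc (A a) (A b)) :=
  ⟨fun _ ht => ⟨hA.monotoneOn (left_mem_Icc.2 hab) ht ht.1,
    hA.monotoneOn ht (right_mem_Icc.2 hab) ht.2⟩, hA.injOn, intermediate_value_Icc hab hAc⟩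

variable {a b : ℝ} {A B : ℝ → ℝ≥0∞} {g : ℝ≥0∞ → ℝ≥0∞}

theorem strictMonoOn (hab : a ≤ b) (hA : StrictMonoOn A (Icc a b))
    (hAc : ContinuousOn A (Icc a b)) (hB : StrictMonoOn B (Icc a b))
    (hg : ∀ t ∈ Icc a b, g (A t) = B t) : StrictMonoOn g (Icc (A a) (A b)) := by
  intro x hx y hy hxy
  obtain ⟨s, hs, rfl⟩ := (bijOn_Icc hab hA hAc).surjOn hx
  obtain ⟨t, ht, rfl⟩ := (bijOn_Icc hab hA hAc).surjOn hy
  rw [hg s hs, hg t ht]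
  exact hB hs ht ((hA.lt_iff_lt hs ht).1 hxy)

theorem bijOn (hab : a ≤ b) (hA : StrictMonoOn A (Icc a b))
    (hAc : ContinuousOn A (Icc a b)) (hB : StrictMonoOn B (Icc a b))
    (hBc : ContinuousOn B (Icc a b)) (hg : ∀ t ∈ Icc a b, g (A t) = B t) :
    BijOn g (Icc (A a) (A b)) (Icc (B a) (B b)) := by
  have hA' := bijOn_Icc hab hA hAc
  refine ⟨fun x hx => ?_, (strictMonoOn hab hA hAc hB hg).injOn, fun y hy => ?_⟩
  · obtain ⟨t, ht, rfl⟩ := hA'.surjOn hx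
    rw [hg t ht]
    exact (bijOn_Icc hab hB hBc).mapsTo ht
  · obtain ⟨t, ht, rfl⟩ := (bijOn_Icc hab hB hBc).surjOn hy
    exact ⟨A t, hA'.mapsTo ht, hg t ht⟩

/-- A strictly increasing map with order-connected image is an order isomorphism onto it, hence
continuous for the order topologies. -/
theorem continuousOn (hab : a ≤ b) (hA : StrictMonoOn A (Icc a b))
    (hAc : ContinuousOn A (Icc a b)) (hB : StrictMonoOn B (Icc a b))
    (hBc : ContinuousOn B (Icc a b)) (hg : ∀ t ∈ Icc a b, g (A t) = B t) :
    ContinuousOn g (Icc (A a) (A b)) := by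
  have : OrdConnected (g '' Icc (A a) (A b)) := by
    rw [(bijOn hab hA hAc hB hBc hg).image_eq]
    infer_instance
  rw [continuousOn_iff_continuous_domRestrict]
  exact continuous_subtype_val.comp ((strictMonoOn hab hA hAc hB hg).orderIso g _).continuous

theorem sInf_eq (hab : a ≤ b) (hA : StrictMonoOn A (Icc a b))
    (hAc : ContinuousOn A (Icc a b)) (hB : StrictMonoOn B (Icc a b))
    (hg : ∀ t ∈ Icc a b, g (A t) = B t) (hmono : Monotone g) {t : ℝ} (ht : t ∈ Ioc a b) :
    sInf {r | B t ≤ g r} = A t := by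
  have ht' : t ∈ Icc a b := Ioc_subset_Icc_self ht
  refine le_antisymm (sInf_le (hg t ht').ge) (le_sInf fun r hr => ?_)
  by_contra! h
  have h0 : A a < A t := hA (left_mem_Icc.2 hab) ht' ht.1
  have htb := ((bijOn_Icc hab hA hAc).mapsTo ht').2
  -- Strict monotonicity is known only on the parametrized interval, so `r` is first raised to its
  -- left end; this stays below `A t` because t > a.
  have h1 : max r (A a) < A t := max_lt h h0
  have h2 := strictMonoOn hab hA hAc hB hg ⟨le_max_right _ _, h1.le.trans htb⟩ ⟨h0.le, htb⟩ h1
  rw [hg t ht'] at h2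
  exact absurd ((hmono (le_max_left r (A a))).trans_lt h2) (not_lt.2 hr)

end Parametric

/-! ### Level sets of the Watson density -/

namespace Watson

open Set SimplexChain Persistence

section

variable {n : ℕ} (μ : Sphere (n + 2)) {κ : ℝ}

theorem ofReal_normConst_le_density (hκ : 0 ≤ κ) (x : Sphere (n + 2)) :
    ENNReal.ofReal (normConst μ κ) ≤ density μ κ x :=
  ENNReal.ofReal_le_ofReal (le_mul_of_one_le_right (normConst_pos μ hκ).le (one_le_kernel μ hκ x))

theorem density_le (hκ : 0 ≤ κ) (x : Sphere (n + 2)) :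
    density μ κ x ≤ ENNReal.ofReal (normConst μ κ * Real.exp κ) :=
  ENNReal.ofReal_le_ofReal (mul_le_mul_of_nonneg_left (kernel_le μ hκ x) (normConst_pos μ hκ).le)

theorem sublevel_eq_empty (hκ : 0 ≤ κ) {r : EReal}
    (hr : r < (ENNReal.ofReal (normConst μ κ) : EReal)) : sublevel (density μ κ) r = ∅ :=
  eq_empty_of_forall_notMem fun x hx => absurd (hx : (density μ κ x : EReal) ≤ r)
    (not_le.2 (hr.trans_le (EReal.coe_ennreal_le_coe_ennreal_iff.2
      (ofReal_normConst_le_density μ hκ x))))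

theorem sublevel_eq_univ (hκ : 0 ≤ κ) {r : EReal}
    (hr : (ENNReal.ofReal (normConst μ κ * Real.exp κ) : EReal) ≤ r) :
    sublevel (density μ κ) r = univ :=
  eq_univ_of_forall fun x => (EReal.coe_ennreal_le_coe_ennreal_iff.2 (density_le μ hκ x)).trans hr

theorem superlevel_eq_univ (hκ : 0 ≤ κ) {r : ℝ≥0∞}
    (hr : (ENNReal.ofReal (normConst μ κ))⁻¹ ≤ r) : superlevel (density μ κ) r = univ :=
  eq_univ_of_forall fun x => (ENNReal.inv_le_iff_inv_le.1 hr).trans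
    (ofReal_normConst_le_density μ hκ x)

/-- Between its minimum and its maximum, the sublevel sets of the density are bands around the
equator. -/
theorem exists_sublevel_eq_band (hκ : 0 ≤ κ) {r : EReal}
    (hr : r ∈ Ico (ENNReal.ofReal (normConst μ κ) : EReal)
      (ENNReal.ofReal (normConst μ κ * Real.exp κ) : EReal)) :
    ∃ c : ℝ, 0 ≤ c ∧ c < 1 ∧ sublevel (density μ κ) r =
      {x : Sphere (n + 2) | |inner ℝ (x : EuclideanSpace ℝ (Fin (n + 2))) (μ : EuclideanSpace ℝ (Fin (n + 2)))|
        ≤ c} := by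
  have hd := normConst_pos μ hκ
  have hde : 0 < normConst μ κ * Real.exp κ := by positivity
  obtain ⟨s, rfl⟩ : ∃ s : ℝ, r = s := by
    refine ⟨r.toReal, (EReal.coe_toReal ?_ ?_).symm⟩
    · exact (hr.2.trans_le le_top).ne
    · rintro rfl
      exact absurd hr.1 (by simp)
  rw [EReal.coe_ennreal_ofReal, max_eq_left hd.le, EReal.coe_ennreal_ofReal, max_eq_left hde.le,
    mem_Ico, EReal.coe_le_coe_iff, EReal.coe_lt_coe_iff] at hr
  have hsd : 0 < s / normConst μ κ := div_pos (hd.trans_le hr.1) hd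
  have hlog0 : 0 ≤ Real.log (s / normConst μ κ) :=
    Real.log_nonneg ((one_le_div hd).2 hr.1)
  have hlog1 : Real.log (s / normConst μ κ) < κ :=
    (Real.log_lt_iff_lt_exp hsd).2 ((div_lt_iff₀' hd).2 hr.2)
  -- For κ = 0 the range of levels is empty, so the division by κ below is legitimate.
  have hκ' : 0 < κ := hlog0.trans_lt hlog1
  refine ⟨√(Real.log (s / normConst μ κ) / κ), Real.sqrt_nonneg _, ?_, ?_⟩
  · rw [Real.sqrt_lt' one_pos, one_pow, div_lt_one hκ']
    exact hlog1
  · ext x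
    change (density μ κ x : EReal) ≤ s ↔ |_| ≤ √_
    rw [density, kernel, EReal.coe_ennreal_ofReal, max_eq_left (by positivity),
      EReal.coe_le_coe_iff, ← le_div_iff₀' hd, ← Real.le_log_iff_exp_le hsd, ← le_div_iff₀' hκ',
      ← Real.sqrt_sq_eq_abs, Real.sqrt_le_sqrt_iff (by positivity)]

/-- Below its maximal value, the superlevel sets of the density are empty or unions of two
antipodal caps. -/
theorem acyclicAt_superlevel (F : Type u) [Field F] (hκ : 0 ≤ κ) {r : ℝ≥0∞}
    (hr : r < (ENNReal.ofReal (normConst μ κ))⁻¹) (k : ℕ) :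
    AcyclicAt F (superlevel (density μ κ) r) (k + 2) := by
  have hd := normConst_pos μ hκ
  have hempty (h : superlevel (density μ κ) r = ∅) :
      AcyclicAt F (superlevel (density μ κ) r) (k + 2) := by
    rw [h]
    exact isHomologySphere_empty.acyclicAt _ (by omega)
  rcases eq_or_ne r 0 with rfl | hr0
  · refine hempty (eq_empty_of_forall_notMem fun x hx => ?_)
    simp [superlevel, density] at hx
  set s := r⁻¹.toReal with hs
  have hrs : r⁻¹ = ENNReal.ofReal s := (ENNReal.ofReal_toReal (by simpa using hr0)).symm
  have hds : normConst μ κ < s := by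
    rw [← ENNReal.lt_inv_iff_lt_inv, hrs] at hr
    exact lt_of_not_ge fun h => absurd (ENNReal.ofReal_le_ofReal h) (not_le.2 hr)
  have hsd : 0 < s / normConst μ κ := div_pos (hd.trans hds) hd
  have hlog0 : 0 < Real.log (s / normConst μ κ) := Real.log_pos ((one_lt_div hd).2 hds)
  have hmem (x : Sphere (n + 2)) : x ∈ superlevel (density μ κ) r ↔
      Real.log (s / normConst μ κ) ≤ κ * (inner ℝ (x : EuclideanSpace ℝ (Fin (n + 2)))
        (μ : EuclideanSpace ℝ (Fin (n + 2)))) ^ 2 := by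
    change r⁻¹ ≤ density μ κ x ↔ _
    rw [hrs, density, kernel, ENNReal.ofReal_le_ofReal_iff (by positivity),
      Real.log_le_iff_le_exp hsd, div_le_iff₀' hd]
  rcases lt_or_ge κ (Real.log (s / normConst μ κ)) with hlt | hle
  · refine hempty (eq_empty_of_forall_notMem fun x hx => ?_)
    exact absurd (((hmem x).1 hx).trans (mul_le_of_le_one_right hκ (inner_sq_le_one μ x)))
      (not_le.2 hlt)
  have hκ' : 0 < κ := hlog0.trans_le hle
  set c := √(Real.log (s / normConst μ κ) / κ) with hc
  -- Positive because the level is strictly above min f; this makes the two caps disjoint.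
  have hc0 : 0 < c := Real.sqrt_pos.2 (by positivity)
  have hc1 : c ≤ 1 := Real.sqrt_le_one.2 ((div_le_one hκ').2 hle)
  have hunion : superlevel (density μ κ) r =
      {x : Sphere (n + 2) | c ≤ inner ℝ (x : EuclideanSpace ℝ (Fin (n + 2))) (μ : EuclideanSpace ℝ (Fin (n + 2)))} ∪
      {x : Sphere (n + 2) | c ≤ inner ℝ (x : EuclideanSpace ℝ (Fin (n + 2)))
        ((-μ : Sphere (n + 2)) : EuclideanSpace ℝ (Fin (n + 2)))} := by
    ext x
    rw [hmem, ← div_le_iff₀' hκ', ← Real.sqrt_le_sqrt_iff (sq_nonneg _), Real.sqrt_sq_eq_abs,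
      le_abs, coe_neg_sphere]
    simp only [mem_union, mem_ofPred_eq, inner_neg_right]
    rfl
  rw [hunion]
  refine AcyclicAt.union (isClosed_le (by fun_prop) (by fun_prop))
    (isClosed_le (by fun_prop) (by fun_prop)) ?_ (acyclicAt_cap μ hc0.le hc1 _)
    (acyclicAt_cap (-μ) hc0.le hc1 _)
  refine eq_empty_of_forall_notMem fun x hx => ?_
  obtain ⟨h1, h2⟩ := hx
  simp only [mem_ofPred_eq, coe_neg_sphere, inner_neg_right] at h1 h2
  linarith

theorem finrank_orthogonal_axis :
    Module.finrank ℝ (ℝ ∙ (μ : EuclideanSpace ℝ (Fin (n + 2))))ᗮ = n + 1 := by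
  have : Fact (Module.finrank ℝ (EuclideanSpace ℝ (Fin (n + 2))) = n + 1 + 1) := ⟨by simp⟩
  exact Submodule.finrank_orthogonal_span_singleton (ne_zero_of_mem_unit_sphere μ)

/-- The homology of the equator sits in index n + 1 > 0, so its empty simplex bounds and the equator
has a point. The field ℚ is an arbitrary choice. -/
theorem exists_inner_eq_zero : ∃ x : Sphere (n + 2),
    inner ℝ (x : EuclideanSpace ℝ (Fin (n + 2))) (μ : EuclideanSpace ℝ (Fin (n + 2))) = 0 := by
  obtain ⟨w, hw⟩ := exists_isHomologySphere_subsphere ℚ (n + 1) _ (finrank_orthogonal_axis μ)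
  obtain ⟨x, hx⟩ := (hw.acyclicAt 0 (by omega)).nonempty
  exact ⟨x, by
    rw [real_inner_comm]
    exact Submodule.mem_orthogonal_singleton_iff_inner_right.1 hx⟩

theorem isLeast_density (hκ : 0 ≤ κ) :
    IsLeast (range (density μ κ)) (ENNReal.ofReal (normConst μ κ)) := by
  refine ⟨?_, forall_mem_range.2 (ofReal_normConst_le_density μ hκ)⟩
  obtain ⟨x, hx⟩ := exists_inner_eq_zero μ
  exact ⟨x, by simp [density, kernel, hx]⟩

theorem isGreatest_density (hκ : 0 ≤ κ) :
    IsGreatest (range (density μ κ)) (ENNReal.ofReal (normConst μ κ * Real.exp κ)) :=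
  ⟨⟨μ, by simp [density, kernel]⟩, forall_mem_range.2 (density_le μ hκ)⟩

/-- One cycle of the equator is chosen before the level: the bands all retract onto the same
equator, which is what yields a single bar. -/
theorem exists_isHomologySphere_sublevel (F : Type u) [Field F] (hκ : 0 ≤ κ) :
    ∃ w : Chain F (n + 1) (Sphere (n + 2)), IsCyc w ∧ ∀ r ∈ Ico (ENNReal.ofReal (normConst μ κ) : EReal)
      (ENNReal.ofReal (normConst μ κ * Real.exp κ) : EReal),
      IsHomologySphere (sublevel (density μ κ) r) (n + 1) w := by
  obtain ⟨w, hw⟩ := exists_isHomologySphere_subsphere F (n + 1) _ (finrank_orthogonal_axis μ)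
  refine ⟨w, hw.isCyc, fun r hr => ?_⟩
  obtain ⟨c, hc0, hc1, h⟩ := exists_sublevel_eq_band μ hκ hr
  rw [h]
  exact hw.band hc0 hc1

theorem exists_isHomologySphere_univ (F : Type u) [Field F] (n : ℕ) :
    ∃ w : Chain F n (Sphere n), IsHomologySphere (univ : Set (Sphere n)) n w :=
  exists_isHomologySphere_subsphere F n ⊤ (by simp)

end

end Watson


namespace Watson

open Set SimplexChain Persistence

section

variable {n : ℕ} (μ : Sphere (n + 2)) {κ : ℝ} (F : Type u) [Field F]

/-! ### Barcodes of the Watson density -/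

theorem acyclicAt_sublevel (hκ : 0 ≤ κ) (r : EReal) {k : ℕ} (h : k + 1 ≠ n + 1)
    (h' : k + 1 ≠ n + 2) : AcyclicAt F (sublevel (density μ κ) r) (k + 1) := by
  rcases lt_or_ge r (ENNReal.ofReal (normConst μ κ) : EReal) with hr | hr
  · rw [sublevel_eq_empty μ hκ hr]
    exact isHomologySphere_empty.acyclicAt _ (by omega)
  rcases lt_or_ge r (ENNReal.ofReal (normConst μ κ * Real.exp κ) : EReal) with hr' | hr'
  · obtain ⟨w, -, hw⟩ := exists_isHomologySphere_sublevel μ F hκ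
    exact (hw r ⟨hr, hr'⟩).acyclicAt _ h
  · obtain ⟨w, hw⟩ := exists_isHomologySphere_univ F (n + 2)
    rw [sublevel_eq_univ μ hκ hr']
    exact hw.acyclicAt _ h'

theorem acyclicAt_sublevel_of_notMem_Ico (hκ : 0 ≤ κ) {r : EReal}
    (hr : r ∉ Ico (ENNReal.ofReal (normConst μ κ) : EReal)
      (ENNReal.ofReal (normConst μ κ * Real.exp κ) : EReal)) :
    AcyclicAt F (sublevel (density μ κ) r) (n + 1) := by
  rcases lt_or_ge r (ENNReal.ofReal (normConst μ κ) : EReal) with h | h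
  · rw [sublevel_eq_empty μ hκ h]
    exact isHomologySphere_empty.acyclicAt _ (by omega)
  · obtain ⟨w, hw⟩ := exists_isHomologySphere_univ F (n + 2)
    rw [sublevel_eq_univ μ hκ (not_lt.1 fun h' => hr ⟨h, h'⟩)]
    exact hw.acyclicAt _ (by omega)

theorem acyclicAt_sublevel_of_lt (hκ : 0 ≤ κ) {r : EReal}
    (hr : r < (ENNReal.ofReal (normConst μ κ * Real.exp κ) : EReal)) :
    AcyclicAt F (sublevel (density μ κ) r) (n + 2) := by
  rcases lt_or_ge r (ENNReal.ofReal (normConst μ κ) : EReal) with h | h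
  · rw [sublevel_eq_empty μ hκ h]
    exact isHomologySphere_empty.acyclicAt _ (by omega)
  · obtain ⟨w, -, hw⟩ := exists_isHomologySphere_sublevel μ F hκ
    exact (hw r ⟨h, hr⟩).acyclicAt _ (by omega)

theorem exists_mem_sublevel (κ : ℝ) : ∃ x : Sphere (n + 2),
    ∀ r ∈ Icc (ENNReal.ofReal (normConst μ κ) : EReal) ⊤, x ∈ sublevel (density μ κ) r := by
  obtain ⟨x, hx⟩ := exists_inner_eq_zero μ
  exact ⟨x, fun r hr => by simpa [sublevel, density, kernel, hx] using hr.1⟩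

theorem morse_hasBettiBarcode_top (hκ : 0 ≤ κ) :
    (morseFiltration F (density μ κ)).HasBettiBarcode (n + 1)
      {Icc (ENNReal.ofReal (normConst μ κ * Real.exp κ) : EReal) ⊤} := by
  obtain ⟨w, hw⟩ := exists_isHomologySphere_univ F (n + 2)
  refine morse_hasBettiBarcode_singleton hw.isCyc ordConnected_Icc (fun r hr => ?_) fun r hr => ?_
  · rw [sublevel_eq_univ μ hκ hr.1]
    exact hw
  · exact acyclicAt_sublevel_of_lt μ F hκ (not_le.1 fun h => hr ⟨h, le_top⟩)

theorem morse_hasBettiBarcode_equator (hκ : 0 ≤ κ) (hn : n ≠ 0) :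
    (morseFiltration F (density μ κ)).HasBettiBarcode n
      {Ico (ENNReal.ofReal (normConst μ κ) : EReal)
        (ENNReal.ofReal (normConst μ κ * Real.exp κ) : EReal)} := by
  obtain ⟨k, rfl⟩ := Nat.exists_eq_succ_of_ne_zero hn
  obtain ⟨w, hcyc, hw⟩ := exists_isHomologySphere_sublevel μ F hκ
  exact morse_hasBettiBarcode_singleton hcyc ordConnected_Ico hw
    fun r hr => acyclicAt_sublevel_of_notMem_Ico μ F hκ hr

theorem morse_hasBettiBarcode_zero_zero (hκ : 0 ≤ κ) (hn : n ≠ 0) :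
    (morseFiltration F (density μ κ)).HasBettiBarcode 0
      {Icc (ENNReal.ofReal (normConst μ κ) : EReal) ⊤} := by
  obtain ⟨x, hx⟩ := exists_mem_sublevel μ κ
  exact morse_hasBettiBarcode_degree_zero ordConnected_Icc hx
    (fun r _ => acyclicAt_sublevel μ F hκ r (by omega) (by omega))
    fun r hr => sublevel_eq_empty μ hκ (not_le.1 fun h => hr ⟨h, le_top⟩)

theorem morse_hasBettiBarcode_zero_pair (μ : Sphere 2) (hκ : 0 ≤ κ) :
    (morseFiltration F (density μ κ)).HasBettiBarcode 0
      {Icc (ENNReal.ofReal (normConst μ κ) : EReal) ⊤,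
        Ico (ENNReal.ofReal (normConst μ κ) : EReal)
          (ENNReal.ofReal (normConst μ κ * Real.exp κ) : EReal)} := by
  obtain ⟨x, hx⟩ := exists_mem_sublevel (n := 0) μ κ
  obtain ⟨w, hcyc, hw⟩ := exists_isHomologySphere_sublevel (n := 0) μ F hκ
  exact morse_hasBettiBarcode_degree_zero_pair hcyc ordConnected_Icc ordConnected_Ico
    (fun r hr => ⟨hr.1, le_top⟩) hx hw
    (fun r _ hr => acyclicAt_sublevel_of_notMem_Ico (n := 0) μ F hκ hr)
    fun r hr => sublevel_eq_empty (n := 0) μ hκ (not_le.1 fun h => hr ⟨h, le_top⟩)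

theorem morse_hasBettiBarcode_eq_zero (hκ : 0 ≤ κ) {k : ℕ} (hk : k ≠ 0) (h : k ≠ n)
    (h' : k ≠ n + 1) : (morseFiltration F (density μ κ)).HasBettiBarcode k 0 := by
  obtain ⟨l, rfl⟩ := Nat.exists_eq_succ_of_ne_zero hk
  exact morse_hasBettiBarcode_zero fun r =>
    acyclicAt_sublevel μ F hκ r (by omega) (by omega)

theorem cech_hasBettiBarcode_top (hκ : 0 ≤ κ) :
    (cechFiltration F (density μ κ)).HasBettiBarcode (n + 1)
      {Icc (((ENNReal.ofReal (normConst μ κ))⁻¹ : ℝ≥0∞) : EReal) ⊤} := by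
  obtain ⟨w, hw⟩ := exists_isHomologySphere_univ F (n + 2)
  refine cech_hasBettiBarcode_singleton ordConnected_Icc hw (fun r hr => ?_) fun r hr h0 => ?_
  · have h0 : 0 ≤ r := (EReal.coe_ennreal_nonneg _).trans hr.1
    refine ⟨h0, superlevel_eq_univ μ hκ ?_⟩
    rw [← EReal.coe_ennreal_le_coe_ennreal_iff, EReal.coe_toENNReal h0]
    exact hr.1
  · refine acyclicAt_superlevel μ F hκ ?_ n
    rw [← EReal.coe_ennreal_lt_coe_ennreal_iff, EReal.coe_toENNReal h0]
    exact not_le.1 fun h => hr ⟨h, le_top⟩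

theorem cech_hasBettiBarcode_eq_zero (hκ : 0 ≤ κ) {k : ℕ} (hk : k ≠ 0) (h : k ≠ n + 1) :
    (cechFiltration F (density μ κ)).HasBettiBarcode k 0 := by
  obtain ⟨l, rfl⟩ := Nat.exists_eq_succ_of_ne_zero hk
  refine cech_hasBettiBarcode_zero fun r => ?_
  rcases lt_or_ge r (ENNReal.ofReal (normConst μ κ))⁻¹ with hr | hr
  · exact acyclicAt_superlevel μ F hκ hr l
  · obtain ⟨w, hw⟩ := exists_isHomologySphere_univ F (n + 2)
    rw [superlevel_eq_univ μ hκ hr]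
    exact hw.acyclicAt _ (by omega)

end

/-! ### The Betti-0 function of the Watson density -/

section

variable {n : ℕ} (μ : Sphere (n + 2)) {κ : ℝ}

theorem strictMonoOn_ofReal_comp {f : ℝ → ℝ} {s : Set ℝ} (hf : StrictMonoOn f s)
    (h : ∀ t ∈ s, 0 ≤ f t) : StrictMonoOn (fun t => ENNReal.ofReal (f t)) s :=
  fun x hx _ hy hxy => (ENNReal.ofReal_lt_ofReal_iff_of_nonneg (h x hx)).2 (hf hx hy hxy)

theorem inv_ofReal_normConst (hκ : 0 ≤ κ) :
    (ENNReal.ofReal (normConst μ κ))⁻¹ =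
      ENNReal.ofReal (levelInv (normConst μ κ) κ (Real.pi / 2)) := by
  rw [← ENNReal.ofReal_inv_of_pos (normConst_pos μ hκ)]
  simp [levelInv]

theorem inv_ofReal_normConst_mul_exp (hκ : 0 ≤ κ) :
    (ENNReal.ofReal (normConst μ κ * Real.exp κ))⁻¹ =
      ENNReal.ofReal (levelInv (normConst μ κ) κ 0) := by
  have := normConst_pos μ hκ
  rw [← ENNReal.ofReal_inv_of_pos (by positivity)]
  simp [levelInv, Real.exp_neg, div_eq_inv_mul, mul_comm]

/-- No integral is evaluated: at angle π/2 the superlevel set is the whole sphere, and the density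
has mass 1. -/
theorem ofReal_angularMass_pi_div_two (hκ : 0 < κ) :
    ENNReal.ofReal (angularMass (n + 2) (normConst μ κ) κ (Real.pi / 2)) = 1 := by
  rw [← superlevelMass_levelInv μ hκ (right_mem_Icc.2 (by positivity)),
    ← inv_ofReal_normConst μ hκ.le, superlevelMass, superlevel_eq_univ μ hκ.le le_rfl,
    setLIntegral_univ, lintegral_density μ hκ.le]

theorem monotone_superlevelMass {X : Type} [MeasurableSpace X] (ν : Measure X) (f : X → ℝ≥0∞) :
    Monotone (superlevelMass ν f) :=
  fun _ _ h => lintegral_mono_set (superlevel_mono f h)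

/-- The Betti-0 function of the Watson density is the inverse of the explicit mass function. -/
theorem superlevelMass_and_bettiZero (hκ : 0 < κ) {m' M' : ℝ≥0∞}
    (hm' : m' = ENNReal.ofReal (levelInv (normConst μ κ) κ (Real.pi / 2)))
    (hM' : M' = ENNReal.ofReal (levelInv (normConst μ κ) κ 0)) :
    ContinuousOn (superlevelMass (uniform (n + 2)) (density μ κ)) (Icc M' m') ∧
    StrictMonoOn (superlevelMass (uniform (n + 2)) (density μ κ)) (Icc M' m') ∧
    BijOn (superlevelMass (uniform (n + 2)) (density μ κ)) (Icc M' m') (Icc 0 1) ∧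
    (∀ x ∈ Ioc (0 : ℝ≥0∞) 1,
      bettiZero (uniform (n + 2)) (density μ κ) x ∈ Icc M' m' ∧
      superlevelMass (uniform (n + 2)) (density μ κ)
        (bettiZero (uniform (n + 2)) (density μ κ) x) = x) ∧
    (∀ r : ℝ, ENNReal.ofReal r ∈ Icc M' m' →
      superlevelMass (uniform (n + 2)) (density μ κ) (ENNReal.ofReal r) =
        ENNReal.ofReal (angularMass (n + 2) (normConst μ κ) κ
          (Real.arccos (Real.sqrt (-(1 / κ) * Real.log (normConst μ κ * r)))))) ∧
    {q : ℝ≥0∞ × ℝ≥0∞ | q.1 ∈ Ioc 0 1 ∧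
        q.2 = bettiZero (uniform (n + 2)) (density μ κ) q.1} =
      (fun t : ℝ =>
        (ENNReal.ofReal (angularMass (n + 2) (normConst μ κ) κ t),
          ENNReal.ofReal (Real.exp (-κ * Real.cos t ^ 2) / normConst μ κ))) ''
        Ioc 0 (Real.pi / 2) := by
  subst hm' hM'
  have hd := normConst_pos μ hκ.le
  let A : ℝ → ℝ≥0∞ := fun t => ENNReal.ofReal (levelInv (normConst μ κ) κ t)
  let B : ℝ → ℝ≥0∞ := fun t => ENNReal.ofReal (angularMass (n + 2) (normConst μ κ) κ t)
  have hpi : 0 ≤ Real.pi / 2 := by positivity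
  have h0 := left_mem_Icc.2 hpi
  have h1 := right_mem_Icc.2 hpi
  have hlevel_pos (t : ℝ) : 0 < levelInv (normConst μ κ) κ t := div_pos (Real.exp_pos _) hd
  have hGm := angularMass_strictMonoOn hd n κ
  have hA : StrictMonoOn A (Icc 0 (Real.pi / 2)) := strictMonoOn_ofReal_comp (levelInv_strictMonoOn hd hκ) fun t _ => (hlevel_pos t).le
  have hAc : ContinuousOn A (Icc 0 (Real.pi / 2)) := (ENNReal.continuous_ofReal.comp
    (continuous_levelInv (normConst μ κ) κ)).continuousOn
  have hB : StrictMonoOn B (Icc 0 (Real.pi / 2)) := strictMonoOn_ofReal_comp hGm fun t ht =>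
    (angularMass_zero (n + 2) _ κ).symm.le.trans (hGm.monotoneOn h0 ht ht.1)
  have hBc : ContinuousOn B (Icc 0 (Real.pi / 2)) := (ENNReal.continuous_ofReal.comp
    (continuous_angularMass (n + 2) (normConst μ κ) κ)).continuousOn
  have hg (t : ℝ) (ht : t ∈ Icc 0 (Real.pi / 2)) :
      superlevelMass (uniform (n + 2)) (density μ κ) (A t) = B t := superlevelMass_levelInv μ hκ ht
  have hB0 : B 0 = 0 := by
    simp only [B, angularMass_zero, ENNReal.ofReal_zero]
  have hB1 : B (Real.pi / 2) = 1 := ofReal_angularMass_pi_div_two μ hκ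
  have hmono := monotone_superlevelMass (uniform (n + 2)) (density μ κ)
  have hbetti := fun t ht => Parametric.sInf_eq (t := t) hpi hA hAc hB hg hmono ht
  have hBmaps (t : ℝ) (ht : t ∈ Ioc 0 (Real.pi / 2)) :
      B t ∈ Ioc (0 : ℝ≥0∞) 1 := by
    have ht' := Ioc_subset_Icc_self ht
    constructor
    · rw [← hB0]
      exact hB h0 ht' ht.1
    · rw [← hB1]
      exact hB.monotoneOn ht' h1 ht.2
  have hBsurj (x : ℝ≥0∞) (hx : x ∈ Ioc (0 : ℝ≥0∞) 1) : ∃ t ∈ Ioc 0 (Real.pi / 2),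
      B t = x := by
    obtain ⟨t, ht, rfl⟩ := (Parametric.bijOn_Icc hpi hB hBc).surjOn (a := x)
      ⟨by simp only [hB0, zero_le], by simpa only [hB1] using hx.2⟩
    -- The parameter 0 is excluded because it has mass 0 and x > 0.
    refine ⟨t, ⟨lt_of_le_of_ne ht.1 ?_, ht.2⟩, rfl⟩
    rintro rfl
    exact hx.1.ne' hB0
  have hbij := Parametric.bijOn hpi hA hAc hB hBc hg
  simp only [hB0, hB1] at hbij
  refine ⟨Parametric.continuousOn (A := A) hpi hA hAc hB hBc hg, Parametric.strictMonoOn (A := A) hpi hA hAc hB hg,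
    hbij, fun x hx => ?_, fun r hr => ?_, ?_⟩
  · obtain ⟨t, ht, rfl⟩ := hBsurj x hx
    have ht' := Ioc_subset_Icc_self ht
    rw [bettiZero, hbetti t ht]
    exact ⟨(Parametric.bijOn_Icc hpi hA hAc).mapsTo ht', hg t ht'⟩
  · have hr0 : r ∈ Icc (levelInv (normConst μ κ) κ 0) (levelInv (normConst μ κ) κ (Real.pi / 2)) := by
      have hrpos : 0 < r := ENNReal.ofReal_pos.1
        ((ENNReal.ofReal_pos.2 (hlevel_pos 0)).trans_le hr.1)
      exact ⟨(ENNReal.ofReal_le_ofReal_iff hrpos.le).1 hr.1,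
        (ENNReal.ofReal_le_ofReal_iff (hlevel_pos _).le).1 hr.2⟩
    rw [show ENNReal.ofReal (angularMass _ _ _ _) = _ from (hg _ ⟨Real.arccos_nonneg _, 
      Real.arccos_le_pi_div_two.2 (Real.sqrt_nonneg _)⟩).symm]
    simp only [A]
    rw [levelInv_arccos hd hκ hr0]
  · ext ⟨x, y⟩
    constructor
    · rintro ⟨hx, hy⟩
      obtain ⟨t, ht, rfl⟩ := hBsurj x hx
      exact ⟨t, ht, Prod.ext rfl ((hbetti t ht).symm.trans hy.symm)⟩
    · rintro ⟨t, ht, h⟩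
      obtain ⟨rfl, rfl⟩ := Prod.mk.inj h
      exact ⟨hBmaps t ht, (hbetti t ht).symm⟩

end

end Watson

end

/-! ### The main theorem -/

open Persistence Watson in
theorem mainTheorem5 (F : Type u) [Field F] (p : ℕ) (hp : 2 ≤ p) (μ : Sphere p)
    (κ : ℝ) (hκ : 0 ≤ κ) :
    ∃ m M : ℝ≥0∞,
      -- `m = min f = d(κ)` and `M = max f = d(κ) e^κ`
      IsLeast (Set.range (density μ κ)) m ∧
      IsGreatest (Set.range (density μ κ)) M ∧
      m = ENNReal.ofReal (normConst μ κ) ∧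
      M = ENNReal.ofReal (normConst μ κ * Real.exp κ) ∧
      -- Morse filtration, `p > 2`
      (2 < p →
        (morseFiltration F (density μ κ)).HasBettiBarcode 0 {Set.Icc (m : EReal) ⊤} ∧
        (morseFiltration F (density μ κ)).HasBettiBarcode (p - 2)
          {Set.Ico (m : EReal) (M : EReal)} ∧
        (morseFiltration F (density μ κ)).HasBettiBarcode (p - 1) {Set.Icc (M : EReal) ⊤} ∧
        ∀ k : ℕ, k ≠ 0 → k ≠ p - 2 → k ≠ p - 1 →
          (morseFiltration F (density μ κ)).HasBettiBarcode k 0) ∧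
      -- Morse filtration, `p = 2`
      (p = 2 →
        (morseFiltration F (density μ κ)).HasBettiBarcode 0
          {Set.Icc (m : EReal) ⊤, Set.Ico (m : EReal) (M : EReal)} ∧
        (morseFiltration F (density μ κ)).HasBettiBarcode 1 {Set.Icc (M : EReal) ⊤} ∧
        ∀ k : ℕ, 2 ≤ k → (morseFiltration F (density μ κ)).HasBettiBarcode k 0) ∧
      -- Čech filtration, degrees at least one
      (cechFiltration F (density μ κ)).HasBettiBarcode (p - 1)
        {Set.Icc ((m⁻¹ : ℝ≥0∞) : EReal) ⊤} ∧
      (∀ k : ℕ, 1 ≤ k → k ≠ p - 1 →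
        (cechFiltration F (density μ κ)).HasBettiBarcode k 0) ∧
      -- the Betti-0 function is the inverse of `g` on `[1 / max f, 1 / min f]`, and `g` is explicit
      (0 < κ →
        ContinuousOn (superlevelMass (uniform p) (density μ κ)) (Set.Icc M⁻¹ m⁻¹) ∧
        StrictMonoOn (superlevelMass (uniform p) (density μ κ)) (Set.Icc M⁻¹ m⁻¹) ∧
        Set.BijOn (superlevelMass (uniform p) (density μ κ)) (Set.Icc M⁻¹ m⁻¹) (Set.Icc 0 1) ∧
        (∀ x ∈ Set.Ioc (0 : ℝ≥0∞) 1,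
          bettiZero (uniform p) (density μ κ) x ∈ Set.Icc M⁻¹ m⁻¹ ∧
          superlevelMass (uniform p) (density μ κ)
            (bettiZero (uniform p) (density μ κ) x) = x) ∧
        (∀ r : ℝ, ENNReal.ofReal r ∈ Set.Icc M⁻¹ m⁻¹ →
          superlevelMass (uniform p) (density μ κ) (ENNReal.ofReal r) =
            ENNReal.ofReal (angularMass p (normConst μ κ) κ
              (Real.arccos (Real.sqrt (-(1 / κ) * Real.log (normConst μ κ * r)))))) ∧
        -- parametric description of the graph of the Betti-0 function
        {q : ℝ≥0∞ × ℝ≥0∞ | q.1 ∈ Set.Ioc 0 1 ∧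
            q.2 = bettiZero (uniform p) (density μ κ) q.1} =
          (fun t : ℝ =>
            (ENNReal.ofReal (angularMass p (normConst μ κ) κ t),
              ENNReal.ofReal (Real.exp (-κ * Real.cos t ^ 2) / normConst μ κ))) ''
            Set.Ioc 0 (Real.pi / 2)) := by
  obtain ⟨n, rfl⟩ := Nat.exists_eq_add_of_le' hp
  refine ⟨ENNReal.ofReal (normConst μ κ), ENNReal.ofReal (normConst μ κ * Real.exp κ),
    isLeast_density μ hκ, isGreatest_density μ hκ, rfl, rfl, fun h => ?_, fun h => ?_,
    cech_hasBettiBarcode_top μ F hκ,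
    fun k hk hk' => cech_hasBettiBarcode_eq_zero μ F hκ (by omega) hk', fun hκ' => ?_⟩
  · exact ⟨morse_hasBettiBarcode_zero_zero μ F hκ (by omega),
      morse_hasBettiBarcode_equator μ F hκ (by omega), morse_hasBettiBarcode_top μ F hκ,
      fun k h0 h1 h2 => morse_hasBettiBarcode_eq_zero μ F hκ h0 h1 h2⟩
  · obtain rfl : n = 0 := by omega
    exact ⟨morse_hasBettiBarcode_zero_pair F μ hκ, morse_hasBettiBarcode_top μ F hκ,
      fun k hk => morse_hasBettiBarcode_eq_zero μ F hκ (by omega) (by omega) (by omega)⟩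
  · exact superlevelMass_and_bettiZero μ hκ' (inv_ofReal_normConst μ hκ)
      (inv_ofReal_normConst_mul_exp μ hκ)
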